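/- **Theorem (regret of ViOlin on two-layer networks).** *Network class.* Let $\sigma:\mathbb R\to\mathbb R$ be twice differentiable with $|\sigma|,|\sigma'|,|\sigma''|\le 1$ and $\sigma''$ $1$-Lipschitz. For $\theta=(W_1,W_2)$ with $W_1\in\mathbb R^{m\times d}$, $W_2\in\mathbb R^{1\times m}$ and $a\in\mathbb R^d$ let $\eta(\theta,a)=W_2\,\sigma(W_1a)$ and let the (regularized) reward be $\tilde\eta(\theta,a)=\eta(\theta,a)-\tfrac12\|a\|_2^2$. Let $\Theta=\{(W_1,W_2):\ \max_i\sum_j|[W_1]_{ij}|\le 1,\ \|W_2\|_1\le 1\}$ and let $\theta^\star\in\Theta$ be the unknown ground truth. Fix $\rho\ge 2$, $\zeta_g\ge 1+\rho$, $\zeta_h\ge 2$, $\zeta_3\ge 1$ (these bound $\|\nabla_a\tilde\eta\|_2$ on $\|a\|_2\le\rho$, $\|\nabla_a^2\tilde\eta\|_{\rm op}$, and the Lipschitz constant of $\nabla^2_a\tilde\eta$), and put $\kappa_1=2\zeta_g$, $\kappa_2=640\sqrt2\,\zeta_h$. *Prediction task.* For $x=(a,a',u,v)$ let $\hat y(\theta,x)=[\tilde\eta(\theta,a),\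 \tilde\eta(\theta,a'),\ \langle\nabla_a\tilde\eta(\theta,a'),u\rangle,\ \langle\nabla_a^2\tilde\eta(\theta,a')u,v\rangle]\in\mathbb R^4$ and, for $y\in\mathbb R^4$, $$\ell((x,y);\theta)=(\hat y_1-y_1)^2+(\hat y_2-y_2)^2+\min\{\kappa_1^2,(\hat y_3-y_3)^2\}+\min\{\kappa_2^2,(\hat y_4-y_4)^2\}.$$ An online learner $\mathcal R$ maps, in each round $t=1,\dots,T$, the past data $(x_i,y_i)_{i<t}$ measurably to a probability distribution $p_t$ on $\Theta$. Nature chooses $\bar x_t=(a,a')$ with $\|a\|_2,\|a'\|_2\le\rho$ depending on the past, then $\xi_t=(u_t,v_t)$ is drawn with independent $u_t,v_t\sim\mathcal N(0,I_d)$, then nature chooses $y_t\in\mathbb R^4$ with $|[y_t]_1|,|[y_t]_2|\le 1+\rho^2/2$ depending on the past and on $\xi_t$; $x_t=(\bar x_t,\xi_t)$. The expected regret is $\mathbb E\big[\sum_{t\le T}\mathbb E_{\theta\sim p_t}\ell((x_t,y_t);\theta)-\inf_{\theta\in\Theta}\sum_{t\le T}\ell((x_t,y_t);\theta)\big]$.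 The sequential Rademacher complexity is $$\mathfrak R_T=\sup_{\bar{\mathbf x},\mathbf y}\ \mathbb E_{\xi}\,\mathbb E_{\varepsilon}\Big[\sup_{\theta\in\Theta}\sum_{t=1}^T\varepsilon_t\,\ell\big(((\bar{\mathbf x}_t,\xi_t),\mathbf y_t);\theta\big)\Big],$$ where $\varepsilon_1,\dots,\varepsilon_T$ are independent uniform signs and the supremum is over all (measurable) trees whose nodes obey the bounds above, $\bar{\mathbf x}_t$ depending on $\varepsilon_{1:t-1},\xi_{1:t-1}$ and $\mathbf y_t$ on $\varepsilon_{1:t-1},\xi_{1:t}$. We say that $\mathcal R$ is *good for horizon $T$* if its expected regret against every such nature is at most $2\mathfrak R_T+1$. *Algorithm (ViOlin).* Start with $a_0$, $\|a_0\|_2\le\rho$. In round $t=1,\dots,T$: obtain $p_t=\mathcal R((x_i,y_i)_{i<t})$; play $a_t\in\arg\max_{a\in\mathbb R^d}\mathbb E_{\theta\sim p_t}[\tilde\eta(\theta,a)]$ (any measurable choice depending on $\xi_{1:t-1}$); draw $u_t,v_t\sim\mathcal N(0,I_d)$ independently; set $x_t=(a_t,a_{t-1},u_t,v_t)$ and $y_t=\hat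 y(\theta^\star,x_t)$. *Regret.* Let $\mathfrak A_{\epsilon_g,\epsilon_h}$ be the set of $a$ with $\|\nabla_a\tilde\eta(\theta^\star,a)\|_2\le\epsilon_g$ and $\lambda_{\max}(\nabla_a^2\tilde\eta(\theta^\star,a))\le\epsilon_h$, and $$\textsc{reg}_{\epsilon_g,\epsilon_h}(T)=\sum_{t=1}^T\Big(\inf_{a\in\mathfrak A_{\epsilon_g,\epsilon_h}}\tilde\eta(\theta^\star,a)-\tilde\eta(\theta^\star,a_t)\Big),\qquad \textsc{reg}(T)=\sum_{t=1}^T\Big(\sup_a\tilde\eta(\theta^\star,a)-\tilde\eta(\theta^\star,a_t)\Big).$$ *Claim.* There are $K>0$ and $q\in\mathbb N$, depending only on $\rho,\zeta_g,\zeta_h,\zeta_3$, such that for all $m,d,T$ and all $\sigma$ as above: 1. there is a learner that is good for horizon $T$ and for which the algorithm can be run, for every $\theta^\star\in\Theta$ and every $a_0$ with $\|a_0\|_2\le\rho$; 2. for every learner that is good for horizon $T$, every $\theta^\star\in\Theta$, every $a_0$ with $\|a_0\|_2\le\rho$, and every run of the algorithm: for every $0<\epsilon\le\min\{1,\zeta_3/16\}$,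 $$\mathbb E\big[\textsc{reg}_{\epsilon,6\sqrt{\zeta_3\epsilon}}(T)\big]\le K\log^q(dT+2)\,\epsilon^{-2}\,T^{3/4};$$ 3. if moreover the network is input-concave on the relevant actions, i.e. $a\mapsto\eta(\theta^\star,a)$ is concave on $\{\|a\|_2\le 2\}$, then $$\mathbb E\big[\textsc{reg}(T)\big]\le K\log^q(dT+2)\,T^{7/8}.$$ -/

import Mathlib

open MeasureTheory ProbabilityTheory

noncomputable section

namespace ViOlin

/-! ### Two-layer networks, rewards and their derivatives -/

/-- The action space `ℝᵈ` with the Euclidean norm. -/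
abbrev Act (d : ℕ) : Type := EuclideanSpace ℝ (Fin d)

/-- Parameters `(W₁, W₂)`: an `m × d` array of first-layer weights and a row of `m`
second-layer weights. -/
abbrev Param (m d : ℕ) : Type := (Fin m → Fin d → ℝ) × (Fin m → ℝ)

/-- The hypothesis class `Θ`: every row of `W₁` has `ℓ₁`-norm at most one (that is, the maximum over
the rows of the row sums of absolute values is at most one), and `‖W₂‖₁ ≤ 1`. -/
def Theta (m d : ℕ) : Set (Param m d) :=
  {θ | (∀ i, ∑ j, |θ.1 i j| ≤ 1) ∧ ∑ i, |θ.2 i| ≤ 1}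

/-- The activation is twice differentiable, `σ`, `σ'`, `σ''` are bounded by one in absolute value,
and `σ''` is `1`-Lipschitz. -/
structure IsSmoothActivation (σ : ℝ → ℝ) : Prop where
  diff : Differentiable ℝ σ
  diff_deriv : Differentiable ℝ (deriv σ)
  bound : ∀ x, |σ x| ≤ 1
  bound_deriv : ∀ x, |deriv σ x| ≤ 1
  bound_deriv2 : ∀ x, |deriv (deriv σ) x| ≤ 1
  lipschitz_deriv2 : ∀ x y, |deriv (deriv σ) x - deriv (deriv σ) y| ≤ |x - y|

/-- The two-layer network `a ↦ W₂ σ(W₁ a)`. -/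
def net {m d : ℕ} (σ : ℝ → ℝ) (θ : Param m d) (a : Act d) : ℝ :=
  ∑ i, θ.2 i * σ (∑ j, θ.1 i j * a j)

/-- The reward: the network with the `ℓ₂` regularizer, `W₂ σ(W₁ a) - ‖a‖² / 2`. -/
def reward {m d : ℕ} (σ : ℝ → ℝ) (θ : Param m d) (a : Act d) : ℝ :=
  net σ θ a - ‖a‖ ^ 2 / 2

/-- The Hessian of `f` at `a`, as a linear operator. -/
def hess {d : ℕ} (f : Act d → ℝ) (a : Act d) : Act d →L[ℝ] Act d :=
  fderiv ℝ (gradient f) a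

/-- `a` is an `(εg, εh)`-approximate local maximum of `f`: the gradient has norm at most `εg` and the
largest eigenvalue of the Hessian is at most `εh` (expressed through the quadratic form). -/
def IsApproxLocalMax {d : ℕ} (f : Act d → ℝ) (εg εh : ℝ) (a : Act d) : Prop :=
  ‖gradient f a‖ ≤ εg ∧ ∀ v : Act d, inner ℝ (hess f a v) v ≤ εh * ‖v‖ ^ 2

/-! ### The prediction task -/

/-- The adversarial part `(a, a')` of an input. -/
abbrev Pair (d : ℕ) : Type := Act d × Act d

/-- The random part `ξ = (u, v)` of an input. -/
abbrev Noise (d : ℕ) : Type := Act d × Act d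

/-- A labelled data point `((a, a', u, v), y)` with `y ∈ ℝ⁴`. -/
abbrev Data (d : ℕ) : Type := (Pair d × Noise d) × (Fin 4 → ℝ)

/-- The prediction
`[η(θ,a), η(θ,a'), ⟨∇η(θ,a'), u⟩, ⟨∇²η(θ,a') u, v⟩]` at the input `(a, a', u, v)`. -/
def predict {m d : ℕ} (σ : ℝ → ℝ) (θ : Param m d) (x : Pair d × Noise d) : Fin 4 → ℝ :=
  ![reward σ θ x.1.1,
    reward σ θ x.1.2,
    inner ℝ (gradient (reward σ θ) x.1.2) x.2.1,
    inner ℝ (hess (reward σ θ) x.1.2 x.2.1) x.2.2]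

/-- The truncated square loss with truncation levels `κ₁` and `κ₂`. -/
def loss {m d : ℕ} (σ : ℝ → ℝ) (κ₁ κ₂ : ℝ) (z : Data d) (θ : Param m d) : ℝ :=
  (predict σ θ z.1 0 - z.2 0) ^ 2 + (predict σ θ z.1 1 - z.2 1) ^ 2
    + min (κ₁ ^ 2) ((predict σ θ z.1 2 - z.2 2) ^ 2)
    + min (κ₂ ^ 2) ((predict σ θ z.1 3 - z.2 3) ^ 2)

/-- The law of the noise of `T` rounds: all `uₜ`, `vₜ` are independent standard Gaussian vectors. -/
def noiseLaw (d T : ℕ) : Measure (Fin T → Noise d) :=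
  Measure.pi fun _ => (stdGaussian (Act d)).prod (stdGaussian (Act d))

/-! ### Online learners -/

/-- A strategy of nature for `T` rounds: the pair `x t` depends on the noise of the rounds before `t`,
the label `y t` on the noise up to and including round `t`. The actions lie in the ball of radius `ρ`,
where all rewards are at most `1 + ρ² / 2` in absolute value; so are the two labels that stand for
rewards.
(Since the learner is a fixed map from histories to distributions, a choice that depends on
the distribution of the learner or on the history is a function of the past noise.) -/
structure IsStrategy {d T : ℕ} (ρ : ℝ) (x : Fin T → (Fin T → Noise d) → Pair d)
    (y : Fin T → (Fin T → Noise d) → Fin 4 → ℝ) : Prop where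
  measurable_x : ∀ t, Measurable (x t)
  measurable_y : ∀ t, Measurable (y t)
  predictable_x : ∀ t ξ ξ', (∀ s, s < t → ξ s = ξ' s) → x t ξ = x t ξ'
  adapted_y : ∀ t ξ ξ', (∀ s, s ≤ t → ξ s = ξ' s) → y t ξ = y t ξ'
  action_bound : ∀ t ξ, ‖(x t ξ).1‖ ≤ ρ ∧ ‖(x t ξ).2‖ ≤ ρ
  label_bound : ∀ t ξ, |y t ξ 0| ≤ 1 + ρ ^ 2 / 2 ∧ |y t ξ 1| ≤ 1 + ρ ^ 2 / 2

/-- A tree of depth `T`: a strategy for every sequence of signs `ε`, whose node in round `t` depends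
only on the signs of the rounds before `t`. -/
def IsTree {d T : ℕ} (ρ : ℝ) (x : Fin T → (Fin T → ℤˣ) → (Fin T → Noise d) → Pair d)
    (y : Fin T → (Fin T → ℤˣ) → (Fin T → Noise d) → Fin 4 → ℝ) : Prop :=
  (∀ ε, IsStrategy ρ (fun t => x t ε) (fun t => y t ε)) ∧
    ∀ t ε ε', (∀ s, s < t → ε s = ε' s) → x t ε = x t ε' ∧ y t ε = y t ε'

/-- The sequential Rademacher complexity of the class of losses `{ℓ(·; θ) : θ ∈ Θ}` along a tree:
the expectation over the noise and over uniform signs of the supremum over `θ ∈ Θ` of the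
signed sum of the losses. -/
def treeComplexity (m : ℕ) {d T : ℕ} (σ : ℝ → ℝ) (κ₁ κ₂ : ℝ)
    (x : Fin T → (Fin T → ℤˣ) → (Fin T → Noise d) → Pair d)
    (y : Fin T → (Fin T → ℤˣ) → (Fin T → Noise d) → Fin 4 → ℝ) : ℝ :=
  ∫ ξ, (2 ^ T : ℝ)⁻¹ * ∑ ε : Fin T → ℤˣ,
    ⨆ θ : Theta m d, ∑ t, (((ε t : ℤˣ) : ℤ) : ℝ) *
      loss σ κ₁ κ₂ ((x t ε ξ, ξ t), y t ε ξ) (θ : Param m d) ∂noiseLaw d T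

/-- The (distribution-dependent) sequential Rademacher complexity of the class of losses over `T`
rounds: the supremum over all trees. -/
def seqRademacher (m d T : ℕ) (ρ : ℝ) (σ : ℝ → ℝ) (κ₁ κ₂ : ℝ) : ℝ :=
  sSup {r | ∃ x y, IsTree ρ x y ∧ r = treeComplexity (d := d) (T := T) m σ κ₁ κ₂ x y}

/-- An online learner: in round `t` it maps the `t` data points seen so far, measurably, to a
probability distribution over `Θ`. -/
structure Learner (m d : ℕ) where
  dist : (t : ℕ) → Kernel (Fin t → Data d) (Theta m d)
  isMarkov : ∀ t, IsMarkovKernel (dist t)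

/-- The history before round `t`. -/
def history {d T : ℕ} (x : Fin T → (Fin T → Noise d) → Pair d)
    (y : Fin T → (Fin T → Noise d) → Fin 4 → ℝ) (ξ : Fin T → Noise d) (t : Fin T) :
    Fin (t : ℕ) → Data d :=
  fun s => let r : Fin T := ⟨s, s.2.trans t.2⟩
    ((x r ξ, ξ r), y r ξ)

/-- The expected regret of a learner against a strategy of nature:
`𝔼 [∑ₜ 𝔼_{θ ∼ pₜ} ℓ((xₜ, yₜ); θ) - inf_{θ ∈ Θ} ∑ₜ ℓ((xₜ, yₜ); θ)]`. -/
def onlineRegret {m d T : ℕ} (σ : ℝ → ℝ) (κ₁ κ₂ : ℝ) (R : Learner m d)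
    (x : Fin T → (Fin T → Noise d) → Pair d)
    (y : Fin T → (Fin T → Noise d) → Fin 4 → ℝ) : ℝ :=
  ∫ ξ, ((∑ t : Fin T, ∫ θ : Theta m d,
        loss σ κ₁ κ₂ ((x t ξ, ξ t), y t ξ) (θ : Param m d) ∂(R.dist t (history x y ξ t)))
      - ⨅ θ : Theta m d, ∑ t : Fin T,
          loss σ κ₁ κ₂ ((x t ξ, ξ t), y t ξ) (θ : Param m d)) ∂noiseLaw d T

/-- The guarantee on the online learner over `T` rounds: against every strategy of nature its
expected regret is at most twice the sequential Rademacher complexity of the losses, up to an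
additive slack of one. -/
def HasGuarantee {m d : ℕ} (T : ℕ) (ρ : ℝ) (σ : ℝ → ℝ) (κ₁ κ₂ : ℝ) (R : Learner m d) : Prop :=
  ∀ (x : Fin T → (Fin T → Noise d) → Pair d) (y : Fin T → (Fin T → Noise d) → Fin 4 → ℝ),
    IsStrategy ρ x y → onlineRegret σ κ₁ κ₂ R x y ≤ 2 * seqRademacher m d T ρ σ κ₁ κ₂ + 1

/-! ### The algorithm and its regret -/

/-- The pair `(aₜ, aₜ₋₁)`; the rounds `1, …, T` are indexed by `t : Fin T`, so that the action of the
round `t` is `a t.succ` and the action before it is `a t.castSucc`. -/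
def runPair {d T : ℕ} (a : Fin (T + 1) → (Fin T → Noise d) → Act d) (t : Fin T)
    (ξ : Fin T → Noise d) : Pair d :=
  (a t.succ ξ, a t.castSucc ξ)

/-- The supervision generated by the ground truth `θs`. -/
def runLabel {m d T : ℕ} (σ : ℝ → ℝ) (θs : Param m d)
    (a : Fin (T + 1) → (Fin T → Noise d) → Act d) (t : Fin T) (ξ : Fin T → Noise d) : Fin 4 → ℝ :=
  predict σ θs (runPair a t ξ, ξ t)

/-- `a` is the (random) sequence of actions of a run of ViOlin with learner `R`, ground truth `θs`
and initial action `a₀`: the action of each round is chosen on the basis of the noise of the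
earlier rounds, and it maximizes over `ℝᵈ` the expected virtual reward under the
distribution that the learner outputs on the history. Ties are broken arbitrarily. -/
structure IsRun {m d T : ℕ} (σ : ℝ → ℝ) (R : Learner m d) (θs : Param m d) (a₀ : Act d)
    (a : Fin (T + 1) → (Fin T → Noise d) → Act d) : Prop where
  measurable : ∀ t, Measurable (a t)
  init : ∀ ξ, a 0 ξ = a₀
  predictable : ∀ (t : Fin T) ξ ξ', (∀ s, s < t → ξ s = ξ' s) → a t.succ ξ = a t.succ ξ'
  argmax : ∀ (t : Fin T) ξ (b : Act d),
    ∫ θ : Theta m d, reward σ (θ : Param m d) b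
        ∂(R.dist t (history (runPair a) (runLabel σ θs a) ξ t))
      ≤ ∫ θ : Theta m d, reward σ (θ : Param m d) (a t.succ ξ)
        ∂(R.dist t (history (runPair a) (runLabel σ θs a) ξ t))

/-- The `(εg, εh)`-local regret of the actions of rounds `1, …, T` for the reward function `f`:
the comparator is the worst `(εg, εh)`-approximate local maximum of `f`. -/
def localRegret {d T : ℕ} (f : Act d → ℝ) (εg εh : ℝ)
    (a : Fin (T + 1) → (Fin T → Noise d) → Act d) (ξ : Fin T → Noise d) : ℝ :=
  ∑ t : Fin T, (sInf (f '' {b | IsApproxLocalMax f εg εh b}) - f (a t.succ ξ))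

/-- The global regret of the actions of rounds `1, …, T` for the reward function `f`:
the comparator is the largest reward. -/
def globalRegret {d T : ℕ} (f : Act d → ℝ)
    (a : Fin (T + 1) → (Fin T → Noise d) → Act d) (ξ : Fin T → Noise d) : ℝ :=
  ∑ t : Fin T, ((⨆ b, f b) - f (a t.succ ξ))

end ViOlin

end

/-! Three ingredients are combined.

Progress. Averaged over the Gaussian noise, the truncated loss of a round bounds the squared errors
of a virtual model: in the rewards of the new and the previous action, and in the gradient and
Hessian at the previous action (`gaussConst_sq_mul_le`). Since the new action maximizes the mean
virtual reward, its true reward is at least the second-order expansion of the true reward along any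
step of length at most one from the previous action, minus a cubic term and an error 2(μ + Δ/(cμ)).
Here Δ is the mean loss of the round, c = `gaussConst ^ 2`, and μ > 0 is free (`reward_progress`).
Away from approximate local maxima some step gains ε²/8 (`exists_step`); in the concave case a step
towards the maximizer gains a fixed fraction of the gap (`exists_step_of_concave`). So the gap to
the comparator contracts up to the errors, and the regret is bounded by a multiple of their sum. The
ground truth has loss zero, hence the expected sum of the Δ is an online regret, at most 2R_T + 1.
With R_T of order √T and μ = T^(-1/4), both Tμ and R_T/μ are of order T^(3/4); this holds in the
concave case too, where the claimed exponent is larger.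

Complexity. R_T is √T times a power of log(dT), for every width. Massart's lemma treats linear
functions on the ℓ₁-ball. Activations, products and truncated squares need a contraction principle
for sequential complexities, obtained by chaining. A class of complexity D√n has sequential covers
at scale 2D/2^j of logarithmic size about 4^j log T, because a forecaster built from the conditional
complexity can follow any θ at that scale with at most 4^j corrections (`exists_corrections`,
`exists_seqCover`, `SeqBound.contraction`). Products follow by polarization, and networks are
absolutely convex combinations of neurons.

Learner. A good learner comes from a minimax argument played round by round. Θ is replaced by a
finite net and a potential is defined backwards in time by symmetrized values. A separating
hyperplane yields in each round a mixed action for which the expected loss is paid for by the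
potential (`exists_mixed_action`). Nearly optimal moves of nature form a tree, which shows that the
initial potential is at most 2R_T up to a small error (`potential_le_seqRademacher`). Rounding the
cumulative losses to a grid leaves countably many states, so all choices are measurable, and the
rounding errors fit into the additive slack of one. -/

/-! ### Sequential Rademacher complexity of abstract function classes -/

namespace ViOlin

/-! ### Averages over signs -/

/-- A sign as a real number. -/
abbrev sg (e : ℤˣ) : ℝ := ((e : ℤ) : ℝ)

lemma abs_sg (e : ℤˣ) : |sg e| = 1 := by
  rcases Int.units_eq_one_or e with rfl | rfl <;> simp [sg]

/-- The average over all sequences of signs. -/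
noncomputable def signAvg {T : ℕ} (g : (Fin T → ℤˣ) → ℝ) : ℝ := (2 ^ T : ℝ)⁻¹ * ∑ ε, g ε

lemma signAvg_mono {T : ℕ} {g h : (Fin T → ℤˣ) → ℝ} (H : ∀ ε, g ε ≤ h ε) :
    signAvg g ≤ signAvg h :=
  mul_le_mul_of_nonneg_left (Finset.sum_le_sum fun ε _ => H ε) (by positivity)

lemma signAvg_const (T : ℕ) (c : ℝ) : signAvg (fun _ : Fin T → ℤˣ => c) = c := by
  simp [signAvg]

lemma signAvg_add {T : ℕ} (g h : (Fin T → ℤˣ) → ℝ) :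
    signAvg (fun ε => g ε + h ε) = signAvg g + signAvg h := by
  simp [signAvg, Finset.sum_add_distrib, mul_add]

lemma signAvg_const_mul {T : ℕ} (c : ℝ) (g : (Fin T → ℤˣ) → ℝ) :
    signAvg (fun ε => c * g ε) = c * signAvg g := by
  simp [signAvg, ← Finset.mul_sum]; ring

lemma signAvg_sum {T : ℕ} {ι : Type*} (s : Finset ι) (g : ι → (Fin T → ℤˣ) → ℝ) :
    signAvg (fun ε => ∑ i ∈ s, g i ε) = ∑ i ∈ s, signAvg (g i) := by
  simp only [signAvg, Finset.mul_sum]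
  rw [Finset.sum_comm]

lemma signAvg_zero (g : (Fin 0 → ℤˣ) → ℝ) (ε : Fin 0 → ℤˣ) : signAvg g = g ε := by
  simpa [signAvg] using congrArg g (Subsingleton.elim _ _)

lemma signAvg_succ {T : ℕ} (g : (Fin (T + 1) → ℤˣ) → ℝ) :
    signAvg g = 1 / 2 * (signAvg (fun ε : Fin T → ℤˣ => g (Fin.cons 1 ε))
      + signAvg (fun ε : Fin T → ℤˣ => g (Fin.cons (-1) ε))) := by
  have h : ∑ ε, g ε = ∑ e : ℤˣ, ∑ ε : Fin T → ℤˣ, g (Fin.cons e ε) := by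
    rw [← Fintype.sum_prod_type' (fun (e : ℤˣ) (ε : Fin T → ℤˣ) => g (Fin.cons e ε))]
    exact (Fintype.sum_equiv (Fin.consEquiv fun _ => ℤˣ) _ _ fun x => rfl).symm
  simp only [signAvg, h, UnitsInt.univ]
  rw [Finset.sum_pair (by decide), pow_succ, mul_inv]
  ring

/-- A process that in round `t` depends only on the signs of the rounds before `t`. -/
def Predictable {T : ℕ} {α : Type*} (w : Fin T → (Fin T → ℤˣ) → α) : Prop :=
  ∀ t ε ε', (∀ s, s < t → ε s = ε' s) → w t ε = w t ε'

lemma Predictable.tail {T : ℕ} {α : Type*} {w : Fin (T + 1) → (Fin (T + 1) → ℤˣ) → α}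
    (hw : Predictable w) (e : ℤˣ) :
    Predictable fun (t : Fin T) ε => w t.succ (Fin.cons e ε) := by
  intro t ε ε' h
  refine hw _ _ _ fun s hs => ?_
  induction s using Fin.cases with
  | zero => rfl
  | succ s => simpa using h s (by simpa using hs)

lemma Predictable.comp {T : ℕ} {α β : Type*} {w : Fin T → (Fin T → ℤˣ) → α}
    (hw : Predictable w) (F : α → β) : Predictable fun t ε => F (w t ε) :=
  fun t ε ε' h => congrArg F (hw t ε ε' h)

lemma Predictable.comp₂ {T : ℕ} {α β γ : Type*} {w : Fin T → (Fin T → ℤˣ) → α}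
    {w' : Fin T → (Fin T → ℤˣ) → β} (hw : Predictable w) (hw' : Predictable w') (F : α → β → γ) :
    Predictable fun t ε => F (w t ε) (w' t ε) :=
  fun t ε ε' h => by simp only [hw t ε ε' h, hw' t ε ε' h]

/-- Azuma–Hoeffding by induction on the rounds, peeling off the first sign: the first node is a
constant `w0`, averaging over its sign gives `cosh w0 ≤ exp (c ^ 2 / 2)`, and both subtrees are
again predictable. -/
lemma signAvg_exp_le {T : ℕ} (w : Fin T → (Fin T → ℤˣ) → ℝ) (hw : Predictable w) {c : ℝ}
    (hc : ∀ t ε, |w t ε| ≤ c) :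
    signAvg (fun ε => Real.exp (∑ t, sg (ε t) * w t ε)) ≤ Real.exp (T * (c ^ 2 / 2)) := by
  induction T with
  | zero => simp [signAvg]
  | succ T ih =>
    set w0 : ℝ := w 0 1 with hw0
    have h0 : ∀ ε, w 0 ε = w0 := fun ε => hw 0 _ _ fun s hs => absurd hs (Fin.not_lt_zero s)
    have key : ∀ e : ℤˣ, signAvg (fun ε : Fin T → ℤˣ =>
        Real.exp (∑ t, sg ((Fin.cons e ε : Fin (T + 1) → ℤˣ) t) * w t (Fin.cons e ε)))
        ≤ Real.exp (sg e * w0) * Real.exp (T * (c ^ 2 / 2)) := by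
      intro e
      refine le_trans (le_of_eq ?_) (mul_le_mul_of_nonneg_left
        (ih (fun t ε => w t.succ (Fin.cons e ε)) (hw.tail e) fun t ε => hc _ _)
        (Real.exp_pos _).le)
      rw [← signAvg_const_mul]
      congr 1
      ext ε
      rw [Fin.sum_univ_succ, ← Real.exp_add, h0]
      simp
    rw [signAvg_succ]
    have h1 := key 1
    have h2 := key (-1)
    have h3 : Real.cosh w0 ≤ Real.exp (c ^ 2 / 2) := by
      refine (Real.cosh_le_exp_half_sq w0).trans (Real.exp_le_exp.2 ?_)
      have := sq_le_sq' (by linarith [abs_le.1 (hc 0 1)] : -c ≤ w0) (abs_le.1 (hc 0 1)).2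
      linarith
    rw [Real.cosh_eq] at h3
    have h4 : Real.exp ((T + 1 : ℕ) * (c ^ 2 / 2))
        = Real.exp (c ^ 2 / 2) * Real.exp (T * (c ^ 2 / 2)) := by
      rw [← Real.exp_add]; congr 1; push_cast; ring
    rw [h4]
    simp only [sg, Units.val_one, Int.cast_one, one_mul, Units.val_neg, Int.cast_neg,
      neg_mul] at h1 h2
    have h5 := mul_le_mul_of_nonneg_right h3 (Real.exp_pos (T * (c ^ 2 / 2))).le
    linarith

/-- Massart's lemma for predictable processes. -/
lemma signAvg_iSup_le {T : ℕ} {ι : Type*} [Fintype ι] [Nonempty ι]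
    (w : ι → Fin T → (Fin T → ℤˣ) → ℝ) (hw : ∀ i, Predictable (w i)) {c : ℝ} (hc0 : 0 ≤ c)
    (hc : ∀ i t ε, |w i t ε| ≤ c) :
    signAvg (fun ε => ⨆ i, |∑ t, sg (ε t) * w i t ε|)
      ≤ c * √(2 * Real.log (2 * Fintype.card ι)) * √T := by
  rcases hc0.eq_or_lt with rfl | hcpos
  · have : ∀ i t ε, w i t ε = 0 := fun i t ε => abs_nonpos_iff.1 (hc i t ε)
    simp [this, signAvg]
  rcases Nat.eq_zero_or_pos T with rfl | hT
  · simp [signAvg]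
  set n : ℝ := 2 * Fintype.card ι with hn
  have hn2 : 2 ≤ n := by
    have : (1 : ℝ) ≤ Fintype.card ι := by exact_mod_cast Fintype.card_pos (α := ι)
    linarith
  have hlog : 0 < Real.log n := Real.log_pos (by linarith)
  set h := √(2 * Real.log n) with hh
  have hhpos : 0 < h := Real.sqrt_pos.2 (by linarith)
  have hh2 : h ^ 2 = 2 * Real.log n := Real.sq_sqrt (by linarith)
  have hTpos : (0 : ℝ) < √T := Real.sqrt_pos.2 (by exact_mod_cast hT)
  have hT2 : √(T : ℝ) ^ 2 = T := Real.sq_sqrt (by positivity)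
  -- The inverse temperature that minimizes the bound; `n` counts every process twice because of the
  -- absolute values.
  set l := h / (c * √T) with hl
  have hlpos : 0 < l := by positivity
  set b := Real.log n + T * ((l * c) ^ 2 / 2) with hb
  -- In place of Jensen's inequality, the tangent line bound `x ≤ exp (x - b) + b - 1`, with `b`
  -- such that the averaged exponential term is at most one.
  have hpt : ∀ ε : Fin T → ℤˣ, l * (⨆ i, |∑ t, sg (ε t) * w i t ε|) ≤
      Real.exp (-b) * (∑ i, (Real.exp (∑ t, sg (ε t) * (l * w i t ε))
        + Real.exp (∑ t, sg (ε t) * (-l * w i t ε)))) + (b - 1) := by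
    intro ε
    obtain ⟨i, hi⟩ := exists_eq_ciSup_of_finite (f := fun i => |∑ t, sg (ε t) * w i t ε|)
    rw [← hi]
    have e1 : ∑ t, sg (ε t) * (l * w i t ε) = l * ∑ t, sg (ε t) * w i t ε := by
      rw [Finset.mul_sum]; exact Finset.sum_congr rfl fun _ _ => by ring
    have e2 : ∑ t, sg (ε t) * (-l * w i t ε) = -(l * ∑ t, sg (ε t) * w i t ε) := by
      rw [Finset.mul_sum, ← Finset.sum_neg_distrib]; exact Finset.sum_congr rfl fun _ _ => by ring
    have h1 : Real.exp (l * |∑ t, sg (ε t) * w i t ε|) ≤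
        Real.exp (∑ t, sg (ε t) * (l * w i t ε)) + Real.exp (∑ t, sg (ε t) * (-l * w i t ε)) := by
      rw [e1, e2]
      rcases abs_cases (∑ t, sg (ε t) * w i t ε) with ⟨h, -⟩ | ⟨h, -⟩ <;> rw [h]
      · linarith [Real.exp_pos (-(l * ∑ t, sg (ε t) * w i t ε))]
      · rw [mul_neg]; linarith [Real.exp_pos (l * ∑ t, sg (ε t) * w i t ε)]
    have h2 := h1.trans (Finset.single_le_sum (f := fun i =>
        Real.exp (∑ t, sg (ε t) * (l * w i t ε)) + Real.exp (∑ t, sg (ε t) * (-l * w i t ε)))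
        (fun i _ => by positivity) (Finset.mem_univ i))
    have h3 := Real.add_one_le_exp (-b + l * |∑ t, sg (ε t) * w i t ε|)
    rw [Real.exp_add] at h3
    have h4 := mul_le_mul_of_nonneg_left h2 (Real.exp_pos (-b)).le
    linarith
  have h1 := signAvg_mono hpt
  rw [signAvg_const_mul, signAvg_add, signAvg_const, signAvg_const_mul, signAvg_sum] at h1
  have h2 : ∀ i, signAvg (fun ε => Real.exp (∑ t, sg (ε t) * (l * w i t ε))
        + Real.exp (∑ t, sg (ε t) * (-l * w i t ε))) ≤ 2 * Real.exp (T * ((l * c) ^ 2 / 2)) := by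
    intro i
    rw [signAvg_add]
    have a1 := signAvg_exp_le (fun t ε => l * w i t ε) ((hw i).comp (l * ·)) (c := l * c)
      fun t ε => by rw [abs_mul, abs_of_pos hlpos]; gcongr; exact hc i t ε
    have a2 := signAvg_exp_le (fun t ε => -l * w i t ε) ((hw i).comp (-l * ·)) (c := l * c)
      fun t ε => by rw [abs_mul, abs_neg, abs_of_pos hlpos]; gcongr; exact hc i t ε
    linarith
  have h3 := Finset.sum_le_sum fun i (_ : i ∈ Finset.univ) => h2 i
  rw [Finset.sum_const, nsmul_eq_mul, Finset.card_univ] at h3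
  have h4 : Real.exp (-b) * (Fintype.card ι * (2 * Real.exp (T * ((l * c) ^ 2 / 2)))) = 1 := by
    have : Fintype.card ι * (2 * Real.exp (T * ((l * c) ^ 2 / 2))) = Real.exp b := by
      rw [hb, Real.exp_add, Real.exp_log (by linarith)]; ring
    rw [this, ← Real.exp_add]; simp
  have h5 := mul_le_mul_of_nonneg_left h3 (Real.exp_pos (-b)).le
  rw [h4] at h5
  have h6 : l * signAvg (fun ε => ⨆ i, |∑ t, sg (ε t) * w i t ε|) ≤ b := by linarith
  have h7 : b = l * (c * h * √T) := by
    have : l * (c * √T) = h := by rw [hl]; field_simp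
    calc b = Real.log n + (l * (c * √T)) ^ 2 / 2 := by rw [hb, mul_pow, mul_pow, mul_pow, hT2]; ring
      _ = h * h := by rw [this]; nlinarith
      _ = _ := by nth_rewrite 1 [← this]; ring
  rw [h7] at h6
  exact le_of_mul_le_mul_left h6 hlpos

/-! ### Sequential Rademacher bounds for classes of functions -/

/-- `𝓕` is a class of functions on `Θ` that are bounded by `b` and whose sequential Rademacher
complexity over `n ≤ N` rounds is at most `D √n`. -/
structure SeqBound {Θ : Type*} (N : ℕ) (𝓕 : Set (Θ → ℝ)) (b D : ℝ) : Prop where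
  bdd : ∀ f ∈ 𝓕, ∀ θ, |f θ| ≤ b
  avg : ∀ T ≤ N, ∀ f : Fin T → (Fin T → ℤˣ) → Θ → ℝ, Predictable f → (∀ t ε, f t ε ∈ 𝓕) →
    signAvg (fun ε => ⨆ θ, |∑ t, sg (ε t) * f t ε θ|) ≤ D * √T

lemma abs_sum_sg_le {T : ℕ} (ε : Fin T → ℤˣ) (x : Fin T → ℝ) {b : ℝ} (hx : ∀ t, |x t| ≤ b) :
    |∑ t, sg (ε t) * x t| ≤ T * b := by
  refine (Finset.abs_sum_le_sum_abs _ _).trans ((Finset.sum_le_card_nsmul _ _ b ?_).trans ?_)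
  · intro t _; rw [abs_mul, abs_sg, one_mul]; exact hx t
  · simp

lemma bddAbove_abs_sum {Θ : Type*} {T : ℕ} (ε : Fin T → ℤˣ) (f : Fin T → Θ → ℝ) {b : ℝ}
    (hf : ∀ t θ, |f t θ| ≤ b) : BddAbove (Set.range fun θ => |∑ t, sg (ε t) * f t θ|) :=
  ⟨T * b, by rintro _ ⟨θ, rfl⟩; exact abs_sum_sg_le ε _ fun t => hf t θ⟩

variable {Θ Θ' : Type*} {N : ℕ}

lemma SeqBound.mono {𝓕 𝓖 : Set (Θ → ℝ)} {b D b' D' : ℝ} (h : SeqBound N 𝓕 b D) (hs : 𝓖 ⊆ 𝓕)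
    (hb : b ≤ b') (hD : D ≤ D') : SeqBound N 𝓖 b' D' where
  bdd f hf θ := (h.bdd f (hs hf) θ).trans hb
  avg T hT f hp hf := (h.avg T hT f hp fun t ε => hs (hf t ε)).trans (by gcongr)

/-- The two components are chosen once for each function of `𝓖`, not for each node, so the trees of
components inherit predictability. The same device serves in the other closure properties. -/
lemma SeqBound.lin [Nonempty Θ] {𝓕₁ 𝓕₂ 𝓖 : Set (Θ → ℝ)} {b₁ b₂ D₁ D₂ : ℝ}
    (h₁ : SeqBound N 𝓕₁ b₁ D₁) (h₂ : SeqBound N 𝓕₂ b₂ D₂) (α β : ℝ)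
    (hg : ∀ g ∈ 𝓖, ∃ f₁ ∈ 𝓕₁, ∃ f₂ ∈ 𝓕₂, ∀ θ, g θ = α * f₁ θ + β * f₂ θ) :
    SeqBound N 𝓖 (|α| * b₁ + |β| * b₂) (|α| * D₁ + |β| * D₂) where
  bdd g hg' θ := by
    obtain ⟨f₁, hf₁, f₂, hf₂, e⟩ := hg g hg'
    rw [e]
    refine (abs_add_le _ _).trans ?_
    rw [abs_mul, abs_mul]
    gcongr
    exacts [h₁.bdd _ hf₁ θ, h₂.bdd _ hf₂ θ]
  avg T hT f hp hf := by
    have hg' : ∀ g : 𝓖, ∃ f₁ ∈ 𝓕₁, ∃ f₂ ∈ 𝓕₂, ∀ θ, (g : Θ → ℝ) θ = α * f₁ θ + β * f₂ θ :=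
      fun g => hg g g.2
    choose F₁ hF₁ F₂ hF₂ e using hg'
    have hp' : Predictable fun t ε => (⟨f t ε, hf t ε⟩ : 𝓖) :=
      fun t ε ε' h => Subtype.ext (hp t ε ε' h)
    have k₁ := h₁.avg T hT (fun t ε => F₁ ⟨f t ε, hf t ε⟩) (hp'.comp F₁) fun t ε => hF₁ _
    have k₂ := h₂.avg T hT (fun t ε => F₂ ⟨f t ε, hf t ε⟩) (hp'.comp F₂) fun t ε => hF₂ _
    have hpt : ∀ ε : Fin T → ℤˣ, (⨆ θ, |∑ t, sg (ε t) * f t ε θ|) ≤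
        |α| * (⨆ θ, |∑ t, sg (ε t) * F₁ ⟨f t ε, hf t ε⟩ θ|)
          + |β| * (⨆ θ, |∑ t, sg (ε t) * F₂ ⟨f t ε, hf t ε⟩ θ|) := by
      intro ε
      refine ciSup_le fun θ => ?_
      have : ∑ t, sg (ε t) * f t ε θ = α * (∑ t, sg (ε t) * F₁ ⟨f t ε, hf t ε⟩ θ)
          + β * (∑ t, sg (ε t) * F₂ ⟨f t ε, hf t ε⟩ θ) := by
        rw [Finset.mul_sum, Finset.mul_sum, ← Finset.sum_add_distrib]
        refine Finset.sum_congr rfl fun t _ => ?_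
        rw [show f t ε θ = _ from e ⟨f t ε, hf t ε⟩ θ]; ring
      rw [this]
      refine (abs_add_le _ _).trans ?_
      rw [abs_mul, abs_mul]
      gcongr
      · exact le_ciSup (bddAbove_abs_sum ε _ fun t θ => h₁.bdd _ (hF₁ _) θ) θ
      · exact le_ciSup (bddAbove_abs_sum ε _ fun t θ => h₂.bdd _ (hF₂ _) θ) θ
    refine (signAvg_mono hpt).trans ?_
    rw [signAvg_add, signAvg_const_mul, signAvg_const_mul, add_mul, mul_assoc, mul_assoc]
    gcongr

/-- Passing to absolutely convex combinations of functions does not increase the complexity. -/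
lemma SeqBound.hull [Nonempty Θ] {m : ℕ} {𝓕 : Set (Θ' → ℝ)} {𝓖 : Set (Θ → ℝ)} {b D : ℝ}
    (h : SeqBound N 𝓕 b D) (hb : 0 ≤ b) (c : Θ → Fin m → ℝ) (w : Θ → Fin m → Θ')
    (hc : ∀ θ, ∑ i, |c θ i| ≤ 1)
    (hg : ∀ g ∈ 𝓖, ∃ f ∈ 𝓕, ∀ θ, g θ = ∑ i, c θ i * f (w θ i)) :
    SeqBound N 𝓖 b D where
  bdd g hg' θ := by
    obtain ⟨f, hf, e⟩ := hg g hg'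
    rw [e]
    calc |∑ i, c θ i * f (w θ i)| ≤ ∑ i, |c θ i| * b := by
          refine (Finset.abs_sum_le_sum_abs _ _).trans (Finset.sum_le_sum fun i _ => ?_)
          rw [abs_mul]; gcongr; exact h.bdd f hf _
      _ ≤ b := by rw [← Finset.sum_mul]; exact mul_le_of_le_one_left hb (hc θ)
  avg T hT f hp hf := by
    have hg' : ∀ g : 𝓖, ∃ f ∈ 𝓕, ∀ θ, (g : Θ → ℝ) θ = ∑ i, c θ i * f (w θ i) := fun g => hg g g.2
    choose F hF e using hg'
    have hp' : Predictable fun t ε => (⟨f t ε, hf t ε⟩ : 𝓖) :=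
      fun t ε ε' h => Subtype.ext (hp t ε ε' h)
    refine le_trans (signAvg_mono fun ε => ?_)
      (h.avg T hT (fun t ε => F ⟨f t ε, hf t ε⟩) (hp'.comp F) fun t ε => hF _)
    refine ciSup_le fun θ => ?_
    have : ∑ t, sg (ε t) * f t ε θ
        = ∑ i, c θ i * ∑ t, sg (ε t) * F ⟨f t ε, hf t ε⟩ (w θ i) := by
      simp only [Finset.mul_sum]
      rw [Finset.sum_comm]
      refine Finset.sum_congr rfl fun t _ => ?_
      rw [show f t ε θ = _ from e ⟨f t ε, hf t ε⟩ θ, Finset.mul_sum]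
      exact Finset.sum_congr rfl fun i _ => by ring
    rw [this]
    set S := ⨆ θ', |∑ t, sg (ε t) * F ⟨f t ε, hf t ε⟩ θ'|
    have hS : ∀ θ', |∑ t, sg (ε t) * F ⟨f t ε, hf t ε⟩ θ'| ≤ S := fun θ' =>
      le_ciSup (bddAbove_abs_sum ε _ fun t θ => h.bdd _ (hF _) θ) θ'
    calc |∑ i, c θ i * ∑ t, sg (ε t) * F ⟨f t ε, hf t ε⟩ (w θ i)| ≤ ∑ i, |c θ i| * S := by
          refine (Finset.abs_sum_le_sum_abs _ _).trans (Finset.sum_le_sum fun i _ => ?_)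
          rw [abs_mul]; gcongr; exact hS _
      _ ≤ S := by
          rw [← Finset.sum_mul]
          exact mul_le_of_le_one_left (Real.iSup_nonneg fun _ => abs_nonneg _) (hc θ)

/-- Linear functions on the `ℓ₁`-ball. -/
lemma SeqBound.linear {d : ℕ} (N : ℕ) {b : ℝ} (hb : 0 ≤ b) :
    SeqBound N {f : {w : Fin d → ℝ // ∑ j, |w j| ≤ 1} → ℝ |
      ∃ z : Fin d → ℝ, (∀ j, |z j| ≤ b) ∧ ∀ w, f w = ∑ j, (w : Fin d → ℝ) j * z j} b
      (b * √(2 * Real.log (2 * d))) where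
  bdd f hf w := by
    obtain ⟨z, hz, e⟩ := hf
    rw [e]
    calc |∑ j, w.1 j * z j| ≤ ∑ j, |w.1 j| * b := by
          refine (Finset.abs_sum_le_sum_abs _ _).trans (Finset.sum_le_sum fun i _ => ?_)
          rw [abs_mul]; gcongr; exact hz i
      _ ≤ b := by rw [← Finset.sum_mul]; exact mul_le_of_le_one_left hb w.2
  avg T hT f hp hf := by
    have : Nonempty {w : Fin d → ℝ // ∑ j, |w j| ≤ 1} := ⟨⟨0, by simp⟩⟩
    rcases Nat.eq_zero_or_pos d with rfl | hd
    · have : ∀ t ε w, f t ε w = 0 := fun t ε w => by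
        obtain ⟨z, -, e⟩ := hf t ε
        simp [e]
      simp [this, signAvg]
    have : Nonempty (Fin d) := ⟨⟨0, hd⟩⟩
    set 𝓕 := {f : {w : Fin d → ℝ // ∑ j, |w j| ≤ 1} → ℝ |
      ∃ z : Fin d → ℝ, (∀ j, |z j| ≤ b) ∧ ∀ w, f w = ∑ j, (w : Fin d → ℝ) j * z j} with h𝓕
    have hg' : ∀ g : 𝓕, ∃ z : Fin d → ℝ, (∀ j, |z j| ≤ b) ∧
      ∀ w, g.1 w = ∑ j, (w : Fin d → ℝ) j * z j := fun g => g.2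
    choose Z hZ e using hg'
    have hp' : Predictable fun t ε => (⟨f t ε, hf t ε⟩ : 𝓕) :=
      fun t ε ε' h => Subtype.ext (hp t ε ε' h)
    -- By duality of ℓ₁ and ℓ∞ the supremum over the ball is at most the largest of `d` coordinate
    -- processes, to which Massart's lemma applies.
    have k := signAvg_iSup_le (fun j t ε => Z ⟨f t ε, hf t ε⟩ j)
      (fun j => hp'.comp fun g => Z g j) hb fun j t ε => hZ _ j
    rw [Fintype.card_fin] at k
    refine le_trans (signAvg_mono fun ε => ciSup_le fun w => ?_) k
    have : ∑ t, sg (ε t) * f t ε w = ∑ j, w.1 j * ∑ t, sg (ε t) * Z ⟨f t ε, hf t ε⟩ j := by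
      simp only [Finset.mul_sum]
      rw [Finset.sum_comm]
      refine Finset.sum_congr rfl fun t _ => ?_
      rw [show f t ε w = _ from e ⟨f t ε, hf t ε⟩ w, Finset.mul_sum]
      exact Finset.sum_congr rfl fun i _ => by ring
    rw [this]
    set S := ⨆ j, |∑ t, sg (ε t) * Z ⟨f t ε, hf t ε⟩ j|
    calc |∑ j, w.1 j * ∑ t, sg (ε t) * Z ⟨f t ε, hf t ε⟩ j| ≤ ∑ j, |w.1 j| * S := by
          refine (Finset.abs_sum_le_sum_abs _ _).trans (Finset.sum_le_sum fun i _ => ?_)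
          rw [abs_mul]; gcongr
          exact le_ciSup (f := fun j => |∑ t, sg (ε t) * Z ⟨f t ε, hf t ε⟩ j|)
            (Set.finite_range _).bddAbove i
      _ ≤ S := by
          rw [← Finset.sum_mul]
          exact mul_le_of_le_one_left (Real.iSup_nonneg fun _ => abs_nonneg _) w.2

end ViOlin

namespace ViOlin

variable {Θ : Type*}

/-! ### A potential for online prediction -/

/-- The trees of depth `n` with nodes in `𝓕`. -/
abbrev FTree (𝓕 : Set (Θ → ℝ)) (n : ℕ) : Type _ :=
  {f : Fin n → (Fin n → ℤˣ) → Θ → ℝ // Predictable f ∧ ∀ t ε, f t ε ∈ 𝓕}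

/-- The conditional sequential Rademacher complexity with `n` rounds to go. -/
noncomputable def seqPot (𝓕 : Set (Θ → ℝ)) (n : ℕ) (A : Θ → ℝ) : ℝ :=
  ⨆ f : FTree 𝓕 n, signAvg fun ε => ⨆ θ, |A θ + ∑ t, sg (ε t) * f.1 t ε θ|

lemma abs_add_sum_le {T : ℕ} (ε : Fin T → ℤˣ) (x : Fin T → ℝ) {a b y : ℝ} (hy : |y| ≤ a)
    (hx : ∀ t, |x t| ≤ b) : |y + ∑ t, sg (ε t) * x t| ≤ a + T * b :=
  (abs_add_le _ _).trans (add_le_add hy (abs_sum_sg_le ε x hx))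

lemma bddAbove_seqPot [Nonempty Θ] {𝓕 : Set (Θ → ℝ)} {b : ℝ} (hb : ∀ f ∈ 𝓕, ∀ θ, |f θ| ≤ b)
    (n : ℕ) {A : Θ → ℝ} {a : ℝ} (hA : ∀ θ, |A θ| ≤ a) :
    BddAbove (Set.range fun f : FTree 𝓕 n =>
      signAvg fun ε => ⨆ θ, |A θ + ∑ t, sg (ε t) * f.1 t ε θ|) := by
  refine ⟨a + n * b, ?_⟩
  rintro _ ⟨f, rfl⟩
  rw [← signAvg_const n (a + n * b)]
  exact signAvg_mono fun ε => ciSup_le fun θ =>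
    abs_add_sum_le ε _ (hA θ) fun t => hb _ (f.2.2 t ε) θ

/-- This is the terminal inequality of the potential argument: it makes running out of updates in
`exists_corrections` contradictory. -/
lemma le_seqPot_zero [Nonempty Θ] {𝓕 : Set (Θ → ℝ)} {b : ℝ} (hb : ∀ f ∈ 𝓕, ∀ θ, |f θ| ≤ b)
    {A : Θ → ℝ} {a : ℝ} (hA : ∀ θ, |A θ| ≤ a) (θ : Θ) : A θ ≤ seqPot 𝓕 0 A := by
  let f : FTree 𝓕 0 := ⟨fun t => t.elim0, fun t => t.elim0, fun t => t.elim0⟩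
  refine le_trans ?_ (le_ciSup (bddAbove_seqPot hb 0 hA) f)
  rw [signAvg_zero _ 1]
  refine le_trans ?_ (le_ciSup (f := fun θ => |A θ + ∑ t, sg _ * f.1 t 1 θ|)
    ⟨a + (0 : ℕ) * b, ?_⟩ θ)
  · simpa using le_abs_self (A θ)
  · rintro _ ⟨θ, rfl⟩
    exact abs_add_sum_le _ _ (hA θ) fun t => t.elim0

lemma seqPot_le [Nonempty Θ] {𝓕 : Set (Θ → ℝ)} {N : ℕ} {b D : ℝ} (h : SeqBound N 𝓕 b D)
    (hD : 0 ≤ D) {n : ℕ} (hn : n ≤ N) : seqPot 𝓕 n 0 ≤ D * √n := by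
  refine Real.iSup_le (fun f => ?_) (by positivity)
  simpa using h.avg n hn f.1 f.2.1 f.2.2

/-- Nearly optimal trees for `A + f` and `A - f` are glued below the root `f`; the first sign
selects the subtree. -/
lemma seqPot_step [Nonempty Θ] {𝓕 : Set (Θ → ℝ)} {b : ℝ} (hb : ∀ f ∈ 𝓕, ∀ θ, |f θ| ≤ b)
    (n : ℕ) {A : Θ → ℝ} {a : ℝ} (hA : ∀ θ, |A θ| ≤ a) {f : Θ → ℝ} (hf : f ∈ 𝓕) :
    1 / 2 * (seqPot 𝓕 n (A + f) + seqPot 𝓕 n (A - f)) ≤ seqPot 𝓕 (n + 1) A := by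
  have : Nonempty (FTree 𝓕 n) := ⟨⟨fun _ _ => f, fun _ _ _ _ => rfl, fun _ _ => hf⟩⟩
  refine le_of_forall_pos_lt_add fun δ hδ => ?_
  obtain ⟨g, hg⟩ := exists_lt_of_lt_ciSup (show seqPot 𝓕 n (A + f) - δ < seqPot 𝓕 n (A + f) by
    linarith)
  obtain ⟨g', hg'⟩ := exists_lt_of_lt_ciSup (show seqPot 𝓕 n (A - f) - δ < seqPot 𝓕 n (A - f) by
    linarith)
  let F : Fin (n + 1) → (Fin (n + 1) → ℤˣ) → Θ → ℝ := fun t ε =>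
    Fin.cases f (fun t => if ε 0 = 1 then g.1 t (Fin.tail ε) else g'.1 t (Fin.tail ε)) t
  have hF : Predictable F ∧ ∀ t ε, F t ε ∈ 𝓕 := by
    constructor
    · intro t ε ε' h
      induction t using Fin.cases with
      | zero => rfl
      | succ t =>
        have h0 := h 0 (Fin.succ_pos t)
        have h1 : ∀ s, s < t → Fin.tail ε s = Fin.tail ε' s := fun s hs => h s.succ (by simpa)
        simp only [F, Fin.cases_succ, h0, g.2.1 t _ _ h1, g'.2.1 t _ _ h1]
    · intro t ε
      induction t using Fin.cases with
      | zero => exact hf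
      | succ t =>
        simp only [F, Fin.cases_succ]
        split_ifs
        exacts [g.2.2 _ _, g'.2.2 _ _]
  have h1 : signAvg (fun ε => ⨆ θ, |A θ + ∑ t, sg (ε t) * F t ε θ|) ≤ seqPot 𝓕 (n + 1) A :=
    le_ciSup (bddAbove_seqPot hb (n + 1) hA) ⟨F, hF⟩
  rw [signAvg_succ] at h1
  have e1 : (fun ε : Fin n → ℤˣ => ⨆ θ, |A θ + ∑ t,
      sg ((Fin.cons 1 ε : Fin (n + 1) → ℤˣ) t) * F t (Fin.cons 1 ε) θ|)
      = fun ε => ⨆ θ, |(A + f) θ + ∑ t, sg (ε t) * g.1 t ε θ| := by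
    ext ε
    congr 1; ext θ
    rw [Fin.sum_univ_succ]
    simp [F, sg, add_assoc]
  have e2 : (fun ε : Fin n → ℤˣ => ⨆ θ, |A θ + ∑ t,
      sg ((Fin.cons (-1) ε : Fin (n + 1) → ℤˣ) t) * F t (Fin.cons (-1) ε) θ|)
      = fun ε => ⨆ θ, |(A - f) θ + ∑ t, sg (ε t) * g'.1 t ε θ| := by
    ext ε
    congr 1; ext θ
    rw [Fin.sum_univ_succ]
    simp [F, sg, add_assoc, sub_eq_add_neg]
  rw [e1, e2] at h1
  linarith

/-! ### A forecaster that makes few mistakes -/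

/-- The forecast in a state: the number of updates that are left and the sum of the updates. -/
noncomputable def forecast (𝓕 : Set (Θ → ℝ)) (st : ℕ × (Θ → ℝ)) (f : Θ → ℝ) : ℝ :=
  1 / 2 * (seqPot 𝓕 (st.1 - 1) (st.2 + f) - seqPot 𝓕 (st.1 - 1) (st.2 - f))

open Classical in
/-- The forecaster updates its state when it is told a value that is far from the forecast. -/
noncomputable def forecastStep (𝓕 : Set (Θ → ℝ)) (st : ℕ × (Θ → ℝ)) (f : Θ → ℝ) :
    Option ℝ → ℕ × (Θ → ℝ)
  | none => st
  | some v => if forecast 𝓕 st f < v then (st.1 - 1, st.2 + f) else (st.1 - 1, st.2 - f)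

/-- The states of the forecaster along the functions `z` and the corrections `p`. -/
noncomputable def forecastRun (𝓕 : Set (Θ → ℝ)) (M : ℕ) (z : ℕ → Θ → ℝ) (p : ℕ → Option ℝ) :
    ℕ → ℕ × (Θ → ℝ)
  | 0 => (M, 0)
  | t + 1 => forecastStep 𝓕 (forecastRun 𝓕 M z p t) (z t) (p t)

/-- The predictions of the forecaster, after corrections. -/
noncomputable def prediction (𝓕 : Set (Θ → ℝ)) (M : ℕ) (z : ℕ → Θ → ℝ) (p : ℕ → Option ℝ)
    (t : ℕ) : ℝ :=
  (p t).getD (forecast 𝓕 (forecastRun 𝓕 M z p t) (z t))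

lemma forecastRun_congr (𝓕 : Set (Θ → ℝ)) (M : ℕ) {z z' : ℕ → Θ → ℝ} {p p' : ℕ → Option ℝ}
    (t : ℕ) (hz : ∀ s < t, z s = z' s) (hp : ∀ s < t, p s = p' s) :
    forecastRun 𝓕 M z p t = forecastRun 𝓕 M z' p' t := by
  induction t with
  | zero => rfl
  | succ t ih =>
    simp only [forecastRun]
    rw [ih (fun s hs => hz s (by omega)) (fun s hs => hp s (by omega)), hz t (by omega),
      hp t (by omega)]

lemma prediction_congr (𝓕 : Set (Θ → ℝ)) (M : ℕ) {z z' : ℕ → Θ → ℝ} {p p' : ℕ → Option ℝ}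
    (t : ℕ) (hz : ∀ s ≤ t, z s = z' s) (hp : ∀ s ≤ t, p s = p' s) :
    prediction 𝓕 M z p t = prediction 𝓕 M z' p' t := by
  simp only [prediction]
  rw [forecastRun_congr 𝓕 M t (fun s hs => hz s hs.le) (fun s hs => hp s hs.le), hz t le_rfl,
    hp t le_rfl]

open Classical in
/-- The states of the forecaster when it is corrected by the values of `θ`, rounded by `r`. -/
noncomputable def correctedRun (𝓕 : Set (Θ → ℝ)) (M : ℕ) (z : ℕ → Θ → ℝ) (e : ℝ) (r : ℝ → ℝ)
    (θ : Θ) : ℕ → ℕ × (Θ → ℝ)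
  | 0 => (M, 0)
  | t + 1 => forecastStep 𝓕 (correctedRun 𝓕 M z e r θ t) (z t)
      (if |z t θ - forecast 𝓕 (correctedRun 𝓕 M z e r θ t) (z t)| ≤ e then none
        else some (r (z t θ)))

/-- The forecast y is half the difference of the potentials after the updates `A + f` and `A - f`,
so by `seqPot_step` these updates raise the potential by at most y and -y respectively. An update
occurs only when the true value lies more than `e` from y, on the side towards which the state
moves; the value of `θ` then gains more than `e` over the growth of the potential. Since the initial
potential is below `e * M`, there is no room for `M` updates. -/
lemma exists_corrections [Nonempty Θ] {𝓕 : Set (Θ → ℝ)} {b : ℝ}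
    (hb : ∀ f ∈ 𝓕, ∀ θ, |f θ| ≤ b) {M T : ℕ} (hM : 0 < M) {z : ℕ → Θ → ℝ}
    (hz : ∀ t < T, z t ∈ 𝓕) {e : ℝ} (hpot : seqPot 𝓕 M 0 < e * M) {r : ℝ → ℝ}
    (hr : ∀ x, |x| ≤ b → |r x - x| ≤ e) (θ : Θ) :
    ∃ p : ℕ → Option ℝ, (∀ t < T, |prediction 𝓕 M z p t - z t θ| ≤ e) ∧
      (∀ t v, p t = some v → v = r (z t θ)) ∧
      ((Finset.range T).filter fun t => p t ≠ none).card ≤ M := by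
  classical
  let run := correctedRun 𝓕 M z e r θ
  let p : ℕ → Option ℝ := fun t =>
    if |z t θ - forecast 𝓕 (run t) (z t)| ≤ e then none else some (r (z t θ))
  have hrun : ∀ t, forecastRun 𝓕 M z p t = run t := by
    intro t
    induction t with
    | zero => rfl
    | succ t ih => simp only [forecastRun, ih]; rfl
  refine ⟨p, fun t ht => ?_, fun t v hv => ?_, ?_⟩
  · simp only [prediction, hrun]
    by_cases h : |z t θ - forecast 𝓕 (run t) (z t)| ≤ e
    · simp only [p, if_pos h, Option.getD_none]
      rwa [abs_sub_comm]
    · simp only [p, if_neg h, Option.getD_some]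
      exact hr _ (hb _ (hz t ht) θ)
  · by_cases h : |z t θ - forecast 𝓕 (run t) (z t)| ≤ e
    · simp [p, h] at hv
    · simpa [p, h] using hv.symm
  -- `c` is the sum of the forecasts at the updates so far, with the sign of the update: the
  -- potential has grown by at most `c`, while the cumulative value at `θ` exceeds `c` by at least
  -- `e` per update.
  have inv : ∀ t ≤ T, ∃ c : ℝ,
      (run t).1 + ((Finset.range t).filter fun t => p t ≠ none).card = M ∧ 0 < (run t).1 ∧
      (∀ θ, |(run t).2 θ| ≤ t * b) ∧ seqPot 𝓕 (run t).1 (run t).2 ≤ seqPot 𝓕 M 0 + c ∧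
      e * (M - (run t).1) ≤ (run t).2 θ - c := by
    intro t
    induction t with
    | zero => intro _; exact ⟨0, by simp [run, correctedRun, hM]⟩
    | succ t ih =>
      intro ht
      obtain ⟨c, h1, h2, h3, h4, h5⟩ := ih (by omega)
      have hzt := hz t (by omega)
      have hb0 : 0 ≤ b := (abs_nonneg _).trans (hb _ hzt θ)
      have hstep : run (t + 1) = forecastStep 𝓕 (run t) (z t) (p t) := rfl
      by_cases h : |z t θ - forecast 𝓕 (run t) (z t)| ≤ e
      · have hp : p t = none := by simp [p, h]
        have hs : run (t + 1) = run t := by rw [hstep, hp]; rfl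
        refine ⟨c, ?_, by rwa [hs], fun θ => ?_, by rwa [hs], by rwa [hs]⟩
        · rw [hs, Finset.range_add_one, Finset.filter_insert, if_neg (by simp [hp])]
          exact h1
        · rw [hs]; push_cast; linarith [h3 θ]
      · have hp : p t = some (r (z t θ)) := by simp [p, h]
        obtain ⟨k, hk⟩ : ∃ k, (run t).1 = k + 1 := ⟨(run t).1 - 1, by omega⟩
        have hcard : ((Finset.range (t + 1)).filter fun t => p t ≠ none).card
            = ((Finset.range t).filter fun t => p t ≠ none).card + 1 := by
          rw [Finset.range_add_one, Finset.filter_insert, if_pos (by simp [hp]),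
            Finset.card_insert_of_notMem (by simp)]
        have hpstep := seqPot_step hb k h3 hzt
        rw [← hk] at hpstep
        set y := forecast 𝓕 (run t) (z t) with hy
        have hy' : y = 1 / 2 * (seqPot 𝓕 k ((run t).2 + z t) - seqPot 𝓕 k ((run t).2 - z t)) := by
          rw [hy, forecast, hk, Nat.add_sub_cancel]
        have hrz := abs_le.1 (hr _ (hb _ hzt θ))
        rw [hk] at h5
        push_cast at h5
        have conclude : ∀ (A : Θ → ℝ) (c' : ℝ), run (t + 1) = (k, A) →
            (∀ θ, |A θ| ≤ (t + 1 : ℕ) * b) → seqPot 𝓕 k A ≤ seqPot 𝓕 M 0 + c' →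
            e * (M - k) < A θ - c' → ∃ c : ℝ,
            (run (t + 1)).1 + ((Finset.range (t + 1)).filter fun t => p t ≠ none).card = M ∧
            0 < (run (t + 1)).1 ∧ (∀ θ, |(run (t + 1)).2 θ| ≤ (t + 1 : ℕ) * b) ∧
            seqPot 𝓕 (run (t + 1)).1 (run (t + 1)).2 ≤ seqPot 𝓕 M 0 + c ∧
            e * (M - (run (t + 1)).1) ≤ (run (t + 1)).2 θ - c := by
          intro A c' hr1 hA hpotA hlt
          refine ⟨c', ?_, ?_, ?_, ?_, ?_⟩
          · rw [hr1, hcard]; simp only; omega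
          · rw [hr1]
            rcases Nat.eq_zero_or_pos k with rfl | hk0
            · exfalso
              have := le_seqPot_zero hb hA θ
              simp only [Nat.cast_zero, sub_zero] at hlt
              linarith
            · exact hk0
          · rw [hr1]; exact hA
          · rw [hr1]; exact hpotA
          · rw [hr1]; exact hlt.le
        by_cases hlt : y < r (z t θ)
        · refine conclude ((run t).2 + z t) (c + y) ?_ (fun θ => ?_) ?_ ?_
          · rw [hstep, hp, forecastStep, if_pos hlt, hk]; rfl
          · refine (abs_add_le _ _).trans ?_
            push_cast
            linarith [h3 θ, hb _ hzt θ]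
          · linarith
          -- Rounding moves a value by at most `e`, so the rounded value lies on the same side of
          -- the forecast as the true one.
          · have : e < z t θ - y := by
              rcases lt_abs.1 (not_le.1 h) with h | h <;> linarith
            simp only [Pi.add_apply]
            linarith
        · refine conclude ((run t).2 - z t) (c - y) ?_ (fun θ => ?_) ?_ ?_
          · rw [hstep, hp, forecastStep, if_neg hlt, hk]; rfl
          · refine (abs_sub _ _).trans ?_
            push_cast
            linarith [h3 θ, hb _ hzt θ]
          · linarith
          · have : e < y - z t θ := by
              rcases lt_abs.1 (not_le.1 h) with h | h <;> linarith
            simp only [Pi.sub_apply]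
            linarith
  obtain ⟨c, h1, -⟩ := inv T le_rfl
  omega

end ViOlin

namespace ViOlin

variable {Θ : Type*}

/-! ### Sequential covers and contraction -/

/-- A class with sequential Rademacher complexity `D √n` has sequential covers at scale `2 D / 2ʲ`
whose logarithmic size is of order `4ʲ`. -/
lemma exists_seqCover [Nonempty Θ] {𝓕 : Set (Θ → ℝ)} {N : ℕ} {b D : ℝ} (h : SeqBound N 𝓕 b D)
    (hbD : b ≤ D) (hD : 0 < D) {T : ℕ} (hT : T ≤ N) (f : Fin T → (Fin T → ℤˣ) → Θ → ℝ)
    (hp : Predictable f) (hf : ∀ t ε, f t ε ∈ 𝓕) {j : ℕ} (hj : 4 ^ j ≤ T) :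
    ∃ (V : Type) (_ : Fintype V) (_ : Nonempty V) (v : V → Fin T → (Fin T → ℤˣ) → ℝ),
      Fintype.card V ≤ (2 * T) ^ (2 * 4 ^ j) ∧ (∀ i, Predictable (v i)) ∧
      ∀ ε θ, ∃ i, ∀ t, |v i t ε - f t ε θ| ≤ 2 * D / 2 ^ j := by
  classical
  -- With `M = 4 ^ j` corrections the potential is at most D√M = D·2^j, half of `η * M`.
  set M := 4 ^ j with hMdef
  have hM : 0 < M := by positivity
  set G := 2 * 2 ^ j + 1 with hG
  set η : ℝ := 2 * D / 2 ^ j with hη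
  have hηpos : 0 < η := by positivity
  -- Grid points of spacing `η` on [-2D, 2D], enough for functions bounded by `b ≤ D`.
  let val : Fin G → ℝ := fun i => ((i : ℕ) - (2 : ℝ) ^ j) * η
  have hround : ∀ x : ℝ, ∃ i : Fin G, |x| ≤ b → |val i - x| ≤ η := by
    intro x
    by_cases hx : |x| ≤ b
    · have hx' := abs_le.1 (hx.trans hbD)
      have h0 : 0 ≤ x / η + 2 ^ j := by
        have : -(2 ^ j : ℝ) * η ≤ x := by
          have : (2 ^ j : ℝ) * η = 2 * D := by rw [hη]; field_simp
          linarith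
        have := (le_div_iff₀ hηpos).2 this
        linarith
      have h1 : x / η + 2 ^ j ≤ 2 * 2 ^ j := by
        have : x ≤ (2 ^ j : ℝ) * η := by
          have : (2 ^ j : ℝ) * η = 2 * D := by rw [hη]; field_simp
          linarith
        have := (div_le_iff₀ hηpos).2 this
        linarith
      refine ⟨⟨⌊x / η + 2 ^ j⌋₊, ?_⟩, fun _ => ?_⟩
      · rw [hG, Nat.lt_succ_iff]
        exact Nat.floor_le_of_le (by push_cast; exact h1)
      · have a1 := Nat.floor_le h0
        have a2 := Nat.lt_floor_add_one (x / η + 2 ^ j)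
        have e : x = x / η * η := by field_simp
        simp only [val]
        rw [abs_le]
        constructor <;> nlinarith
    · exact ⟨⟨0, by omega⟩, fun h => absurd h hx⟩
  choose rd hrd using hround
  let r : ℝ → ℝ := fun x => val (rd x)
  -- An element of the cover is a list of at most `M` corrections, each a round with a rounded
  -- value; replaying the forecaster with these corrections gives a predictable process. Since `2 ^
  -- j ≤ T`, there are at most (2T)² possibilities for each entry.
  let V := Fin M → Option (Fin T × Fin G)
  -- If several entries name the same round an arbitrary one is used; for the lists that matter they
  -- all carry the same value.
  let dec : V → ℕ → Option ℝ := fun v t =>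
    if h : ∃ k x, v k = some x ∧ (x.1 : ℕ) = t then some (val h.choose_spec.choose.2) else none
  let z : (Fin T → ℤˣ) → ℕ → Θ → ℝ := fun ε s => if h : s < T then f ⟨s, h⟩ ε else 0
  have hz : ∀ ε, ∀ t < T, z ε t ∈ 𝓕 := fun ε t ht => by simp only [z, dif_pos ht]; exact hf _ _
  have hpot : seqPot 𝓕 M 0 < η * M := by
    refine (seqPot_le h hD.le (hj.trans hT)).trans_lt ?_
    have e1 : √(M : ℝ) = 2 ^ j := by
      rw [hMdef]; push_cast
      rw [show (4 : ℝ) ^ j = (2 ^ j) ^ 2 by rw [← pow_mul, mul_comm, pow_mul]; norm_num]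
      exact Real.sqrt_sq (by positivity)
    have e2 : η * M = 2 * D * 2 ^ j := by
      rw [hMdef, hη]; push_cast
      rw [show (4 : ℝ) ^ j = (2 ^ j) ^ 2 by rw [← pow_mul, mul_comm, pow_mul]; norm_num]
      field_simp
    rw [e1, e2]
    have : 0 < D * 2 ^ j := by positivity
    linarith
  refine ⟨V, inferInstance, ⟨fun _ => none⟩, fun v t ε => prediction 𝓕 M (z ε) (dec v) t,
    ?_, ?_, ?_⟩
  · have hT1 : 1 ≤ T := hM.trans_le hj
    have h2 : 2 ^ j ≤ T := le_trans (Nat.pow_le_pow_left (by norm_num) j) hj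
    simp only [V, Fintype.card_fun, Fintype.card_fin, Fintype.card_option, Fintype.card_prod]
    rw [pow_mul]
    refine Nat.pow_le_pow_left ?_ _
    rw [hG]
    nlinarith
  · intro v t ε ε' he
    refine prediction_congr 𝓕 M _ (fun s hs => ?_) fun _ _ => rfl
    have hs' : s < T := hs.trans_lt t.2
    simp only [z, dif_pos hs']
    exact hp _ _ _ fun u hu => he u (lt_of_lt_of_le hu hs)
  · intro ε θ
    obtain ⟨p, h1, h2, h3⟩ := exists_corrections h.bdd hM (hz ε) hpot (r := r)
      (fun x hx => hrd x hx) θ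
    set S := (Finset.range T).filter fun t => p t ≠ none with hS
    have hSlt : ∀ t ∈ S, t < T := fun t ht => Finset.mem_range.1 (Finset.mem_filter.1 ht).1
    let v : V := fun k => if hk : (k : ℕ) < S.card then
        some (⟨S.equivFin.symm ⟨k, hk⟩, hSlt _ (S.equivFin.symm ⟨k, hk⟩).2⟩,
          rd (z ε (S.equivFin.symm ⟨k, hk⟩) θ))
      else none
    have hv : ∀ k x, v k = some x → (x.1 : ℕ) ∈ S ∧ x.2 = rd (z ε x.1 θ) := by
      intro k x hx
      by_cases hk : (k : ℕ) < S.card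
      · simp only [v, dif_pos hk, Option.some.injEq] at hx
        subst hx
        exact ⟨(S.equivFin.symm ⟨k, hk⟩).2, rfl⟩
      · simp [v, dif_neg hk] at hx
    have hdec : ∀ t < T, dec v t = p t := by
      intro t ht
      by_cases hex : ∃ k x, v k = some x ∧ (x.1 : ℕ) = t
      · have e1 : dec v t = some (val hex.choose_spec.choose.2) := dif_pos hex
        obtain ⟨e2, e3⟩ := hex.choose_spec.choose_spec
        obtain ⟨e4, e5⟩ := hv _ _ e2
        rw [e3] at e4 e5
        obtain ⟨y, hy⟩ := Option.ne_none_iff_exists'.1 (Finset.mem_filter.1 e4).2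
        rw [e1, hy, h2 t y hy, e5]
      · have e1 : dec v t = none := dif_neg hex
        rw [e1]
        by_contra hne
        have htS : t ∈ S := Finset.mem_filter.2 ⟨Finset.mem_range.2 ht, Ne.symm hne⟩
        have hlt := (S.equivFin ⟨t, htS⟩).2
        refine hex ⟨⟨S.equivFin ⟨t, htS⟩, hlt.trans_le h3⟩, (⟨t, ht⟩, rd (z ε t θ)), ?_, rfl⟩
        simp only [v, dif_pos hlt]
        simp
    refine ⟨v, fun t => ?_⟩
    have e1 : prediction 𝓕 M (z ε) (dec v) t = prediction 𝓕 M (z ε) p t :=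
      prediction_congr 𝓕 M _ (fun _ _ => rfl) fun s hs => hdec s (hs.trans_lt t.2)
    have e2 : z ε t = f t ε := by simp [z]
    have := h1 t t.2
    rw [e2] at this
    simp only [e1]
    exact this

lemma abs_max_min_le (c x : ℝ) (hc : 0 ≤ c) : |max (-c) (min c x)| ≤ c := by
  rw [abs_le]
  exact ⟨le_max_left _ _, max_le (by linarith) (min_le_left _ _)⟩

lemma max_min_eq {c x : ℝ} (h : |x| ≤ c) : max (-c) (min c x) = x := by
  rw [min_eq_right (abs_le.1 h).2, max_eq_right (abs_le.1 h).1]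

/-- Equal values of `f` force equal values of `g`, so `g` is a Lipschitz function of `f` on the
range of `f`. The extension to ℝ is needed because the chaining evaluates it at points of the
covers, which need not be values of `f`. -/
lemma exists_lipschitz_factor (f g : Θ → ℝ) [Nonempty Θ] {L : ℝ} (hL : 0 ≤ L)
    (h : ∀ θ θ', |g θ - g θ'| ≤ L * |f θ - f θ'|) :
    ∃ φ : ℝ → ℝ, (∀ x y, |φ x - φ y| ≤ L * |x - y|) ∧ ∀ θ, g θ = φ (f θ) := by
  have key : ∀ θ, g (Function.invFun f (f θ)) = g θ := by
    intro θ
    have h1 : f (Function.invFun f (f θ)) = f θ := Function.invFun_eq ⟨θ, rfl⟩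
    have h2 := h (Function.invFun f (f θ)) θ
    rw [h1, sub_self, abs_zero, mul_zero] at h2
    exact sub_eq_zero.1 (abs_nonpos_iff.1 h2)
  have h1 : LipschitzOnWith L.toNNReal (fun x => g (Function.invFun f x)) (Set.range f) := by
    refine LipschitzOnWith.of_dist_le_mul ?_
    rintro _ ⟨θ, rfl⟩ _ ⟨θ', rfl⟩
    rw [Real.dist_eq, Real.dist_eq, key, key, Real.coe_toNNReal _ hL]
    exact h θ θ'
  obtain ⟨φ, hφ, e⟩ := h1.extend_real
  refine ⟨φ, fun x y => ?_, fun θ => ?_⟩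
  · have := hφ.dist_le_mul x y
    rwa [Real.dist_eq, Real.dist_eq, Real.coe_toNNReal _ hL] at this
  · rw [← e ⟨θ, rfl⟩]; exact (key θ).symm

/-- Contraction for sequential Rademacher complexities, up to logarithmic factors: composing the
functions of a class with Lipschitz functions that may depend on the node. -/
theorem SeqBound.contraction [Nonempty Θ] {𝓕 𝓖 : Set (Θ → ℝ)} {N : ℕ} {b D : ℝ}
    (h : SeqBound N 𝓕 b D) (hbD : b ≤ D) (hD : 0 < D) {b' L l : ℝ} (hb' : 0 ≤ b') (hL : 0 ≤ L)
    (hl : 1 ≤ l) (hN : Real.log (2 * N) ≤ l) (hbdd : ∀ g ∈ 𝓖, ∀ θ, |g θ| ≤ b')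
    (hg : ∀ g ∈ 𝓖, ∃ f ∈ 𝓕, ∀ θ θ', |g θ - g θ'| ≤ L * |f θ - f θ'|) :
    SeqBound N 𝓖 b' (3 * b' * l + 30 * L * D * l ^ 2) where
  bdd := hbdd
  avg T hT g hp hg𝓖 := by
    rcases Nat.eq_zero_or_pos T with rfl | hT0
    · simp [signAvg]
    have hg' : ∀ g : 𝓖, ∃ f ∈ 𝓕, ∃ φ : ℝ → ℝ, (∀ x y, |φ x - φ y| ≤ L * |x - y|) ∧
        ∀ θ, (g : Θ → ℝ) θ = φ (f θ) := fun g => by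
      obtain ⟨f, hf, hfg⟩ := hg g g.2
      exact ⟨f, hf, exists_lipschitz_factor f g hL hfg⟩
    choose F hF Φ hΦ hgΦ using hg'
    have hp' : Predictable fun t ε => (⟨g t ε, hg𝓖 t ε⟩ : 𝓖) :=
      fun t ε ε' h => Subtype.ext (hp t ε ε' h)
    set f : Fin T → (Fin T → ℤˣ) → Θ → ℝ := fun t ε => F ⟨g t ε, hg𝓖 t ε⟩ with hfdef
    set φ : Fin T → (Fin T → ℤˣ) → ℝ → ℝ := fun t ε => Φ ⟨g t ε, hg𝓖 t ε⟩ with hφdef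
    have hpf : Predictable f := hp'.comp F
    have hpφ : Predictable φ := hp'.comp Φ
    have hgf : ∀ t ε θ, g t ε θ = φ t ε (f t ε θ) := fun t ε θ => hgΦ ⟨g t ε, hg𝓖 t ε⟩ θ
    -- The finest scale for which `exists_seqCover` applies; since √T ≤ 2·2^J, the remaining
    -- approximation error over `T` rounds is still of order √T.
    set J := Nat.log 4 T with hJ
    have hJT : 4 ^ J ≤ T := Nat.pow_log_le_self 4 hT0.ne'
    have hTJ : T < 4 ^ (J + 1) := Nat.lt_pow_succ_log_self (by norm_num) T
    have hcov : ∀ j : Fin (J + 1), ∃ (V : Type) (_ : Fintype V) (_ : Nonempty V)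
        (v : V → Fin T → (Fin T → ℤˣ) → ℝ),
        Fintype.card V ≤ (2 * T) ^ (2 * 4 ^ (j : ℕ)) ∧ (∀ i, Predictable (v i)) ∧
        ∀ ε θ, ∃ i, ∀ t, |v i t ε - f t ε θ| ≤ 2 * D / 2 ^ (j : ℕ) := fun j =>
      exists_seqCover h hbD hD hT f hpf (fun t ε => hF _)
        ((Nat.pow_le_pow_right (by norm_num) (Nat.lt_succ_iff.1 j.2)).trans hJT)
    choose V instF instN v hcard hpv hcov using hcov
    have hTpos : (1 : ℝ) ≤ T := by exact_mod_cast hT0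
    have hlogT : Real.log (2 * T) ≤ l := by
      refine le_trans (Real.log_le_log (by linarith) ?_) hN
      have : (T : ℝ) ≤ N := by exact_mod_cast hT
      linarith
    have hlogT0 : 0 < Real.log (2 * T) := Real.log_pos (by linarith)
    have hlogV : ∀ j, Real.log (Fintype.card (V j)) ≤ 2 * 4 ^ (j : ℕ) * l := by
      intro j
      have hpos : 0 < Fintype.card (V j) := Fintype.card_pos
      have : Real.log (Fintype.card (V j)) ≤ Real.log ((2 * T : ℝ) ^ (2 * 4 ^ (j : ℕ))) :=
        Real.log_le_log (by exact_mod_cast hpos) (by exact_mod_cast hcard j)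
      rw [Real.log_pow] at this
      push_cast at this
      refine this.trans ?_
      gcongr
    have hlog2 : Real.log 2 ≤ l := (Real.log_le_log (by norm_num) (by linarith)).trans hlogT
    -- the coarsest scale
    set c0 := b' + 2 * L * D with hc0
    have hc0pos : 0 ≤ c0 := by positivity
    -- The processes are truncated because cover elements far from the tree are not controlled;
    -- along the chain that approximates an actual θ the truncation is inactive.
    let w0 : V 0 → Fin T → (Fin T → ℤˣ) → ℝ := fun i t ε => max (-c0) (min c0 (φ t ε (v 0 i t ε)))
    have k0 := signAvg_iSup_le w0
      (fun i => hpφ.comp₂ (hpv 0 i) fun φ x => max (-c0) (min c0 (φ x))) hc0pos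
      fun i t ε => abs_max_min_le _ _ hc0pos
    -- the links of the chain
    let cj : ℕ → ℝ := fun j => 4 * L * D / 2 ^ j
    have hcj : ∀ j, 0 ≤ cj j := fun j => by positivity
    let w : (j : Fin J) → V j.castSucc × V j.succ → Fin T → (Fin T → ℤˣ) → ℝ := fun j i t ε =>
      max (-cj j) (min (cj j) (φ t ε (v j.succ i.2 t ε) - φ t ε (v j.castSucc i.1 t ε)))
    have kj : ∀ j, signAvg (fun ε => ⨆ i, |∑ t, sg (ε t) * w j i t ε|)
        ≤ cj j * √(2 * Real.log (2 * Fintype.card (V j.castSucc × V j.succ))) * √T := by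
      intro j
      refine signAvg_iSup_le (w j) (fun i => ?_) (hcj j) fun i t ε => abs_max_min_le _ _ (hcj j)
      exact (hpφ.comp₂ (hpv j.succ i.2) fun φ x => φ x).comp₂
        (hpφ.comp₂ (hpv j.castSucc i.1) fun φ x => φ x)
        fun x y => max (-cj j) (min (cj j) (x - y))
    -- the chain
    have hpt : ∀ ε : Fin T → ℤˣ, (⨆ θ, |∑ t, sg (ε t) * g t ε θ|) ≤
        (⨆ i, |∑ t, sg (ε t) * w0 i t ε|) + ∑ j, (⨆ i, |∑ t, sg (ε t) * w j i t ε|)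
          + T * (L * (2 * D / 2 ^ J)) := by
      intro ε
      refine ciSup_le fun θ => ?_
      choose i hi using fun j => hcov j ε θ
      have e0 : ∀ t, w0 (i 0) t ε = φ t ε (v 0 (i 0) t ε) := by
        intro t
        refine max_min_eq ?_
        have h1 := hΦ ⟨g t ε, hg𝓖 t ε⟩ (v 0 (i 0) t ε) (f t ε θ)
        have h2 := hbdd _ (hg𝓖 t ε) θ
        rw [hgf] at h2
        have h3 := mul_le_mul_of_nonneg_left (hi 0 t) hL
        simp only [Fin.val_zero, pow_zero, div_one] at h3
        have h4 := abs_sub_abs_le_abs_sub (φ t ε (v 0 (i 0) t ε)) (φ t ε (f t ε θ))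
        have h5 : |φ t ε (v 0 (i 0) t ε) - φ t ε (f t ε θ)| ≤ L * (2 * D) := h1.trans h3
        linarith
      have ej : ∀ (j : Fin J) t, w j (i j.castSucc, i j.succ) t ε
          = φ t ε (v j.succ (i j.succ) t ε) - φ t ε (v j.castSucc (i j.castSucc) t ε) := by
        intro j t
        refine max_min_eq ?_
        have h1 := hΦ ⟨g t ε, hg𝓖 t ε⟩ (v j.succ (i j.succ) t ε)
          (v j.castSucc (i j.castSucc) t ε)
        refine h1.trans ?_
        have h2 := abs_sub_le (v j.succ (i j.succ) t ε) (f t ε θ)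
          (v j.castSucc (i j.castSucc) t ε)
        have h3 := hi j.succ t
        have h4 := hi j.castSucc t
        rw [abs_sub_comm] at h4
        have h5 : 2 * D / 2 ^ (j.succ : ℕ) ≤ 2 * D / 2 ^ (j : ℕ) := by
          gcongr
          · norm_num
          · simp
        calc _ ≤ L * (2 * D / 2 ^ (j : ℕ) + 2 * D / 2 ^ (j : ℕ)) := by
              gcongr
              simp only [Fin.val_castSucc] at h4
              linarith
          _ = cj j := by simp only [cj]; ring
      have eJ : ∀ t, |g t ε θ - φ t ε (v (Fin.last J) (i (Fin.last J)) t ε)|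
          ≤ L * (2 * D / 2 ^ J) := by
        intro t
        rw [hgf, abs_sub_comm]
        refine (hΦ ⟨g t ε, hg𝓖 t ε⟩ _ _).trans ?_
        have := hi (Fin.last J) t
        rw [Fin.val_last] at this
        gcongr
      have tel : ∀ t, ∑ j : Fin J, (φ t ε (v j.succ (i j.succ) t ε)
          - φ t ε (v j.castSucc (i j.castSucc) t ε))
          = φ t ε (v (Fin.last J) (i (Fin.last J)) t ε) - φ t ε (v 0 (i 0) t ε) := by
        intro t
        have h1 := Fin.sum_univ_succ (fun j : Fin (J + 1) => φ t ε (v j (i j) t ε))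
        have h2 := Fin.sum_univ_castSucc (fun j : Fin (J + 1) => φ t ε (v j (i j) t ε))
        rw [Finset.sum_sub_distrib]
        linarith
      have dec : ∑ t, sg (ε t) * g t ε θ = ∑ t, sg (ε t) * w0 (i 0) t ε
          + ∑ j : Fin J, ∑ t, sg (ε t) * w j (i j.castSucc, i j.succ) t ε
          + ∑ t, sg (ε t) * (g t ε θ - φ t ε (v (Fin.last J) (i (Fin.last J)) t ε)) := by
        rw [Finset.sum_comm, ← Finset.sum_add_distrib, ← Finset.sum_add_distrib]
        refine Finset.sum_congr rfl fun t _ => ?_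
        rw [← Finset.mul_sum]
        simp only [e0, ej, tel]
        ring
      rw [dec]
      refine (abs_add_le _ _).trans (add_le_add ((abs_add_le _ _).trans (add_le_add ?_ ?_))
        (abs_sum_sg_le ε _ eJ))
      · exact le_ciSup (f := fun i => |∑ t, sg (ε t) * w0 i t ε|) (Set.finite_range _).bddAbove _
      · refine (Finset.abs_sum_le_sum_abs _ _).trans (Finset.sum_le_sum fun j _ => ?_)
        exact le_ciSup (f := fun i => |∑ t, sg (ε t) * w j i t ε|)
          (Set.finite_range _).bddAbove _
    refine (signAvg_mono hpt).trans ?_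
    rw [signAvg_add, signAvg_add, signAvg_const, signAvg_sum]
    -- numerical bounds
    have n0 : √(2 * Real.log (2 * Fintype.card (V 0))) ≤ 3 * l := by
      rw [Real.sqrt_le_left (by linarith)]
      have hpos : (0 : ℝ) < Fintype.card (V 0) := by exact_mod_cast Fintype.card_pos
      rw [Real.log_mul (by norm_num) hpos.ne']
      have := hlogV 0
      simp only [Fin.val_zero, pow_zero, mul_one] at this
      nlinarith
    have nj : ∀ j : Fin J,
        √(2 * Real.log (2 * Fintype.card (V j.castSucc × V j.succ))) ≤ 5 * 2 ^ (j : ℕ) * l := by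
      intro j
      rw [Real.sqrt_le_left (by positivity), Fintype.card_prod]
      have hpos1 : (0 : ℝ) < Fintype.card (V j.castSucc) := by exact_mod_cast Fintype.card_pos
      have hpos2 : (0 : ℝ) < Fintype.card (V j.succ) := by exact_mod_cast Fintype.card_pos
      push_cast
      rw [Real.log_mul (by norm_num) (by positivity), Real.log_mul hpos1.ne' hpos2.ne']
      have h1 := hlogV j.castSucc
      have h2 := hlogV j.succ
      simp only [Fin.val_castSucc, Fin.val_succ, pow_succ] at h1 h2
      have h4 : (5 * 2 ^ (j : ℕ) * l) ^ 2 = 25 * 4 ^ (j : ℕ) * l ^ 2 := by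
        rw [mul_pow, mul_pow, ← pow_mul, mul_comm (j : ℕ) 2, pow_mul]; norm_num
      rw [h4]
      have h5 : (1 : ℝ) ≤ 4 ^ (j : ℕ) := one_le_pow₀ (by norm_num)
      have h6 : l ≤ 4 ^ (j : ℕ) * l := le_mul_of_one_le_left (by linarith) h5
      have h7 : 4 ^ (j : ℕ) * l ≤ 4 ^ (j : ℕ) * l ^ 2 := by gcongr; nlinarith
      nlinarith
    have hJl : (J : ℝ) ≤ l := by
      have h1 : Real.log ((4 : ℝ) ^ J) ≤ Real.log (2 * T) := by
        refine Real.log_le_log (by positivity) ?_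
        have : ((4 : ℝ) ^ J) ≤ T := by exact_mod_cast hJT
        linarith
      rw [Real.log_pow] at h1
      have h2 : 1 ≤ Real.log 4 := by
        rw [show (4 : ℝ) = 2 ^ 2 by norm_num, Real.log_pow]
        have := Real.log_two_gt_d9
        push_cast; linarith
      have : (J : ℝ) * 1 ≤ J * Real.log 4 := by gcongr
      linarith
    have hlast : T * (L * (2 * D / 2 ^ J)) ≤ 4 * L * D * √T := by
      have h1 : √(T : ℝ) ≤ 2 * 2 ^ J := by
        rw [Real.sqrt_le_left (by positivity)]
        have : (T : ℝ) < 4 ^ (J + 1) := by exact_mod_cast hTJ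
        refine this.le.trans (le_of_eq ?_)
        rw [mul_pow, ← pow_mul, mul_comm J 2, pow_mul, pow_succ]; norm_num; ring
      have h2 : (T : ℝ) = √T * √T := (Real.mul_self_sqrt (by positivity)).symm
      calc (T : ℝ) * (L * (2 * D / 2 ^ J)) = √T * √T * (L * (2 * D / 2 ^ J)) := by rw [← h2]
        _ ≤ √T * (2 * 2 ^ J) * (L * (2 * D / 2 ^ J)) := by gcongr
        _ = 4 * L * D * √T := by field_simp; ring
    have s0 : c0 * √(2 * Real.log (2 * Fintype.card (V 0))) * √T ≤ c0 * (3 * l) * √T := by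
      gcongr
    -- Every link costs the same: its size decays like 2^(-j) while the root of its entropy grows
    -- like 2^j. There are `J ≤ l` links, whence the second factor `l`.
    have sj : ∑ j : Fin J, signAvg (fun ε => ⨆ i, |∑ t, sg (ε t) * w j i t ε|)
        ≤ l * (20 * L * D * l * √T) := by
      calc _ ≤ ∑ j : Fin J, 20 * L * D * l * √T := by
            refine Finset.sum_le_sum fun j _ => (kj j).trans ?_
            calc _ ≤ cj j * (5 * 2 ^ (j : ℕ) * l) * √T := by
                  gcongr
                  exact nj j
              _ = 20 * L * D * l * √T := by simp only [cj]; field_simp; ring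
        _ = J * (20 * L * D * l * √T) := by simp
        _ ≤ _ := by gcongr
    have hLD : L * D * l ≤ L * D * l ^ 2 := by gcongr; nlinarith
    have hLD' : L * D ≤ L * D * l := le_mul_of_one_le_right (by positivity) hl
    have : c0 * (3 * l) * √T + l * (20 * L * D * l * √T) + 4 * L * D * √T
        ≤ (3 * b' * l + 30 * L * D * l ^ 2) * √T := by
      have : c0 * (3 * l) + l * (20 * L * D * l) + 4 * L * D ≤ 3 * b' * l + 30 * L * D * l ^ 2 := by
        rw [hc0]; nlinarith
      have := mul_le_mul_of_nonneg_right this (Real.sqrt_nonneg (T : ℝ))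
      linarith
    linarith

/-- Products of functions of two classes. -/
lemma SeqBound.mul [Nonempty Θ] {𝓕₁ 𝓕₂ 𝓖 : Set (Θ → ℝ)} {N : ℕ} {b₁ b₂ D₁ D₂ l : ℝ}
    (h₁ : SeqBound N 𝓕₁ b₁ D₁) (h₂ : SeqBound N 𝓕₂ b₂ D₂)
    (hD₁ : b₁ ≤ D₁) (hD₂ : b₂ ≤ D₂) (hD : 0 < D₁ + D₂)
    (hl : 1 ≤ l) (hN : Real.log (2 * N) ≤ l)
    (hg : ∀ g ∈ 𝓖, ∃ f₁ ∈ 𝓕₁, ∃ f₂ ∈ 𝓕₂, ∀ θ, g θ = f₁ θ * f₂ θ) :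
    SeqBound N 𝓖 ((D₁ + D₂) ^ 2) (32 * (D₁ + D₂) ^ 2 * l ^ 2) := by
  -- Polarization: f₁f₂ = ((f₁ + f₂)² - (f₁ - f₂)²)/4. Squaring is `2 * (D₁ + D₂)`-Lipschitz on the
  -- range of the sums, so contraction applies to both squares.
  have key : ∀ s : ℝ, |s| = 1 →
      SeqBound N {g | ∃ f₁ ∈ 𝓕₁, ∃ f₂ ∈ 𝓕₂, ∀ θ, g θ = (f₁ θ + s * f₂ θ) ^ 2} ((D₁ + D₂) ^ 2)
        (64 * (D₁ + D₂) ^ 2 * l ^ 2) := by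
    intro s hs
    have k1 := SeqBound.lin h₁ h₂ 1 s
      (𝓖 := {g | ∃ f₁ ∈ 𝓕₁, ∃ f₂ ∈ 𝓕₂, ∀ θ, g θ = 1 * f₁ θ + s * f₂ θ}) fun g hg => hg
    rw [hs, abs_one, one_mul, one_mul, one_mul, one_mul] at k1
    have bd : ∀ f₁ ∈ 𝓕₁, ∀ f₂ ∈ 𝓕₂, ∀ θ, |f₁ θ + s * f₂ θ| ≤ D₁ + D₂ := by
      intro f₁ hf₁ f₂ hf₂ θ
      have h3 := h₁.bdd f₁ hf₁ θ
      have h4 := h₂.bdd f₂ hf₂ θ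
      refine (abs_add_le _ _).trans ?_
      rw [abs_mul, hs]
      linarith
    have k2 := k1.contraction (by linarith) hD (𝓖 := {g | ∃ f₁ ∈ 𝓕₁, ∃ f₂ ∈ 𝓕₂,
      ∀ θ, g θ = (f₁ θ + s * f₂ θ) ^ 2}) (b' := (D₁ + D₂) ^ 2) (L := 2 * (D₁ + D₂))
      (by positivity) (by linarith) hl hN ?_ ?_
    · refine k2.mono le_rfl le_rfl ?_
      have : (D₁ + D₂) ^ 2 * l ≤ (D₁ + D₂) ^ 2 * l ^ 2 := by gcongr; nlinarith
      nlinarith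
    · rintro g ⟨f₁, hf₁, f₂, hf₂, e⟩ θ
      rw [e, abs_pow]
      gcongr
      exact bd f₁ hf₁ f₂ hf₂ θ
    · rintro g ⟨f₁, hf₁, f₂, hf₂, e⟩
      refine ⟨fun θ => 1 * f₁ θ + s * f₂ θ, ⟨f₁, hf₁, f₂, hf₂, fun θ => rfl⟩, fun θ θ' => ?_⟩
      simp only [e, one_mul, sq_sub_sq, abs_mul]
      gcongr
      refine (abs_add_le _ _).trans ?_
      linarith [bd f₁ hf₁ f₂ hf₂ θ, bd f₁ hf₁ f₂ hf₂ θ']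
  have k := SeqBound.lin (key 1 abs_one) (key (-1) (by simp)) (1 / 4) (-(1 / 4)) (𝓖 := 𝓖) ?_
  · rw [abs_neg, abs_of_pos (by norm_num : (0 : ℝ) < 1 / 4)] at k
    refine k.mono le_rfl ?_ ?_ <;> nlinarith [sq_nonneg (D₁ + D₂)]
  · intro g hg'
    obtain ⟨f₁, hf₁, f₂, hf₂, e⟩ := hg g hg'
    refine ⟨fun θ => (f₁ θ + 1 * f₂ θ) ^ 2, ⟨f₁, hf₁, f₂, hf₂, fun θ => rfl⟩,
      fun θ => (f₁ θ + -1 * f₂ θ) ^ 2, ⟨f₁, hf₁, f₂, hf₂, fun θ => rfl⟩, fun θ => ?_⟩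
    rw [e]; ring

end ViOlin

/-! ### Two-layer networks and the complexity of their losses -/

namespace ViOlin

variable {m d : ℕ} {σ : ℝ → ℝ}

/-! ### Explicit derivatives of the network -/

/-- The pre-activation of a neuron. -/
def lin (w : Fin d → ℝ) (a : Act d) : ℝ := ∑ j, w j * a j

lemma inner_toLp (w : Fin d → ℝ) (a : Act d) : inner ℝ (WithLp.toLp 2 w) a = lin w a := by
  simp [lin, PiLp.inner_apply, mul_comm]

lemma lin_add (w : Fin d → ℝ) (a b : Act d) : lin w (a + b) = lin w a + lin w b := by
  simp [← inner_toLp, inner_add_right]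

lemma abs_lin_le {w : Fin d → ℝ} (hw : ∑ j, |w j| ≤ 1) {a : Act d} {b : ℝ} (hb : 0 ≤ b)
    (h : ∀ j, |a j| ≤ b) : |lin w a| ≤ b := by
  calc |lin w a| ≤ ∑ j, |w j| * b := by
        refine (Finset.abs_sum_le_sum_abs _ _).trans (Finset.sum_le_sum fun i _ => ?_)
        rw [abs_mul]; gcongr; exact h i
    _ ≤ b := by rw [← Finset.sum_mul]; exact mul_le_of_le_one_left hb hw

lemma abs_coord_le_norm (a : Act d) (j : Fin d) : |a j| ≤ ‖a‖ := PiLp.norm_apply_le a j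

lemma abs_lin_le_norm {w : Fin d → ℝ} (hw : ∑ j, |w j| ≤ 1) (a : Act d) : |lin w a| ≤ ‖a‖ :=
  abs_lin_le hw (norm_nonneg a) (abs_coord_le_norm a)

/-- The differential of the network in the direction `u`. -/
noncomputable def netGrad (σ : ℝ → ℝ) (θ : Param m d) (a u : Act d) : ℝ :=
  ∑ i, θ.2 i * (deriv σ (lin (θ.1 i) a) * lin (θ.1 i) u)

/-- The second differential of the network in the directions `u`, `v`. -/
noncomputable def netHess (σ : ℝ → ℝ) (θ : Param m d) (a u v : Act d) : ℝ :=
  ∑ i, θ.2 i * (deriv (deriv σ) (lin (θ.1 i) a) * (lin (θ.1 i) u * lin (θ.1 i) v))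

lemma net_eq (σ : ℝ → ℝ) (θ : Param m d) (a : Act d) :
    net σ θ a = ∑ i, θ.2 i * σ (lin (θ.1 i) a) := rfl

lemma gradient_reward (hσ : IsSmoothActivation σ) (θ : Param m d) (a : Act d) :
    gradient (reward σ θ) a =
      ∑ i, (θ.2 i * deriv σ (lin (θ.1 i) a)) • (WithLp.toLp 2 (θ.1 i) : Act d) - a := by
  refine HasGradientAt.gradient ?_
  rw [hasGradientAt_iff_hasFDerivAt]
  have h1 : ∀ i, HasFDerivAt (fun a : Act d => θ.2 i * σ (lin (θ.1 i) a))
      (θ.2 i • deriv σ (lin (θ.1 i) a) • innerSL ℝ (WithLp.toLp 2 (θ.1 i) : Act d)) a := by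
    intro i
    have h2 : HasFDerivAt (fun a : Act d => lin (θ.1 i) a)
        (innerSL ℝ (WithLp.toLp 2 (θ.1 i) : Act d)) a := by
      simp only [← inner_toLp]
      exact (innerSL ℝ (WithLp.toLp 2 (θ.1 i) : Act d)).hasFDerivAt
    exact ((hσ.diff (lin (θ.1 i) a)).hasDerivAt.comp_hasFDerivAt a h2).const_mul _
  have h3 : HasFDerivAt (fun a : Act d => ‖a‖ ^ 2 / 2) (innerSL ℝ a) a := by
    have := ((hasStrictFDerivAt_norm_sq a).hasFDerivAt).const_mul (1 / 2 : ℝ)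
    have e : (fun a : Act d => ‖a‖ ^ 2 / 2) = fun a => 1 / 2 * ‖a‖ ^ 2 := by ext a; ring
    rw [e]
    refine this.congr_fderiv ?_
    ext v; simp
  have h4 := (HasFDerivAt.fun_sum fun i (_ : i ∈ Finset.univ) => h1 i).sub h3
  refine HasFDerivAt.congr_fderiv (f := reward σ θ) h4 ?_
  ext v
  simp [InnerProductSpace.toDual_apply_apply, mul_assoc]

lemma inner_gradient_reward (hσ : IsSmoothActivation σ) (θ : Param m d) (a u : Act d) :
    inner ℝ (gradient (reward σ θ) a) u = netGrad σ θ a u - inner ℝ a u := by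
  rw [gradient_reward hσ, inner_sub_left, sum_inner]
  simp [inner_smul_left, inner_toLp, netGrad, mul_assoc]

lemma hess_reward (hσ : IsSmoothActivation σ) (θ : Param m d) (a u : Act d) :
    hess (reward σ θ) a u =
      ∑ i, (θ.2 i * (deriv (deriv σ) (lin (θ.1 i) a) * lin (θ.1 i) u)) •
        (WithLp.toLp 2 (θ.1 i) : Act d) - u := by
  have e : gradient (reward σ θ) = fun a => ∑ i, (θ.2 i * deriv σ (lin (θ.1 i) a)) •
      (WithLp.toLp 2 (θ.1 i) : Act d) - a := funext fun a => gradient_reward hσ θ a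
  have h1 : ∀ i, HasFDerivAt (fun a : Act d => (θ.2 i * deriv σ (lin (θ.1 i) a)) •
      (WithLp.toLp 2 (θ.1 i) : Act d))
      ((θ.2 i • deriv (deriv σ) (lin (θ.1 i) a) •
        innerSL ℝ (WithLp.toLp 2 (θ.1 i) : Act d)).smulRight (WithLp.toLp 2 (θ.1 i) : Act d)) a := by
    intro i
    have h2 : HasFDerivAt (fun a : Act d => lin (θ.1 i) a)
        (innerSL ℝ (WithLp.toLp 2 (θ.1 i) : Act d)) a := by
      simp only [← inner_toLp]
      exact (innerSL ℝ (WithLp.toLp 2 (θ.1 i) : Act d)).hasFDerivAt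
    exact (((hσ.diff_deriv (lin (θ.1 i) a)).hasDerivAt.comp_hasFDerivAt a h2).const_mul
      _).smul_const _
  have h4 := (HasFDerivAt.fun_sum fun i (_ : i ∈ Finset.univ) => h1 i).fun_sub (hasFDerivAt_id a)
  simp only [id] at h4
  rw [hess, e, h4.fderiv]
  simp [inner_toLp]

lemma inner_hess_reward (hσ : IsSmoothActivation σ) (θ : Param m d) (a u v : Act d) :
    inner ℝ (hess (reward σ θ) a u) v = netHess σ θ a u v - inner ℝ u v := by
  rw [hess_reward hσ, inner_sub_left, sum_inner]
  simp [inner_smul_left, inner_toLp, netHess, mul_assoc]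

/-! ### Bounds -/

lemma abs_sum_weights_le {c x : Fin m → ℝ} (hc : ∑ i, |c i| ≤ 1) {b : ℝ} (hb : 0 ≤ b)
    (h : ∀ i, |x i| ≤ b) : |∑ i, c i * x i| ≤ b := by
  calc |∑ i, c i * x i| ≤ ∑ i, |c i| * b := by
        refine (Finset.abs_sum_le_sum_abs _ _).trans (Finset.sum_le_sum fun i _ => ?_)
        rw [abs_mul]; gcongr; exact h i
    _ ≤ b := by rw [← Finset.sum_mul]; exact mul_le_of_le_one_left hb hc

lemma abs_net_le (hσ : IsSmoothActivation σ) {θ : Param m d} (hθ : θ ∈ Theta m d) (a : Act d) :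
    |net σ θ a| ≤ 1 :=
  abs_sum_weights_le hθ.2 zero_le_one fun _ => hσ.bound _

lemma abs_netGrad_le (hσ : IsSmoothActivation σ) {θ : Param m d} (hθ : θ ∈ Theta m d)
    (a u : Act d) : |netGrad σ θ a u| ≤ ‖u‖ := by
  refine abs_sum_weights_le hθ.2 (norm_nonneg u) fun i => ?_
  rw [abs_mul]
  exact (mul_le_of_le_one_left (abs_nonneg _) (hσ.bound_deriv _)).trans
    (abs_lin_le_norm (hθ.1 i) u)

lemma abs_netHess_le (hσ : IsSmoothActivation σ) {θ : Param m d} (hθ : θ ∈ Theta m d)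
    (a u v : Act d) : |netHess σ θ a u v| ≤ ‖u‖ * ‖v‖ := by
  refine abs_sum_weights_le hθ.2 (by positivity) fun i => ?_
  rw [abs_mul]
  refine (mul_le_of_le_one_left (abs_nonneg _) (hσ.bound_deriv2 _)).trans ?_
  rw [abs_mul]
  gcongr
  exacts [abs_lin_le_norm (hθ.1 i) u, abs_lin_le_norm (hθ.1 i) v]

lemma reward_le (hσ : IsSmoothActivation σ) {θ : Param m d} (hθ : θ ∈ Theta m d) (a : Act d) :
    reward σ θ a ≤ 1 - ‖a‖ ^ 2 / 2 := by
  have := (abs_le.1 (abs_net_le hσ hθ a)).2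
  simp only [reward]; linarith

lemma le_reward (hσ : IsSmoothActivation σ) {θ : Param m d} (hθ : θ ∈ Theta m d) (a : Act d) :
    -1 - ‖a‖ ^ 2 / 2 ≤ reward σ θ a := by
  have := (abs_le.1 (abs_net_le hσ hθ a)).1
  simp only [reward]; linarith

lemma abs_reward_le (hσ : IsSmoothActivation σ) {θ : Param m d} (hθ : θ ∈ Theta m d) {a : Act d}
    {ρ : ℝ} (ha : ‖a‖ ≤ ρ) : |reward σ θ a| ≤ 1 + ρ ^ 2 / 2 := by
  have h1 := reward_le hσ hθ a
  have h2 := le_reward hσ hθ a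
  have h3 : ‖a‖ ^ 2 ≤ ρ ^ 2 := by gcongr
  rw [abs_le]
  constructor <;> nlinarith [sq_nonneg ‖a‖]

/-! ### Taylor expansion -/

/-- The mean value inequality is applied twice on [-|h|, |h|], first to the derivative of the
remainder. This gives the constant 1 where integration would give 1/6, which suffices. -/
lemma IsSmoothActivation.taylor (hσ : IsSmoothActivation σ) (x h : ℝ) :
    |σ (x + h) - σ x - deriv σ x * h - 1 / 2 * deriv (deriv σ) x * h ^ 2| ≤ |h| ^ 3 := by
  have conv : Convex ℝ (Set.Icc (-|h|) |h|) := convex_Icc _ _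
  have h0 : (0 : ℝ) ∈ Set.Icc (-|h|) |h| := ⟨by simp, abs_nonneg h⟩
  have mem : ∀ t ∈ Set.Icc (-|h|) |h|, |t| ≤ |h| := fun t ht => abs_le.2 ht
  have hadd : ∀ t : ℝ, HasDerivAt (fun t => x + t) 1 t := fun t => (hasDerivAt_id t).const_add x
  have d1 : ∀ t, HasDerivAt (fun t => deriv σ (x + t) - deriv (deriv σ) x * t)
      (deriv (deriv σ) (x + t) - deriv (deriv σ) x) t := by
    intro t
    have h1 := (hσ.diff_deriv (x + t)).hasDerivAt.comp t (hadd t)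
    have h2 := (hasDerivAt_id t).const_mul (deriv (deriv σ) x)
    have := h1.sub h2
    simp only [mul_one] at this
    exact this
  have b1 : ∀ t ∈ Set.Icc (-|h|) |h|,
      |deriv σ (x + t) - deriv (deriv σ) x * t - deriv σ x| ≤ |h| ^ 2 := by
    intro t ht
    have := conv.norm_image_sub_le_of_norm_hasDerivWithin_le (C := |h|)
      (fun t _ => (d1 t).hasDerivWithinAt)
      (fun t ht => by
        rw [Real.norm_eq_abs]
        refine (hσ.lipschitz_deriv2 _ _).trans ?_
        rw [add_sub_cancel_left]; exact mem t ht) h0 ht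
    simp only [add_zero, mul_zero, sub_zero, Real.norm_eq_abs] at this
    refine this.trans ?_
    rw [sq]
    exact mul_le_mul_of_nonneg_left (mem t ht) (abs_nonneg h)
  have d2 : ∀ t, HasDerivAt
      (fun t => σ (x + t) - deriv σ x * t - 1 / 2 * deriv (deriv σ) x * t ^ 2)
      (deriv σ (x + t) - deriv (deriv σ) x * t - deriv σ x) t := by
    intro t
    have h1 := (hσ.diff (x + t)).hasDerivAt.comp t (hadd t)
    have h2 := (hasDerivAt_id t).const_mul (deriv σ x)
    have h3 := ((hasDerivAt_id t).pow 2).const_mul (1 / 2 * deriv (deriv σ) x)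
    have := (h1.sub h2).sub h3
    refine HasDerivAt.congr_deriv this ?_
    simp only [id, Nat.cast_ofNat, mul_one]
    ring
  have := conv.norm_image_sub_le_of_norm_hasDerivWithin_le (C := |h| ^ 2)
      (fun t _ => (d2 t).hasDerivWithinAt) (fun t ht => b1 t ht) h0
      (show h ∈ Set.Icc (-|h|) |h| from abs_le.1 le_rfl)
  simp only [add_zero, mul_zero, sub_zero, Real.norm_eq_abs, ne_eq, OfNat.ofNat_ne_zero,
    not_false_eq_true, zero_pow] at this
  calc _ = |σ (x + h) - deriv σ x * h - 1 / 2 * deriv (deriv σ) x * h ^ 2 - σ x| := by ring_nf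
    _ ≤ _ := this
    _ = _ := by ring

/-- The regularizer is quadratic and equals its expansion, so only the neurons contribute a
remainder; their pre-activations move by at most `‖s‖`, and the output weights have ℓ₁-norm at most
one. -/
lemma reward_taylor (hσ : IsSmoothActivation σ) {θ : Param m d} (hθ : θ ∈ Theta m d)
    (a s : Act d) :
    |reward σ θ (a + s) - (reward σ θ a + inner ℝ (gradient (reward σ θ) a) s
      + 1 / 2 * inner ℝ (hess (reward σ θ) a s) s)| ≤ ‖s‖ ^ 3 := by
  rw [inner_gradient_reward hσ, inner_hess_reward hσ]
  have e : reward σ θ (a + s) - (reward σ θ a + (netGrad σ θ a s - inner ℝ a s)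
      + 1 / 2 * (netHess σ θ a s s - inner ℝ s s)) =
      ∑ i, θ.2 i * (σ (lin (θ.1 i) a + lin (θ.1 i) s) - σ (lin (θ.1 i) a)
        - deriv σ (lin (θ.1 i) a) * lin (θ.1 i) s
        - 1 / 2 * deriv (deriv σ) (lin (θ.1 i) a) * lin (θ.1 i) s ^ 2) := by
    simp only [mul_sub, Finset.sum_sub_distrib, reward, net_eq, netGrad, netHess, lin_add]
    rw [norm_add_sq_real, real_inner_self_eq_norm_sq, Finset.mul_sum]
    have : ∑ i, 1 / 2 * (θ.2 i * (deriv (deriv σ) (lin (θ.1 i) a)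
        * (lin (θ.1 i) s * lin (θ.1 i) s))) = ∑ i, θ.2 i *
        (1 / 2 * deriv (deriv σ) (lin (θ.1 i) a) * lin (θ.1 i) s ^ 2) :=
      Finset.sum_congr rfl fun i _ => by ring
    rw [← this]
    ring_nf
  rw [e]
  refine abs_sum_weights_le hθ.2 (by positivity) fun i => ?_
  refine (hσ.taylor _ _).trans ?_
  gcongr
  exact abs_lin_le_norm (hθ.1 i) s

/-! ### Continuity -/

lemma IsSmoothActivation.continuous_deriv2 (hσ : IsSmoothActivation σ) :
    Continuous (deriv (deriv σ)) := by
  refine (LipschitzWith.of_dist_le_mul (K := 1) fun x y => ?_).continuous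
  simpa [Real.dist_eq] using hσ.lipschitz_deriv2 x y

lemma continuous_reward (hσ : IsSmoothActivation σ) :
    Continuous fun p : Param m d × Act d => reward σ p.1 p.2 := by
  have := hσ.diff.continuous
  simp only [reward, net]
  fun_prop

lemma continuous_netGrad (hσ : IsSmoothActivation σ) :
    Continuous fun p : Param m d × Act d × Act d => netGrad σ p.1 p.2.1 p.2.2 := by
  have := hσ.diff_deriv.continuous
  simp only [netGrad, lin]
  fun_prop

lemma continuous_netHess (hσ : IsSmoothActivation σ) :
    Continuous fun p : Param m d × Act d × Act d × Act d =>
      netHess σ p.1 p.2.1 p.2.2.1 p.2.2.2 := by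
  have := hσ.continuous_deriv2
  simp only [netHess, lin]
  fun_prop

lemma predict_two (hσ : IsSmoothActivation σ) (θ : Param m d) (x : Pair d × Noise d) :
    predict σ θ x 2 = netGrad σ θ x.1.2 x.2.1 - inner ℝ x.1.2 x.2.1 :=
  inner_gradient_reward hσ _ _ _

lemma predict_three (hσ : IsSmoothActivation σ) (θ : Param m d) (x : Pair d × Noise d) :
    predict σ θ x 3 = netHess σ θ x.1.2 x.2.1 x.2.2 - inner ℝ x.2.1 x.2.2 :=
  inner_hess_reward hσ _ _ _ _

lemma continuous_predict (hσ : IsSmoothActivation σ) :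
    Continuous fun p : Param m d × (Pair d × Noise d) => predict σ p.1 p.2 := by
  refine continuous_pi fun k => ?_
  fin_cases k
  · exact (continuous_reward hσ).comp (by fun_prop : Continuous
      fun p : Param m d × (Pair d × Noise d) => (p.1, p.2.1.1))
  · exact (continuous_reward hσ).comp (by fun_prop : Continuous
      fun p : Param m d × (Pair d × Noise d) => (p.1, p.2.1.2))
  · simp only [Fin.reduceFinMk, predict_two hσ]
    exact ((continuous_netGrad hσ).comp (by fun_prop : Continuous
      fun p : Param m d × (Pair d × Noise d) => (p.1, p.2.1.2, p.2.2.1))).sub (by fun_prop)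
  · simp only [Fin.reduceFinMk, predict_three hσ]
    exact ((continuous_netHess hσ).comp (by fun_prop : Continuous
      fun p : Param m d × (Pair d × Noise d) => (p.1, p.2.1.2, p.2.2.1, p.2.2.2))).sub
      (by fun_prop)

lemma continuous_loss (hσ : IsSmoothActivation σ) (κ₁ κ₂ : ℝ) :
    Continuous fun p : Data d × Param m d => loss σ κ₁ κ₂ p.1 p.2 := by
  have h : ∀ k, Continuous fun p : Data d × Param m d => predict σ p.2 p.1.1 k := fun k =>
    (continuous_apply k).comp ((continuous_predict hσ).comp (by fun_prop : Continuous
      fun p : Data d × Param m d => (p.2, p.1.1)))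
  have h' : ∀ k, Continuous fun p : Data d × Param m d => p.1.2 k := fun k => by fun_prop
  simp only [loss]
  exact (((((h 0).sub (h' 0)).pow 2).add (((h 1).sub (h' 1)).pow 2)).add
    (continuous_const.min (((h 2).sub (h' 2)).pow 2))).add
    (continuous_const.min (((h 3).sub (h' 3)).pow 2))

/-! ### Bounds for the loss -/

lemma loss_nonneg (κ₁ κ₂ : ℝ) (z : Data d) (θ : Param m d) : 0 ≤ loss σ κ₁ κ₂ z θ := by
  simp only [loss]
  have h1 : 0 ≤ min (κ₁ ^ 2) ((predict σ θ z.1 2 - z.2 2) ^ 2) :=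
    le_min (sq_nonneg _) (sq_nonneg _)
  have h2 : 0 ≤ min (κ₂ ^ 2) ((predict σ θ z.1 3 - z.2 3) ^ 2) :=
    le_min (sq_nonneg _) (sq_nonneg _)
  positivity

/-- The data points that nature may produce. -/
structure IsAdmissible (ρ : ℝ) (z : Data d) : Prop where
  fst : ‖z.1.1.1‖ ≤ ρ
  snd : ‖z.1.1.2‖ ≤ ρ
  label₀ : |z.2 0| ≤ 1 + ρ ^ 2 / 2
  label₁ : |z.2 1| ≤ 1 + ρ ^ 2 / 2

/-- An upper bound for the losses of admissible data points. -/
def lossBound (ρ κ₁ κ₂ : ℝ) : ℝ := 2 * (2 + ρ ^ 2) ^ 2 + κ₁ ^ 2 + κ₂ ^ 2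

lemma lossBound_nonneg (ρ κ₁ κ₂ : ℝ) : 0 ≤ lossBound ρ κ₁ κ₂ := by
  unfold lossBound; positivity

lemma loss_le (hσ : IsSmoothActivation σ) {ρ : ℝ} (κ₁ κ₂ : ℝ) {z : Data d}
    (hz : IsAdmissible ρ z) {θ : Param m d} (hθ : θ ∈ Theta m d) :
    loss σ κ₁ κ₂ z θ ≤ lossBound ρ κ₁ κ₂ := by
  have key : ∀ p y : ℝ, |p| ≤ 1 + ρ ^ 2 / 2 → |y| ≤ 1 + ρ ^ 2 / 2 →
      (p - y) ^ 2 ≤ (2 + ρ ^ 2) ^ 2 := by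
    intro p y hp hy
    rw [sq_le_sq, abs_of_nonneg (by positivity : 0 ≤ 2 + ρ ^ 2)]
    refine (abs_sub _ _).trans ?_
    linarith
  have h0 := key _ _ (abs_reward_le hσ hθ hz.fst) hz.label₀
  have h1 := key _ _ (abs_reward_le hσ hθ hz.snd) hz.label₁
  have h2 := min_le_left (κ₁ ^ 2) ((predict σ θ z.1 2 - z.2 2) ^ 2)
  have h3 := min_le_left (κ₂ ^ 2) ((predict σ θ z.1 3 - z.2 3) ^ 2)
  have e0 : predict σ θ z.1 0 = reward σ θ z.1.1.1 := rfl
  have e1 : predict σ θ z.1 1 = reward σ θ z.1.1.2 := rfl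
  simp only [loss, lossBound, e0, e1]
  linarith

lemma abs_loss_le (hσ : IsSmoothActivation σ) {ρ : ℝ} (κ₁ κ₂ : ℝ) {z : Data d}
    (hz : IsAdmissible ρ z) {θ : Param m d} (hθ : θ ∈ Theta m d) :
    |loss σ κ₁ κ₂ z θ| ≤ lossBound ρ κ₁ κ₂ := by
  rw [abs_of_nonneg (loss_nonneg _ _ _ _)]
  exact loss_le hσ κ₁ κ₂ hz hθ

instance : Nonempty (Theta m d) := ⟨⟨0, by simp [Theta]⟩⟩

end ViOlin

namespace ViOlin

variable {m d : ℕ} {σ : ℝ → ℝ}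

/-! ### Complexity of neurons and networks -/

/-- The `ℓ₁`-ball, the set of first-layer weights of a neuron. -/
abbrev Ball1 (d : ℕ) : Type := {w : Fin d → ℝ // ∑ j, |w j| ≤ 1}

instance : Nonempty (Ball1 d) := ⟨⟨0, by simp⟩⟩

/-- Linear functions of the weights, for inputs with coordinates bounded by `b`. -/
def linClass (d : ℕ) (b : ℝ) : Set (Ball1 d → ℝ) :=
  {f | ∃ u : Act d, (∀ j, |u j| ≤ b) ∧ ∀ w, f w = lin w.1 u}

/-- Activations of a neuron, for actions of norm at most `ρ`. -/
def actClass (d : ℕ) (s : ℝ → ℝ) (ρ : ℝ) : Set (Ball1 d → ℝ) :=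
  {f | ∃ a : Act d, ‖a‖ ≤ ρ ∧ ∀ w, f w = s (lin w.1 a)}

lemma sqrt_two_mul_le {x l : ℝ} (hl : 1 ≤ l) (h : x ≤ l) : √(2 * x) ≤ 2 * l := by
  rw [Real.sqrt_le_left (by linarith)]
  nlinarith

lemma seqBound_linClass (N : ℕ) {b l : ℝ} (hb : 0 ≤ b) (hl : 1 ≤ l)
    (hd : Real.log (2 * d) ≤ l) : SeqBound N (linClass d b) b (2 * b * l) := by
  refine (SeqBound.linear (d := d) N hb).mono ?_ le_rfl ?_
  · rintro f ⟨u, hu, e⟩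
    exact ⟨fun j => u j, hu, e⟩
  · have := mul_le_mul_of_nonneg_left (sqrt_two_mul_le hl hd) hb
    linarith

/-- Contraction with constant one from linear functions of the weights, where 3 + 2·30 = 63. It is
used for σ, σ' and σ''; the last use is where the Lipschitz hypothesis on σ'' enters. -/
lemma seqBound_actClass {N : ℕ} {s : ℝ → ℝ} (hs : ∀ x, |s x| ≤ 1)
    (hs' : ∀ x y, |s x - s y| ≤ |x - y|) {ρ l : ℝ} (hρ : 1 ≤ ρ) (hl : 1 ≤ l)
    (hd : Real.log (2 * d) ≤ l) (hN : Real.log (2 * N) ≤ l) :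
    SeqBound N (actClass d s ρ) 1 (63 * ρ * l ^ 3) := by
  refine ((seqBound_linClass (d := d) N (by linarith : 0 ≤ ρ) hl hd).contraction
    (b' := 1) (L := 1) (𝓖 := actClass d s ρ) ?_ (by positivity) zero_le_one zero_le_one hl hN
    ?_ ?_).mono le_rfl le_rfl ?_
  · nlinarith
  · rintro g ⟨a, -, e⟩ w
    rw [e]; exact hs _
  · rintro g ⟨a, ha, e⟩
    refine ⟨fun w => lin w.1 a, ⟨a, fun j => (abs_coord_le_norm a j).trans ha, fun w => rfl⟩,
      fun w w' => ?_⟩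
    rw [e, e, one_mul]; exact hs' _ _
  · have h1 : l ≤ l ^ 3 := by nlinarith [sq_nonneg (l - 1), mul_pos (by linarith : 0 < l) (by linarith : 0 < l)]
    have h2 : l ^ 3 ≤ ρ * l ^ 3 := le_mul_of_one_le_left (by positivity) hρ
    nlinarith

lemma IsSmoothActivation.lipschitz (hσ : IsSmoothActivation σ) (x y : ℝ) :
    |σ x - σ y| ≤ |x - y| := by
  have := Convex.norm_image_sub_le_of_norm_deriv_le (f := σ) (C := 1) (s := Set.univ)
    (fun x _ => hσ.diff x) (fun x _ => hσ.bound_deriv x) convex_univ (Set.mem_univ y)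
    (Set.mem_univ x)
  simpa using this

lemma IsSmoothActivation.lipschitz_deriv (hσ : IsSmoothActivation σ) (x y : ℝ) :
    |deriv σ x - deriv σ y| ≤ |x - y| := by
  have := Convex.norm_image_sub_le_of_norm_deriv_le (f := deriv σ) (C := 1) (s := Set.univ)
    (fun x _ => hσ.diff_deriv x) (fun x _ => hσ.bound_deriv2 x) convex_univ (Set.mem_univ y)
    (Set.mem_univ x)
  simpa using this

/-- The network outputs as functions of the parameters. -/
def netClass (m d : ℕ) (σ : ℝ → ℝ) (ρ : ℝ) : Set (Theta m d → ℝ) :=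
  {f | ∃ a : Act d, ‖a‖ ≤ ρ ∧ ∀ θ, f θ = net σ θ.1 a}

/-- The directional derivatives of the network as functions of the parameters. -/
def gradClass (m d : ℕ) (σ : ℝ → ℝ) (ρ B : ℝ) : Set (Theta m d → ℝ) :=
  {f | ∃ a u : Act d, ‖a‖ ≤ ρ ∧ (∀ j, |u j| ≤ B) ∧ ∀ θ, f θ = netGrad σ θ.1 a u}

/-- The second directional derivatives of the network as functions of the parameters. -/
def hessClass (m d : ℕ) (σ : ℝ → ℝ) (ρ B : ℝ) : Set (Theta m d → ℝ) :=
  {f | ∃ a u v : Act d, ‖a‖ ≤ ρ ∧ (∀ j, |u j| ≤ B) ∧ (∀ j, |v j| ≤ B) ∧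
    ∀ θ, f θ = netHess σ θ.1 a u v}

section classes

variable {N : ℕ} {ρ B l : ℝ}

/-- The output weights form an absolutely convex combination of neurons, so the width `m` leaves no
trace. -/
lemma seqBound_netClass (hσ : IsSmoothActivation σ) (hρ : 1 ≤ ρ) (hl : 1 ≤ l)
    (hd : Real.log (2 * d) ≤ l) (hN : Real.log (2 * N) ≤ l) :
    SeqBound N (netClass m d σ ρ) 1 (63 * ρ * l ^ 3) := by
  refine (seqBound_actClass hσ.bound hσ.lipschitz hρ hl hd hN).hull zero_le_one
    (fun θ => θ.1.2) (fun θ i => ⟨θ.1.1 i, θ.2.1 i⟩) (fun θ => θ.2.2) ?_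
  rintro g ⟨a, ha, e⟩
  exact ⟨fun w => σ (lin w.1 a), ⟨a, ha, fun _ => rfl⟩, e⟩

/-- A directional derivative is an absolutely convex combination of products σ'(⟨w, a⟩)⟨w, u⟩. Only
the coordinates of `u` are bounded, not its norm; for Gaussian `u` this keeps the dependence on `d`
logarithmic. The constant is 65 = 63 + 2. -/
lemma seqBound_gradClass (hσ : IsSmoothActivation σ) (hρ : 1 ≤ ρ) (hB : 1 ≤ B) (hl : 1 ≤ l)
    (hd : Real.log (2 * d) ≤ l) (hN : Real.log (2 * N) ≤ l) :
    SeqBound N (gradClass m d σ ρ B) ((65 * ρ * B * l ^ 3) ^ 2)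
      (32 * (65 * ρ * B * l ^ 3) ^ 2 * l ^ 2) := by
  have hl3 : l ≤ l ^ 3 := by
    nlinarith [sq_nonneg (l - 1), mul_pos (by linarith : 0 < l) (by linarith : 0 < l)]
  have hl3' : (1 : ℝ) ≤ l ^ 3 := one_le_pow₀ hl
  have hρB : 1 ≤ ρ * l ^ 3 := one_le_mul_of_one_le_of_one_le hρ hl3'
  have h1 := seqBound_actClass (d := d) (N := N) hσ.bound_deriv hσ.lipschitz_deriv hρ hl hd hN
  have h2 := seqBound_linClass (d := d) N (by linarith : 0 ≤ B) hl hd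
  have h3 := h1.mul h2 (𝓖 := {f | ∃ a u : Act d, ‖a‖ ≤ ρ ∧ (∀ j, |u j| ≤ B) ∧
      ∀ w, f w = deriv σ (lin w.1 a) * lin w.1 u}) (by nlinarith) (by nlinarith) (by positivity)
      hl hN ?_
  · have hle : 63 * ρ * l ^ 3 + 2 * B * l ≤ 65 * ρ * B * l ^ 3 := by
      have a1 : ρ * l ^ 3 ≤ ρ * l ^ 3 * B := le_mul_of_one_le_right (by positivity) hB
      have a2 : B * l ≤ B * l ^ 3 := by gcongr
      have a3 : B * l ^ 3 ≤ ρ * (B * l ^ 3) := le_mul_of_one_le_left (by positivity) hρ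
      nlinarith
    refine (h3.hull (m := m) (𝓖 := gradClass m d σ ρ B) (by positivity)
      (fun θ : Theta m d => θ.1.2) (fun θ i => ⟨θ.1.1 i, θ.2.1 i⟩) (fun θ => θ.2.2) ?_).mono
      le_rfl (by gcongr) (by gcongr)
    rintro g ⟨a, u, ha, hu, e⟩
    exact ⟨fun w => deriv σ (lin w.1 a) * lin w.1 u, ⟨a, u, ha, hu, fun _ => rfl⟩, e⟩
  · rintro g ⟨a, u, ha, hu, e⟩
    exact ⟨fun w => deriv σ (lin w.1 a), ⟨a, ha, fun _ => rfl⟩, fun w => lin w.1 u,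
      ⟨u, hu, fun _ => rfl⟩, e⟩

/-- `SeqBound.mul` is used twice, first for ⟨w, u⟩⟨w, v⟩, whose complexity has the constant 512, and
then for its product with σ''(⟨w, a⟩); 575 = 63 + 512. -/
lemma seqBound_hessClass (hσ : IsSmoothActivation σ) (hρ : 1 ≤ ρ) (hB : 1 ≤ B) (hl : 1 ≤ l)
    (hd : Real.log (2 * d) ≤ l) (hN : Real.log (2 * N) ≤ l) :
    SeqBound N (hessClass m d σ ρ B) ((575 * ρ * B ^ 2 * l ^ 4) ^ 2)
      (32 * (575 * ρ * B ^ 2 * l ^ 4) ^ 2 * l ^ 2) := by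
  have hl34 : l ^ 3 ≤ l ^ 4 := pow_le_pow_right₀ hl (by norm_num)
  have hl24 : l ^ 2 ≤ l ^ 4 := pow_le_pow_right₀ hl (by norm_num)
  have hl3' : (1 : ℝ) ≤ l ^ 3 := one_le_pow₀ hl
  have hB2 : (1 : ℝ) ≤ B ^ 2 := one_le_pow₀ hB
  have hρB : 1 ≤ ρ * l ^ 3 := one_le_mul_of_one_le_of_one_le hρ hl3'
  have h1 := seqBound_actClass (d := d) (N := N) hσ.bound_deriv2 hσ.lipschitz_deriv2 hρ hl hd hN
  have h2 := seqBound_linClass (d := d) N (by linarith : 0 ≤ B) hl hd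
  have h3 := h2.mul h2 (𝓖 := {f | ∃ u v : Act d, (∀ j, |u j| ≤ B) ∧ (∀ j, |v j| ≤ B) ∧
      ∀ w, f w = lin w.1 u * lin w.1 v}) (by nlinarith) (by nlinarith) (by positivity) hl hN ?_
  · have h4 := h1.mul h3 (𝓖 := {f | ∃ a u v : Act d, ‖a‖ ≤ ρ ∧ (∀ j, |u j| ≤ B) ∧
        (∀ j, |v j| ≤ B) ∧ ∀ w, f w = deriv (deriv σ) (lin w.1 a) * (lin w.1 u * lin w.1 v)})
        (by nlinarith) ?_ (by positivity) hl hN ?_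
    · have hle : 63 * ρ * l ^ 3 + 32 * (2 * B * l + 2 * B * l) ^ 2 * l ^ 2
          ≤ 575 * ρ * B ^ 2 * l ^ 4 := by
        have e : 32 * (2 * B * l + 2 * B * l) ^ 2 * l ^ 2 = 512 * (B ^ 2 * l ^ 4) := by ring
        have a1 : ρ * l ^ 3 ≤ ρ * l ^ 4 := by gcongr
        have a2 : ρ * l ^ 4 ≤ ρ * l ^ 4 * B ^ 2 := le_mul_of_one_le_right (by positivity) hB2
        have a3 : B ^ 2 * l ^ 4 ≤ ρ * (B ^ 2 * l ^ 4) := le_mul_of_one_le_left (by positivity) hρ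
        rw [e]; nlinarith
      refine (h4.hull (m := m) (𝓖 := hessClass m d σ ρ B) (by positivity)
        (fun θ : Theta m d => θ.1.2) (fun θ i => ⟨θ.1.1 i, θ.2.1 i⟩) (fun θ => θ.2.2) ?_).mono
        le_rfl (by gcongr) (by gcongr)
      rintro g ⟨a, u, v, ha, hu, hv, e⟩
      exact ⟨fun w => deriv (deriv σ) (lin w.1 a) * (lin w.1 u * lin w.1 v),
        ⟨a, u, v, ha, hu, hv, fun _ => rfl⟩, e⟩
    · have : (1 : ℝ) ≤ l ^ 2 := one_le_pow₀ hl
      nlinarith [mul_le_mul_of_nonneg_left this (sq_nonneg (2 * B * l + 2 * B * l)),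
        sq_nonneg (2 * B * l + 2 * B * l)]
    · rintro g ⟨a, u, v, ha, hu, hv, e⟩
      exact ⟨fun w => deriv (deriv σ) (lin w.1 a), ⟨a, ha, fun _ => rfl⟩,
        fun w => lin w.1 u * lin w.1 v, ⟨u, v, hu, hv, fun _ => rfl⟩, e⟩
  · rintro g ⟨u, v, hu, hv, e⟩
    exact ⟨fun w => lin w.1 u, ⟨u, hu, fun _ => rfl⟩, fun w => lin w.1 v, ⟨v, hv, fun _ => rfl⟩, e⟩

end classes

/-! ### Complexity of the loss -/

/-- The truncated square is the square of min(κ, |s|), hence Lipschitz on the whole line. This is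
what permits unbounded labels and unbounded noise. -/
lemma abs_min_sq_sub_le {κ : ℝ} (hκ : 0 ≤ κ) (s t : ℝ) :
    |min (κ ^ 2) (s ^ 2) - min (κ ^ 2) (t ^ 2)| ≤ 2 * κ * |s - t| := by
  have key : ∀ s : ℝ, min (κ ^ 2) (s ^ 2) = (min κ |s|) ^ 2 := by
    intro s
    rw [← sq_abs s]
    rcases le_total κ |s| with h | h
    · rw [min_eq_left h, min_eq_left (by gcongr)]
    · rw [min_eq_right h, min_eq_right (by gcongr)]
  rw [key, key, sq_sub_sq, abs_mul]
  have h1 : |(min κ |s|) + (min κ |t|)| ≤ 2 * κ := by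
    rw [abs_of_nonneg (by positivity)]
    linarith [min_le_left κ |s|, min_le_left κ |t|]
  have h2 : |(min κ |s|) - (min κ |t|)| ≤ |s - t| := by
    have := abs_min_sub_min_le_max κ |s| κ |t|
    rw [sub_self, abs_zero, max_eq_right (abs_nonneg _)] at this
    exact this.trans (abs_abs_sub_abs_le_abs_sub s t)
  gcongr

/-- The hypothesis involves only differences in θ, so a label that depends on the node shifts the
predictions at no cost. The constants of `SeqBound.contraction` are gathered into one product. -/
lemma seqBound_of_shift {N : ℕ} {𝓕 𝓖 : Set (Theta m d → ℝ)} {b D b' L l : ℝ}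
    (h : SeqBound N 𝓕 b D) (hbD : b ≤ D) (hD : 1 ≤ D) (hb' : 0 ≤ b') (hL : 0 ≤ L) (hl : 1 ≤ l)
    (hN : Real.log (2 * N) ≤ l) (hbdd : ∀ g ∈ 𝓖, ∀ θ, |g θ| ≤ b')
    (hg : ∀ g ∈ 𝓖, ∃ f ∈ 𝓕, ∀ θ θ', |g θ - g θ'| ≤ L * |f θ - f θ'|) :
    SeqBound N 𝓖 b' (33 * (b' + L) * (D * l ^ 2)) := by
  refine (h.contraction hbD (by linarith) hb' hL hl hN hbdd hg).mono le_rfl le_rfl ?_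
  have h1 : l ≤ l ^ 2 := by nlinarith
  have h2 : b' * l ≤ b' * (D * l ^ 2) := by
    gcongr
    exact h1.trans (le_mul_of_one_le_left (by positivity) hD)
  have h3 : 0 ≤ L * (D * l ^ 2) := by positivity
  have h4 : 0 ≤ b' * (D * l ^ 2) := by positivity
  nlinarith

/-- A bound for the signed sums of losses along a tree, for fixed noise. -/
lemma exists_signAvg_loss_le {ρ κ₁ κ₂ : ℝ} (hρ : 1 ≤ ρ) (hκ₁ : 0 ≤ κ₁) (hκ₂ : 0 ≤ κ₂) :
    ∃ C : ℝ, 0 ≤ C ∧ ∀ (m d T : ℕ) (σ : ℝ → ℝ), IsSmoothActivation σ → ∀ (B l : ℝ), 1 ≤ B →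
      1 ≤ l → Real.log (2 * d) ≤ l → Real.log (2 * T) ≤ l →
      ∀ z : Fin T → (Fin T → ℤˣ) → Data d, Predictable z → (∀ t ε, IsAdmissible ρ (z t ε)) →
      (∀ t ε j, |(z t ε).1.2.1 j| ≤ B) → (∀ t ε j, |(z t ε).1.2.2 j| ≤ B) →
      signAvg (fun ε => ⨆ θ : Theta m d, ∑ t, sg (ε t) * loss σ κ₁ κ₂ (z t ε) (θ : Param m d))
        ≤ C * (B ^ 4 * l ^ 12) * √T := by
  set b₀ : ℝ := (2 + ρ ^ 2) ^ 2 with hb₀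
  set L₀ : ℝ := 2 * (2 + ρ ^ 2) with hL₀
  refine ⟨2 * (33 * (b₀ + L₀) * (63 * ρ)) + 33 * (κ₁ ^ 2 + 2 * κ₁) * (32 * (65 * ρ) ^ 2)
    + 33 * (κ₂ ^ 2 + 2 * κ₂) * (32 * (575 * ρ) ^ 2), by positivity, ?_⟩
  intro m d T σ hσ B l hB hl hd hT z hz hadm hu hv
  have hl0 : 0 < l := by linarith
  have hlk : ∀ k : ℕ, (1 : ℝ) ≤ l ^ k := fun k => one_le_pow₀ hl
  have hBk : ∀ k : ℕ, (1 : ℝ) ≤ B ^ k := fun k => one_le_pow₀ hB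
  -- the four terms of the loss
  have s0 := seqBound_of_shift (N := T) (𝓖 := {g | ∃ (a : Act d) (y : ℝ), ‖a‖ ≤ ρ ∧
      |y| ≤ 1 + ρ ^ 2 / 2 ∧ ∀ θ : Theta m d, g θ = (reward σ θ.1 a - y) ^ 2}) (b' := b₀) (L := L₀)
    (seqBound_netClass (m := m) hσ hρ hl hd hT) (by nlinarith [hlk 3]) (by nlinarith [hlk 3])
    (by positivity) (by positivity) hl hT ?_ ?_
  rotate_left
  · rintro g ⟨a, y, ha, hy, e⟩ θ
    rw [e, abs_pow, hb₀]
    gcongr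
    refine (abs_sub _ _).trans ?_
    linarith [abs_reward_le hσ θ.2 ha]
  · rintro g ⟨a, y, ha, hy, e⟩
    refine ⟨fun θ => net σ θ.1 a, ⟨a, ha, fun _ => rfl⟩, fun θ θ' => ?_⟩
    rw [e, e, sq_sub_sq, abs_mul]
    have h1 : |reward σ θ.1 a - y + (reward σ θ'.1 a - y)| ≤ L₀ := by
      have h2 := abs_le.1 (abs_reward_le hσ θ.2 ha)
      have h3 := abs_le.1 (abs_reward_le hσ θ'.2 ha)
      have h4 := abs_le.1 hy
      rw [abs_le]; constructor <;> linarith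
    have h2 : reward σ θ.1 a - y - (reward σ θ'.1 a - y) = net σ θ.1 a - net σ θ'.1 a := by
      simp only [reward]; ring
    rw [h2]
    gcongr
  have s2 := seqBound_of_shift (N := T) (𝓖 := {g | ∃ (a u : Act d) (y : ℝ), ‖a‖ ≤ ρ ∧
      (∀ j, |u j| ≤ B) ∧ ∀ θ : Theta m d, g θ = min (κ₁ ^ 2) ((netGrad σ θ.1 a u - y) ^ 2)})
    (b' := κ₁ ^ 2) (L := 2 * κ₁)
    (seqBound_gradClass (m := m) hσ hρ hB hl hd hT) ?_ ?_
    (by positivity) (by positivity) hl hT ?_ ?_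
  rotate_left
  · have := hlk 2
    have h0 : 0 ≤ (65 * ρ * B * l ^ 3) ^ 2 := by positivity
    nlinarith
  · have h1 : 1 ≤ 65 * ρ * B * l ^ 3 := by
      have := one_le_mul_of_one_le_of_one_le (one_le_mul_of_one_le_of_one_le hρ hB) (hlk 3)
      linarith
    have h2 := one_le_pow₀ (n := 2) h1
    have h3 := one_le_mul_of_one_le_of_one_le h2 (hlk 2)
    linarith
  · rintro g ⟨a, u, y, ha, hu, e⟩ θ
    rw [e, abs_of_nonneg (le_min (sq_nonneg _) (sq_nonneg _))]
    exact min_le_left _ _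
  · rintro g ⟨a, u, y, ha, hu, e⟩
    refine ⟨fun θ => netGrad σ θ.1 a u, ⟨a, u, ha, hu, fun _ => rfl⟩, fun θ θ' => ?_⟩
    rw [e, e]
    refine (abs_min_sq_sub_le hκ₁ _ _).trans (le_of_eq ?_)
    congr 2; ring
  have s3 := seqBound_of_shift (N := T) (𝓖 := {g | ∃ (a u v : Act d) (y : ℝ), ‖a‖ ≤ ρ ∧
      (∀ j, |u j| ≤ B) ∧ (∀ j, |v j| ≤ B) ∧
      ∀ θ : Theta m d, g θ = min (κ₂ ^ 2) ((netHess σ θ.1 a u v - y) ^ 2)})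
    (b' := κ₂ ^ 2) (L := 2 * κ₂)
    (seqBound_hessClass (m := m) hσ hρ hB hl hd hT) ?_ ?_
    (by positivity) (by positivity) hl hT ?_ ?_
  rotate_left
  · have := hlk 2
    have h0 : 0 ≤ (575 * ρ * B ^ 2 * l ^ 4) ^ 2 := by positivity
    nlinarith
  · have h1 : 1 ≤ 575 * ρ * B ^ 2 * l ^ 4 := by
      have := one_le_mul_of_one_le_of_one_le (one_le_mul_of_one_le_of_one_le hρ (hBk 2)) (hlk 4)
      linarith
    have h2 := one_le_pow₀ (n := 2) h1
    have h3 := one_le_mul_of_one_le_of_one_le h2 (hlk 2)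
    linarith
  · rintro g ⟨a, u, v, y, ha, hu, hv, e⟩ θ
    rw [e, abs_of_nonneg (le_min (sq_nonneg _) (sq_nonneg _))]
    exact min_le_left _ _
  · rintro g ⟨a, u, v, y, ha, hu, hv, e⟩
    refine ⟨fun θ => netHess σ θ.1 a u v, ⟨a, u, v, ha, hu, hv, fun _ => rfl⟩, fun θ θ' => ?_⟩
    rw [e, e]
    refine (abs_min_sq_sub_le hκ₂ _ _).trans (le_of_eq ?_)
    congr 2; ring
  -- the trees of the four terms
  let F0 : Data d → Theta m d → ℝ := fun z θ => (reward σ θ.1 z.1.1.1 - z.2 0) ^ 2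
  let F1 : Data d → Theta m d → ℝ := fun z θ => (reward σ θ.1 z.1.1.2 - z.2 1) ^ 2
  let F2 : Data d → Theta m d → ℝ := fun z θ =>
    min (κ₁ ^ 2) ((predict σ θ.1 z.1 2 - z.2 2) ^ 2)
  let F3 : Data d → Theta m d → ℝ := fun z θ =>
    min (κ₂ ^ 2) ((predict σ θ.1 z.1 3 - z.2 3) ^ 2)
  have m0 : ∀ t ε, F0 (z t ε) ∈ {g | ∃ (a : Act d) (y : ℝ), ‖a‖ ≤ ρ ∧
      |y| ≤ 1 + ρ ^ 2 / 2 ∧ ∀ θ : Theta m d, g θ = (reward σ θ.1 a - y) ^ 2} := fun t ε =>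
    ⟨_, _, (hadm t ε).fst, (hadm t ε).label₀, fun _ => rfl⟩
  have m1 : ∀ t ε, F1 (z t ε) ∈ {g | ∃ (a : Act d) (y : ℝ), ‖a‖ ≤ ρ ∧
      |y| ≤ 1 + ρ ^ 2 / 2 ∧ ∀ θ : Theta m d, g θ = (reward σ θ.1 a - y) ^ 2} := fun t ε =>
    ⟨_, _, (hadm t ε).snd, (hadm t ε).label₁, fun _ => rfl⟩
  -- The regularizer contributes a term to the derivative that does not depend on θ; it is absorbed
  -- into the label, here and for the Hessian.
  have m2 : ∀ t ε, F2 (z t ε) ∈ {g | ∃ (a u : Act d) (y : ℝ), ‖a‖ ≤ ρ ∧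
      (∀ j, |u j| ≤ B) ∧
      ∀ θ : Theta m d, g θ = min (κ₁ ^ 2) ((netGrad σ θ.1 a u - y) ^ 2)} := fun t ε =>
    ⟨(z t ε).1.1.2, (z t ε).1.2.1, inner ℝ (z t ε).1.1.2 (z t ε).1.2.1 + (z t ε).2 2,
      (hadm t ε).snd, hu t ε, fun θ => by simp only [F2, predict_two hσ]; congr 2; ring⟩
  have m3 : ∀ t ε, F3 (z t ε) ∈ {g | ∃ (a u v : Act d) (y : ℝ), ‖a‖ ≤ ρ ∧
      (∀ j, |u j| ≤ B) ∧ (∀ j, |v j| ≤ B) ∧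
      ∀ θ : Theta m d, g θ = min (κ₂ ^ 2) ((netHess σ θ.1 a u v - y) ^ 2)} := fun t ε =>
    ⟨(z t ε).1.1.2, (z t ε).1.2.1, (z t ε).1.2.2,
      inner ℝ (z t ε).1.2.1 (z t ε).1.2.2 + (z t ε).2 3,
      (hadm t ε).snd, hu t ε, hv t ε, fun θ => by simp only [F3, predict_three hσ]; congr 2; ring⟩
  have k0 := s0.avg T le_rfl _ (hz.comp F0) m0
  have k1 := s0.avg T le_rfl _ (hz.comp F1) m1
  have k2 := s2.avg T le_rfl _ (hz.comp F2) m2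
  have k3 := s3.avg T le_rfl _ (hz.comp F3) m3
  have hpt : ∀ ε : Fin T → ℤˣ,
      (⨆ θ : Theta m d, ∑ t, sg (ε t) * loss σ κ₁ κ₂ (z t ε) (θ : Param m d)) ≤
      (⨆ θ, |∑ t, sg (ε t) * F0 (z t ε) θ|) + (⨆ θ, |∑ t, sg (ε t) * F1 (z t ε) θ|)
      + (⨆ θ, |∑ t, sg (ε t) * F2 (z t ε) θ|) + (⨆ θ, |∑ t, sg (ε t) * F3 (z t ε) θ|) := by
    intro ε
    refine ciSup_le fun θ => ?_
    have e : ∑ t, sg (ε t) * loss σ κ₁ κ₂ (z t ε) (θ : Param m d) =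
        ∑ t, sg (ε t) * F0 (z t ε) θ + ∑ t, sg (ε t) * F1 (z t ε) θ
        + ∑ t, sg (ε t) * F2 (z t ε) θ + ∑ t, sg (ε t) * F3 (z t ε) θ := by
      rw [← Finset.sum_add_distrib, ← Finset.sum_add_distrib, ← Finset.sum_add_distrib]
      refine Finset.sum_congr rfl fun t _ => ?_
      rw [← mul_add, ← mul_add, ← mul_add]
      rfl
    rw [e]
    have b0 := le_ciSup (bddAbove_abs_sum ε (fun t => F0 (z t ε)) fun t θ => s0.bdd _ (m0 t ε) θ) θ
    have b1 := le_ciSup (bddAbove_abs_sum ε (fun t => F1 (z t ε)) fun t θ => s0.bdd _ (m1 t ε) θ) θ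
    have b2 := le_ciSup (bddAbove_abs_sum ε (fun t => F2 (z t ε)) fun t θ => s2.bdd _ (m2 t ε) θ) θ
    have b3 := le_ciSup (bddAbove_abs_sum ε (fun t => F3 (z t ε)) fun t θ => s3.bdd _ (m3 t ε) θ) θ
    exact add_le_add (add_le_add (add_le_add ((le_abs_self _).trans b0) ((le_abs_self _).trans b1))
      ((le_abs_self _).trans b2)) ((le_abs_self _).trans b3)
  refine (signAvg_mono hpt).trans ?_
  rw [signAvg_add, signAvg_add, signAvg_add]
  have n0 : 33 * (b₀ + L₀) * (63 * ρ * l ^ 3 * l ^ 2)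
      ≤ 33 * (b₀ + L₀) * (63 * ρ) * (B ^ 4 * l ^ 12) := by
    have h1 : l ^ 3 * l ^ 2 ≤ B ^ 4 * l ^ 12 := by
      rw [← pow_add]
      exact (pow_le_pow_right₀ hl (by norm_num)).trans
        (le_mul_of_one_le_left (by positivity) (hBk 4))
    calc _ = 33 * (b₀ + L₀) * (63 * ρ) * (l ^ 3 * l ^ 2) := by ring
      _ ≤ _ := by gcongr
  have n2 : 33 * (κ₁ ^ 2 + 2 * κ₁) * (32 * (65 * ρ * B * l ^ 3) ^ 2 * l ^ 2 * l ^ 2)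
      ≤ 33 * (κ₁ ^ 2 + 2 * κ₁) * (32 * (65 * ρ) ^ 2) * (B ^ 4 * l ^ 12) := by
    have h1 : B ^ 2 * l ^ 10 ≤ B ^ 4 * l ^ 12 := by
      gcongr <;> first | assumption | norm_num
    calc _ = 33 * (κ₁ ^ 2 + 2 * κ₁) * (32 * (65 * ρ) ^ 2) * (B ^ 2 * l ^ 10) := by ring
      _ ≤ _ := by gcongr
  -- The Hessian term determines the exponents: (B²l⁴)²·l²·l² = B⁴l¹².
  have n3 : 33 * (κ₂ ^ 2 + 2 * κ₂) * (32 * (575 * ρ * B ^ 2 * l ^ 4) ^ 2 * l ^ 2 * l ^ 2)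
      ≤ 33 * (κ₂ ^ 2 + 2 * κ₂) * (32 * (575 * ρ) ^ 2) * (B ^ 4 * l ^ 12) :=
    le_of_eq (by ring)
  have hs := Real.sqrt_nonneg (T : ℝ)
  have := mul_le_mul_of_nonneg_right n0 hs
  have := mul_le_mul_of_nonneg_right n2 hs
  have := mul_le_mul_of_nonneg_right n3 hs
  linarith

end ViOlin

namespace ViOlin

variable {m d T : ℕ} {σ : ℝ → ℝ}

/-! ### Gaussian noise -/

instance (d T : ℕ) : IsProbabilityMeasure (noiseLaw d T) := by
  unfold noiseLaw; infer_instance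

lemma map_inner_stdGaussian (g : Act d) :
    (stdGaussian (Act d)).map (fun u => inner ℝ g u) = gaussianReal 0 (‖g‖ ^ 2).toNNReal := by
  have h := IsGaussian.map_eq_gaussianReal (μ := stdGaussian (Act d)) (innerSL ℝ g)
  rw [integral_strongDual_stdGaussian, variance_dual_stdGaussian, innerSL_apply_norm] at h
  exact h

lemma inner_single_left (j : Fin d) (u : Act d) :
    inner ℝ (EuclideanSpace.single j (1 : ℝ)) u = u j := by
  simp [EuclideanSpace.inner_single_left]

lemma map_coord_stdGaussian (j : Fin d) :
    (stdGaussian (Act d)).map (fun u => u j) = gaussianReal 0 1 := by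
  have := map_inner_stdGaussian (EuclideanSpace.single j (1 : ℝ))
  simpa [inner_single_left] using this

lemma measurePreserving_noise (t : Fin T) : MeasurePreserving (fun ξ : Fin T → Noise d => ξ t)
    (noiseLaw d T) ((stdGaussian (Act d)).prod (stdGaussian (Act d))) :=
  measurePreserving_eval _ t

lemma map_noise_fst (t : Fin T) (j : Fin d) :
    (noiseLaw d T).map (fun ξ => (ξ t).1 j) = gaussianReal 0 1 := by
  have h : MeasurePreserving (fun ξ : Fin T → Noise d => (ξ t).1) (noiseLaw d T)
    (stdGaussian (Act d)) := measurePreserving_fst.comp (measurePreserving_noise t)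
  rw [← map_coord_stdGaussian j, ← h.map_eq, Measure.map_map (by fun_prop) (by fun_prop)]
  rfl

lemma map_noise_snd (t : Fin T) (j : Fin d) :
    (noiseLaw d T).map (fun ξ => (ξ t).2 j) = gaussianReal 0 1 := by
  have h : MeasurePreserving (fun ξ : Fin T → Noise d => (ξ t).2) (noiseLaw d T)
    (stdGaussian (Act d)) := measurePreserving_snd.comp (measurePreserving_noise t)
  rw [← map_coord_stdGaussian j, ← h.map_eq, Measure.map_map (by fun_prop) (by fun_prop)]
  rfl

lemma integrable_exp_of_map {Ω : Type*} [MeasurableSpace Ω] {μ : Measure Ω} {X : Ω → ℝ}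
    (hX : Measurable X) (h : μ.map X = gaussianReal 0 1) (c : ℝ) :
    Integrable (fun ω => Real.exp (c * X ω)) μ := by
  have := integrable_exp_mul_gaussianReal (μ := 0) (v := 1) c
  rw [← h] at this
  exact this.comp_measurable hX

lemma integral_exp_of_map {Ω : Type*} [MeasurableSpace Ω] {μ : Measure Ω} {X : Ω → ℝ}
    (h : μ.map X = gaussianReal 0 1) (c : ℝ) :
    ∫ ω, Real.exp (c * X ω) ∂μ = Real.exp (c ^ 2 / 2) := by
  have := mgf_gaussianReal h c
  simpa [mgf] using this

/-- A smooth proxy for the exponential of the largest noise coordinate. -/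
noncomputable def noiseSum (ξ : Fin T → Noise d) : ℝ :=
  ∑ t, ∑ j, ((Real.exp (1 * (ξ t).1 j) + Real.exp (-1 * (ξ t).1 j))
    + (Real.exp (1 * (ξ t).2 j) + Real.exp (-1 * (ξ t).2 j)))

lemma integrable_noiseSum : Integrable (noiseSum (d := d) (T := T)) (noiseLaw d T) := by
  refine integrable_finsetSum _ fun t _ => integrable_finsetSum _ fun j _ => ?_
  have h1 := integrable_exp_of_map (by fun_prop) (map_noise_fst (d := d) t j)
  have h2 := integrable_exp_of_map (by fun_prop) (map_noise_snd (d := d) t j)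
  exact ((h1 1).add (h1 (-1))).add ((h2 1).add (h2 (-1)))

lemma integral_noiseSum :
    ∫ ξ, noiseSum ξ ∂noiseLaw d T = 4 * (d * T) * Real.exp (1 / 2) := by
  have h1 := fun (t : Fin T) (j : Fin d) =>
    integrable_exp_of_map (by fun_prop) (map_noise_fst (d := d) t j)
  have h2 := fun (t : Fin T) (j : Fin d) =>
    integrable_exp_of_map (by fun_prop) (map_noise_snd (d := d) t j)
  have h3 := fun (t : Fin T) (j : Fin d) =>
    integral_exp_of_map (map_noise_fst (d := d) t j)
  have h4 := fun (t : Fin T) (j : Fin d) =>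
    integral_exp_of_map (map_noise_snd (d := d) t j)
  have i1 : ∀ (t : Fin T) (j : Fin d), Integrable (fun ξ : Fin T → Noise d =>
      Real.exp (1 * (ξ t).1 j) + Real.exp (-1 * (ξ t).1 j)) (noiseLaw d T) :=
    fun t j => (h1 t j 1).add (h1 t j (-1))
  have i2 : ∀ (t : Fin T) (j : Fin d), Integrable (fun ξ : Fin T → Noise d =>
      Real.exp (1 * (ξ t).2 j) + Real.exp (-1 * (ξ t).2 j)) (noiseLaw d T) :=
    fun t j => (h2 t j 1).add (h2 t j (-1))
  have i3 : ∀ (t : Fin T) (j : Fin d), Integrable (fun ξ : Fin T → Noise d =>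
      (Real.exp (1 * (ξ t).1 j) + Real.exp (-1 * (ξ t).1 j))
      + (Real.exp (1 * (ξ t).2 j) + Real.exp (-1 * (ξ t).2 j))) (noiseLaw d T) :=
    fun t j => (i1 t j).add (i2 t j)
  unfold noiseSum
  rw [integral_finsetSum _ fun t _ => integrable_finsetSum _ fun j _ => i3 t j]
  have : ∀ t : Fin T, ∫ ξ : Fin T → Noise d, ∑ j,
      ((Real.exp (1 * (ξ t).1 j) + Real.exp (-1 * (ξ t).1 j))
      + (Real.exp (1 * (ξ t).2 j) + Real.exp (-1 * (ξ t).2 j))) ∂noiseLaw d T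
      = d * (4 * Real.exp (1 / 2)) := by
    intro t
    rw [integral_finsetSum _ fun j _ => i3 t j]
    have : ∀ j : Fin d, ∫ ξ : Fin T → Noise d,
        ((Real.exp (1 * (ξ t).1 j) + Real.exp (-1 * (ξ t).1 j))
        + (Real.exp (1 * (ξ t).2 j) + Real.exp (-1 * (ξ t).2 j))) ∂noiseLaw d T
        = 4 * Real.exp (1 / 2) := by
      intro j
      rw [integral_add (i1 t j) (i2 t j), integral_add (h1 t j 1) (h1 t j (-1)), integral_add (h2 t j 1) (h2 t j (-1)),
        h3, h3, h4, h4]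
      norm_num; ring
    simp only [this]
    simp
  simp only [this]
  simp; ring

lemma exp_abs_le (x : ℝ) : Real.exp |x| ≤ Real.exp (1 * x) + Real.exp (-1 * x) := by
  rw [one_mul, neg_one_mul]
  rcases abs_cases x with ⟨h, -⟩ | ⟨h, -⟩ <;> rw [h]
  · linarith [Real.exp_pos (-x)]
  · linarith [Real.exp_pos x]

lemma exp_abs_le_noiseSum (ξ : Fin T → Noise d) (t : Fin T) (j : Fin d) :
    Real.exp |(ξ t).1 j| ≤ noiseSum ξ ∧ Real.exp |(ξ t).2 j| ≤ noiseSum ξ := by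
  have h : (Real.exp (1 * (ξ t).1 j) + Real.exp (-1 * (ξ t).1 j))
      + (Real.exp (1 * (ξ t).2 j) + Real.exp (-1 * (ξ t).2 j)) ≤ noiseSum ξ := by
    refine le_trans ?_ (Finset.single_le_sum (f := fun t => ∑ j,
      ((Real.exp (1 * (ξ t).1 j) + Real.exp (-1 * (ξ t).1 j))
      + (Real.exp (1 * (ξ t).2 j) + Real.exp (-1 * (ξ t).2 j))))
      (fun t _ => Finset.sum_nonneg fun j _ => by positivity) (Finset.mem_univ t))
    exact Finset.single_le_sum (f := fun j =>
      ((Real.exp (1 * (ξ t).1 j) + Real.exp (-1 * (ξ t).1 j))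
      + (Real.exp (1 * (ξ t).2 j) + Real.exp (-1 * (ξ t).2 j))))
      (fun j _ => by positivity) (Finset.mem_univ j)
  have h1 := exp_abs_le ((ξ t).1 j)
  have h2 := exp_abs_le ((ξ t).2 j)
  have p1 : 0 < Real.exp (1 * (ξ t).1 j) + Real.exp (-1 * (ξ t).1 j) := by positivity
  have p2 : 0 < Real.exp (1 * (ξ t).2 j) + Real.exp (-1 * (ξ t).2 j) := by positivity
  constructor <;> linarith

/-- Used with x the logarithm of `noiseSum` and L = log(dT + 2): the fourth power of the noise level
is traded for exp x, which is `noiseSum` itself and has an explicit mean, while exp(-L) cancels the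
size of that mean. -/
lemma pow_four_le_exp {x L : ℝ} (hx : 0 ≤ x) (hL : 0 ≤ L) :
    x ^ 4 ≤ 8 * (L ^ 4 + 24 * Real.exp (x - L)) := by
  rcases le_total x L with h | h
  · have h1 : x ^ 4 ≤ L ^ 4 := by gcongr
    have h2 : 0 ≤ L ^ 4 := by positivity
    linarith [Real.exp_pos (x - L)]
  · have h1 := Real.pow_div_factorial_le_exp (x - L) (by linarith) 4
    have h2 : (x - L) ^ 4 ≤ 24 * Real.exp (x - L) := by
      have : ((Nat.factorial 4 : ℕ) : ℝ) = 24 := by norm_num [Nat.factorial]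
      rw [this] at h1
      linarith
    have h3 : x ^ 4 ≤ 8 * (L ^ 4 + (x - L) ^ 4) := by
      have a := add_pow_le hL (by linarith : 0 ≤ x - L) 4
      norm_num at a
      linarith
    linarith

/-! ### The sequential Rademacher complexity of the losses -/

/-- For fixed noise `exists_signAvg_loss_le` applies with `B = 1 + log (noiseSum ξ)` and `l = 2 *
Λ`. The mean of B⁴ is of order Λ⁴, which together with l¹² gives the exponent 16. -/
lemma exists_seqRademacher_le {ρ κ₁ κ₂ : ℝ} (hρ : 1 ≤ ρ) (hκ₁ : 0 ≤ κ₁) (hκ₂ : 0 ≤ κ₂) :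
    ∃ C : ℝ, 0 ≤ C ∧ ∀ (m d T : ℕ) (σ : ℝ → ℝ), IsSmoothActivation σ → 1 ≤ d → 1 ≤ T →
      seqRademacher m d T ρ σ κ₁ κ₂ ≤ C * Real.log (d * T + 2) ^ 16 * √T := by
  obtain ⟨C, hC, hmain⟩ := exists_signAvg_loss_le hρ hκ₁ hκ₂
  refine ⟨C * 2 ^ 12 * 12400, by positivity, ?_⟩
  intro m d T σ hσ hd hT
  have hd' : (1 : ℝ) ≤ d := by exact_mod_cast hd
  have hT' : (1 : ℝ) ≤ T := by exact_mod_cast hT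
  set Λ := Real.log (d * T + 2) with hΛ
  have hdT : (1 : ℝ) ≤ d * T := one_le_mul_of_one_le_of_one_le hd' hT'
  have hΛ1 : 1 ≤ Λ := by
    rw [hΛ, Real.le_log_iff_exp_le (by positivity)]
    linarith [Real.exp_one_lt_d9]
  have hlog2 : Real.log 2 ≤ Λ := Real.log_le_log (by norm_num) (by linarith)
  have hld : Real.log (2 * d) ≤ 2 * Λ := by
    rw [Real.log_mul (by norm_num) (by positivity)]
    have : Real.log d ≤ Λ := Real.log_le_log (by positivity) (by nlinarith)
    linarith
  have hlT : Real.log (2 * T) ≤ 2 * Λ := by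
    rw [Real.log_mul (by norm_num) (by positivity)]
    have : Real.log T ≤ Λ := Real.log_le_log (by positivity) (by nlinarith)
    linarith
  refine Real.sSup_le ?_ (by positivity)
  rintro _ ⟨x, y, htree, rfl⟩
  let bd : (Fin T → Noise d) → ℝ := fun ξ =>
    C * ((8 + 64 * Λ ^ 4 + 1536 * Real.exp (-Λ) * noiseSum ξ) * (2 * Λ) ^ 12) * √T
  have hbdint : Integrable bd (noiseLaw d T) :=
    (((((integrable_const _).add (integrable_noiseSum.const_mul _)).mul_const _).const_mul
      _).mul_const _)
  have hpt : ∀ ξ : Fin T → Noise d, (2 ^ T : ℝ)⁻¹ * ∑ ε : Fin T → ℤˣ,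
      ⨆ θ : Theta m d, ∑ t, (((ε t : ℤˣ) : ℤ) : ℝ) *
        loss σ κ₁ κ₂ ((x t ε ξ, ξ t), y t ε ξ) (θ : Param m d) ≤ bd ξ := by
    intro ξ
    set S := noiseSum ξ with hS
    have hS1 : 1 ≤ S := (Real.one_le_exp (abs_nonneg _)).trans
      (exp_abs_le_noiseSum ξ ⟨0, hT⟩ ⟨0, hd⟩).1
    have hlogS : 0 ≤ Real.log S := Real.log_nonneg hS1
    have hcoord : ∀ c : ℝ, Real.exp |c| ≤ S → |c| ≤ 1 + Real.log S := by
      intro c hc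
      have := (Real.le_log_iff_exp_le (by linarith)).2 hc
      linarith
    have h1 := hmain m d T σ hσ (1 + Real.log S) (2 * Λ) (by linarith) (by linarith) hld hlT
      (fun t ε => ((x t ε ξ, ξ t), y t ε ξ))
      (fun t ε ε' h => by
        obtain ⟨e1, e2⟩ := htree.2 t ε ε' h
        simp only [e1, e2])
      (fun t ε => ⟨((htree.1 ε).action_bound t ξ).1, ((htree.1 ε).action_bound t ξ).2,
        ((htree.1 ε).label_bound t ξ).1, ((htree.1 ε).label_bound t ξ).2⟩)
      (fun t ε j => hcoord _ (exp_abs_le_noiseSum ξ t j).1)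
      (fun t ε j => hcoord _ (exp_abs_le_noiseSum ξ t j).2)
    refine h1.trans ?_
    have h2 := pow_four_le_exp hlogS (by linarith : 0 ≤ Λ)
    have h3 : Real.exp (Real.log S - Λ) = Real.exp (-Λ) * S := by
      rw [sub_eq_neg_add, Real.exp_add, Real.exp_log (by linarith)]
    rw [h3] at h2
    have h4 : (1 + Real.log S) ^ 4 ≤ 8 + 64 * Λ ^ 4 + 1536 * Real.exp (-Λ) * S := by
      have a := add_pow_le zero_le_one hlogS 4
      norm_num at a
      linarith
    simp only [bd]
    gcongr
  have hle : treeComplexity m σ κ₁ κ₂ x y ≤ ∫ ξ, bd ξ ∂noiseLaw d T := by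
    unfold treeComplexity
    -- Integrability of the supremum is not needed: otherwise the integral is zero by convention,
    -- and the bound is nonnegative.
    by_cases hint : Integrable (fun ξ : Fin T → Noise d => (2 ^ T : ℝ)⁻¹ * ∑ ε : Fin T → ℤˣ,
      ⨆ θ : Theta m d, ∑ t, (((ε t : ℤˣ) : ℤ) : ℝ) *
        loss σ κ₁ κ₂ ((x t ε ξ, ξ t), y t ε ξ) (θ : Param m d)) (noiseLaw d T)
    · exact integral_mono hint hbdint hpt
    · rw [integral_undef hint]
      refine integral_nonneg fun ξ => ?_
      have : 0 ≤ noiseSum ξ := Finset.sum_nonneg fun t _ => Finset.sum_nonneg fun j _ => by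
        positivity
      simp only [bd, Pi.zero_apply]
      positivity
  refine hle.trans ?_
  have hI : ∫ ξ, bd ξ ∂noiseLaw d T = C * ((8 + 64 * Λ ^ 4
      + 1536 * Real.exp (-Λ) * (4 * (d * T) * Real.exp (1 / 2))) * (2 * Λ) ^ 12) * √T := by
    simp only [bd]
    rw [integral_mul_const, integral_const_mul, integral_mul_const,
      integral_add (integrable_const _) (integrable_noiseSum.const_mul _), integral_const_mul,
      integral_noiseSum]
    simp
  rw [hI]
  have hexp : Real.exp (-Λ) * (d * T) ≤ 1 := by
    rw [Real.exp_neg, hΛ, Real.exp_log (by positivity), inv_mul_le_iff₀ (by positivity)]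
    linarith
  have he : Real.exp (1 / 2) ≤ 2 := by
    have : Real.exp (1 / 2) * Real.exp (1 / 2) = Real.exp 1 := by rw [← Real.exp_add]; norm_num
    nlinarith [Real.exp_one_lt_d9, Real.exp_pos (1 / 2)]
  -- With `exp (-Λ) * (d * T) ≤ 1` and `exp (1 / 2) ≤ 2` the sum of the constants is 8 + 64 + 1536·8
  -- = 12360.
  have hfin : 8 + 64 * Λ ^ 4 + 1536 * Real.exp (-Λ) * (4 * (d * T) * Real.exp (1 / 2))
      ≤ 12400 * Λ ^ 4 := by
    have h1 : Real.exp (-Λ) * (d * T) * Real.exp (1 / 2) ≤ 1 * 2 := by gcongr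
    have h2 : (1 : ℝ) ≤ Λ ^ 4 := one_le_pow₀ hΛ1
    nlinarith
  calc _ ≤ C * ((12400 * Λ ^ 4) * (2 * Λ) ^ 12) * √T := by gcongr
    _ = _ := by ring

end ViOlin

/-! ### Regret of a run with a good learner -/

namespace ViOlin

variable {m d T : ℕ} {σ : ℝ → ℝ}

/-! ### Resampling one coordinate of a product measure -/

lemma measurePreserving_update {Ω ι : Type*} [Fintype ι] [DecidableEq ι] [MeasurableSpace Ω]
    (ν : Measure Ω) [IsProbabilityMeasure ν] (t : ι) :
    MeasurePreserving (fun p : (ι → Ω) × Ω => Function.update p.1 t p.2)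
      ((Measure.pi fun _ => ν).prod ν) (Measure.pi fun _ => ν) := by
  have hm : Measurable (fun p : (ι → Ω) × Ω => Function.update p.1 t p.2) := by
    refine measurable_pi_iff.2 fun i => ?_
    by_cases h : i = t
    · subst h; simpa using measurable_snd
    · simp only [Function.update_of_ne h]; fun_prop
  refine ⟨hm, (Measure.pi_eq fun s hs => ?_).symm⟩
  rw [Measure.map_apply hm (MeasurableSet.univ_pi hs)]
  have e : (fun p : (ι → Ω) × Ω => Function.update p.1 t p.2) ⁻¹' (Set.univ.pi s)
      = (Set.univ.pi (Function.update s t Set.univ)) ×ˢ s t := by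
    ext ⟨ξ, w⟩
    simp only [Set.mem_preimage, Set.mem_pi, Set.mem_univ, true_imp_iff, Set.mem_prod]
    constructor
    · intro h
      refine ⟨fun i => ?_, by simpa using h t⟩
      by_cases hi : i = t
      · subst hi; simp
      · simpa [Function.update_of_ne hi] using h i
    · rintro ⟨h1, h2⟩ i
      by_cases hi : i = t
      · subst hi; simpa using h2
      · simpa [Function.update_of_ne hi] using h1 i
  rw [e, Measure.prod_prod, Measure.pi_pi, ← Finset.prod_erase_mul _ _ (Finset.mem_univ t),
    ← Finset.prod_erase_mul (a := t) _ (fun i => ν (s i)) (Finset.mem_univ t)]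
  simp only [Function.update_self, measure_univ, mul_one]
  congr 1
  refine Finset.prod_congr rfl fun i hi => ?_
  rw [Function.update_of_ne (Finset.ne_of_mem_erase hi)]

/-- The law of the noise of one round. -/
noncomputable abbrev roundLaw (d : ℕ) : Measure (Noise d) :=
  (stdGaussian (Act d)).prod (stdGaussian (Act d))

/-- This replaces conditioning on the other rounds. After the substitution of a fresh `w` in round
`t`, everything decided before that round is unchanged, so only the dependence on `w` remains in the
inner integral. -/
lemma integral_resample (t : Fin T) {F : (Fin T → Noise d) → ℝ}
    (hF : Integrable F (noiseLaw d T)) :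
    ∫ ξ, F ξ ∂noiseLaw d T
      = ∫ ξ, ∫ w, F (Function.update ξ t w) ∂roundLaw d ∂noiseLaw d T := by
  have h := measurePreserving_update (ι := Fin T) (roundLaw d) t
  have h1 : Integrable (fun p : (Fin T → Noise d) × Noise d => F (Function.update p.1 t p.2))
      ((noiseLaw d T).prod (roundLaw d)) := h.integrable_comp_of_integrable hF
  rw [← integral_prod (fun p : (Fin T → Noise d) × Noise d => F (Function.update p.1 t p.2)) h1]
  have h2 : noiseLaw d T = ((noiseLaw d T).prod (roundLaw d)).map
      (fun p : (Fin T → Noise d) × Noise d => Function.update p.1 t p.2) := h.map_eq.symm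
  conv_lhs => rw [h2]
  rw [integral_map h.measurable.aemeasurable]
  rw [← h2]; exact hF.aestronglyMeasurable

lemma integrable_resample (t : Fin T) {F : (Fin T → Noise d) → ℝ}
    (hF : Integrable F (noiseLaw d T)) :
    Integrable (fun ξ => ∫ w, F (Function.update ξ t w) ∂roundLaw d) (noiseLaw d T) := by
  have h := measurePreserving_update (ι := Fin T) (roundLaw d) t
  have h1 : Integrable (fun p : (Fin T → Noise d) × Noise d => F (Function.update p.1 t p.2))
      ((noiseLaw d T).prod (roundLaw d)) := h.integrable_comp_of_integrable hF
  exact h1.integral_prod_left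

lemma integrable_of_bounded {Ω : Type*} [MeasurableSpace Ω] {μ : Measure Ω} [IsFiniteMeasure μ]
    {f : Ω → ℝ} (hf : Measurable f) {C : ℝ} (hC : ∀ ω, |f ω| ≤ C) : Integrable f μ :=
  Integrable.of_bound hf.aestronglyMeasurable C (Filter.Eventually.of_forall hC)

/-! ### Histories and expected losses -/

lemma measurable_history {x : Fin T → (Fin T → Noise d) → Pair d}
    {y : Fin T → (Fin T → Noise d) → Fin 4 → ℝ} (hx : ∀ t, Measurable (x t))
    (hy : ∀ t, Measurable (y t)) (t : Fin T) : Measurable fun ξ => history x y ξ t := by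
  refine measurable_pi_iff.2 fun s => ?_
  exact ((hx _).prodMk (measurable_pi_apply _)).prodMk (hy _)

lemma history_congr {ρ : ℝ} {x : Fin T → (Fin T → Noise d) → Pair d}
    {y : Fin T → (Fin T → Noise d) → Fin 4 → ℝ} (h : IsStrategy ρ x y) (t : Fin T)
    {ξ ξ' : Fin T → Noise d} (hξ : ∀ s, s < t → ξ s = ξ' s) :
    history x y ξ t = history x y ξ' t := by
  ext1 s
  have hs : (⟨s, s.2.trans t.2⟩ : Fin T) < t := s.2
  simp only [history]
  rw [hξ _ hs, h.predictable_x _ ξ ξ' fun u hu => hξ u (hu.trans hs),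
    h.adapted_y _ ξ ξ' fun u hu => hξ u (hu.trans_lt hs)]

lemma IsStrategy.admissible {ρ : ℝ} {x : Fin T → (Fin T → Noise d) → Pair d}
    {y : Fin T → (Fin T → Noise d) → Fin 4 → ℝ} (h : IsStrategy ρ x y) (t : Fin T)
    (ξ : Fin T → Noise d) (w : Noise d) : IsAdmissible ρ ((x t ξ, w), y t ξ) :=
  ⟨(h.action_bound t ξ).1, (h.action_bound t ξ).2, (h.label_bound t ξ).1, (h.label_bound t ξ).2⟩

lemma Measurable.loss (hσ : IsSmoothActivation σ) (κ₁ κ₂ : ℝ) {α : Type*} [MeasurableSpace α]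
    {F : α → Data d} {G : α → Param m d} (hF : Measurable F) (hG : Measurable G) :
    Measurable fun x => loss σ κ₁ κ₂ (F x) (G x) := by
  have := (continuous_loss (m := m) (d := d) hσ κ₁ κ₂).measurable.comp (hF.prodMk hG)
  exact this

lemma Measurable.predict (hσ : IsSmoothActivation σ) {α : Type*} [MeasurableSpace α]
    {F : α → Pair d × Noise d} {G : α → Param m d} (hG : Measurable G) (hF : Measurable F) :
    Measurable fun x => predict σ (G x) (F x) := by
  have := (continuous_predict (m := m) (d := d) hσ).measurable.comp (hG.prodMk hF)
  exact this

lemma measurable_learnerLoss (hσ : IsSmoothActivation σ) (κ₁ κ₂ : ℝ) (R : Learner m d)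
    {x : Fin T → (Fin T → Noise d) → Pair d} {y : Fin T → (Fin T → Noise d) → Fin 4 → ℝ}
    (hx : ∀ t, Measurable (x t)) (hy : ∀ t, Measurable (y t)) (t : Fin T) :
    Measurable fun ξ => ∫ θ : Theta m d, loss σ κ₁ κ₂ ((x t ξ, ξ t), y t ξ) (θ : Param m d)
      ∂(R.dist t (history x y ξ t)) := by
  have := R.isMarkov t
  let η : Kernel (Fin T → Noise d) (Theta m d) :=
    (R.dist t).comap (fun ξ => history x y ξ t) (measurable_history hx hy t)
  have hη : IsMarkovKernel η := by infer_instance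
  have h : Measurable fun p : (Fin T → Noise d) × Theta m d =>
      loss σ κ₁ κ₂ ((x t p.1, p.1 t), y t p.1) (p.2 : Param m d) :=
    Measurable.loss hσ κ₁ κ₂
      ((((hx t).prodMk (measurable_pi_apply t)).prodMk (hy t)).comp measurable_fst)
      (measurable_subtype_coe.comp measurable_snd)
  exact (h.stronglyMeasurable.integral_kernel_prod_right' (κ := η)).measurable

lemma iInf_loss_sum_nonneg (κ₁ κ₂ : ℝ) (z : Fin T → Data d) :
    0 ≤ ⨅ θ : Theta m d, ∑ t, loss σ κ₁ κ₂ (z t) (θ : Param m d) :=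
  Real.iInf_nonneg fun _ => Finset.sum_nonneg fun _ _ => loss_nonneg _ _ _ _

/-- The loss of `θ` against the labels generated by `θs`, averaged over the noise. -/
noncomputable def meanLoss (σ : ℝ → ℝ) (κ₁ κ₂ : ℝ) (θs : Param m d) (x : Pair d)
    (θ : Param m d) : ℝ :=
  ∫ w, loss σ κ₁ κ₂ ((x, w), predict σ θs (x, w)) θ ∂roundLaw d

lemma isAdmissible_predict (hσ : IsSmoothActivation σ) {ρ : ℝ} {θs : Param m d}
    (hθs : θs ∈ Theta m d) {x : Pair d} (h1 : ‖x.1‖ ≤ ρ) (h2 : ‖x.2‖ ≤ ρ) (w : Noise d) :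
    IsAdmissible ρ ((x, w), predict σ θs (x, w)) :=
  ⟨h1, h2, abs_reward_le hσ hθs h1, abs_reward_le hσ hθs h2⟩

lemma loss_truth {κ₁ κ₂ : ℝ} (θs : Param m d) (x : Pair d × Noise d) :
    loss σ κ₁ κ₂ (x, predict σ θs x) θs = 0 := by
  simp [loss, sq_nonneg]

lemma measurable_loss_predict (hσ : IsSmoothActivation σ) (κ₁ κ₂ : ℝ) (θs : Param m d)
    (x : Pair d) : Measurable fun p : Noise d × Theta m d =>
      loss σ κ₁ κ₂ ((x, p.1), predict σ θs (x, p.1)) (p.2 : Param m d) := by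
  refine Measurable.loss hσ κ₁ κ₂ (Measurable.prodMk (by fun_prop) ?_)
    (measurable_subtype_coe.comp measurable_snd)
  exact Measurable.predict hσ measurable_const (by fun_prop)

lemma measurable_meanLoss (hσ : IsSmoothActivation σ) (κ₁ κ₂ : ℝ) (θs : Param m d)
    (x : Pair d) : Measurable fun θ : Theta m d => meanLoss σ κ₁ κ₂ θs x (θ : Param m d) :=
  ((measurable_loss_predict hσ κ₁ κ₂ θs x).stronglyMeasurable.integral_prod_left').measurable

lemma meanLoss_nonneg (κ₁ κ₂ : ℝ) (θs : Param m d) (x : Pair d) (θ : Param m d) :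
    0 ≤ meanLoss σ κ₁ κ₂ θs x θ := integral_nonneg fun _ => loss_nonneg _ _ _ _

lemma meanLoss_le (hσ : IsSmoothActivation σ) {ρ : ℝ} (κ₁ κ₂ : ℝ) {θs : Param m d}
    (hθs : θs ∈ Theta m d) {x : Pair d} (h1 : ‖x.1‖ ≤ ρ) (h2 : ‖x.2‖ ≤ ρ) {θ : Param m d}
    (hθ : θ ∈ Theta m d) : meanLoss σ κ₁ κ₂ θs x θ ≤ lossBound ρ κ₁ κ₂ := by
  have h := integral_mono_of_nonneg (μ := roundLaw d)
    (f := fun w => loss σ κ₁ κ₂ ((x, w), predict σ θs (x, w)) θ)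
    (Filter.Eventually.of_forall fun w => loss_nonneg κ₁ κ₂ _ θ)
    (integrable_const (lossBound ρ κ₁ κ₂)) (Filter.Eventually.of_forall fun w =>
      loss_le hσ κ₁ κ₂ (isAdmissible_predict hσ hθs h1 h2 w) hθ)
  simpa [meanLoss] using h

lemma integrable_meanLoss (hσ : IsSmoothActivation σ) {ρ : ℝ} (κ₁ κ₂ : ℝ) {θs : Param m d}
    (hθs : θs ∈ Theta m d) {x : Pair d} (h1 : ‖x.1‖ ≤ ρ) (h2 : ‖x.2‖ ≤ ρ)
    (p : Measure (Theta m d)) [IsProbabilityMeasure p] :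
    Integrable (fun θ : Theta m d => meanLoss σ κ₁ κ₂ θs x (θ : Param m d)) p :=
  integrable_of_bounded (measurable_meanLoss hσ κ₁ κ₂ θs x) (C := lossBound ρ κ₁ κ₂) fun θ => by
    rw [abs_of_nonneg (meanLoss_nonneg _ _ _ _ _)]
    exact meanLoss_le hσ κ₁ κ₂ hθs h1 h2 θ.2

/-! ### Runs of the algorithm -/

section run

variable {ρ : ℝ} {R : Learner m d} {θs : Param m d} {a₀ : Act d}
  {a : Fin (T + 1) → (Fin T → Noise d) → Act d}

lemma integrable_reward (hσ : IsSmoothActivation σ) (b : Act d) (p : Measure (Theta m d))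
    [IsProbabilityMeasure p] : Integrable (fun θ : Theta m d => reward σ (θ : Param m d) b) p :=
  integrable_of_bounded ((continuous_reward hσ).measurable.comp
    (measurable_subtype_coe.prodMk measurable_const)) (C := 1 + ‖b‖ ^ 2 / 2) fun θ =>
    abs_reward_le hσ θ.2 le_rfl

/-- Comparison with the action 0, whose virtual reward is at least -1, while at `b` it is at most 1
- ‖b‖²/2. This is why radius `ρ ≥ 2` accommodates all actions after the initial one. -/
lemma norm_argmax_le (hσ : IsSmoothActivation σ) (p : Measure (Theta m d))
    [IsProbabilityMeasure p] {b : Act d}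
    (hb : ∫ θ : Theta m d, reward σ (θ : Param m d) 0 ∂p
      ≤ ∫ θ : Theta m d, reward σ (θ : Param m d) b ∂p) : ‖b‖ ≤ 2 := by
  have h1 : ∫ θ : Theta m d, reward σ (θ : Param m d) b ∂p ≤ 1 - ‖b‖ ^ 2 / 2 := by
    have := integral_mono (integrable_reward hσ b p) (integrable_const (1 - ‖b‖ ^ 2 / 2))
      fun θ => reward_le hσ θ.2 b
    simpa using this
  have h2 : -1 ≤ ∫ θ : Theta m d, reward σ (θ : Param m d) 0 ∂p := by
    have := integral_mono (integrable_const (-1)) (integrable_reward hσ (0 : Act d) p)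
      fun θ => by simpa using le_reward hσ θ.2 (0 : Act d)
    simpa using this
  nlinarith [norm_nonneg b]

lemma IsRun.norm_succ_le (hσ : IsSmoothActivation σ) (h : IsRun σ R θs a₀ a) (t : Fin T)
    (ξ : Fin T → Noise d) : ‖a t.succ ξ‖ ≤ 2 := by
  have := (R.isMarkov t).isProbabilityMeasure (history (runPair a) (runLabel σ θs a) ξ t)
  exact norm_argmax_le hσ _ (h.argmax t ξ 0)

lemma IsRun.norm_le (hσ : IsSmoothActivation σ) (h : IsRun σ R θs a₀ a) (hρ : 2 ≤ ρ)
    (ha₀ : ‖a₀‖ ≤ ρ) (t : Fin (T + 1)) (ξ : Fin T → Noise d) : ‖a t ξ‖ ≤ ρ := by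
  induction t using Fin.cases with
  | zero => rw [h.init]; exact ha₀
  | succ t => exact (h.norm_succ_le hσ t ξ).trans hρ

lemma IsRun.predictable_castSucc (h : IsRun σ R θs a₀ a) (t : Fin T) {ξ ξ' : Fin T → Noise d}
    (hξ : ∀ s, s < t → ξ s = ξ' s) : a t.castSucc ξ = a t.castSucc ξ' := by
  rcases Fin.eq_zero_or_eq_succ t.castSucc with h0 | ⟨s, hs⟩
  · rw [h0, h.init, h.init]
  · rw [hs]
    have hst : s < t := by
      have h1 : (t : ℕ) = s + 1 := by simpa using congrArg Fin.val hs
      exact Fin.lt_def.2 (by omega)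
    exact h.predictable s ξ ξ' fun u hu => hξ u (hu.trans hst)

lemma IsRun.runPair_congr (h : IsRun σ R θs a₀ a) (t : Fin T) {ξ ξ' : Fin T → Noise d}
    (hξ : ∀ s, s < t → ξ s = ξ' s) : runPair a t ξ = runPair a t ξ' := by
  simp only [runPair, h.predictable t ξ ξ' hξ, h.predictable_castSucc t hξ]

lemma IsRun.isStrategy (hσ : IsSmoothActivation σ) (h : IsRun σ R θs a₀ a) (hρ : 2 ≤ ρ)
    (hθs : θs ∈ Theta m d) (ha₀ : ‖a₀‖ ≤ ρ) :
    IsStrategy ρ (runPair a) (runLabel σ θs a) where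
  measurable_x t := (h.measurable _).prodMk (h.measurable _)
  measurable_y t := Measurable.predict hσ measurable_const
    (((h.measurable _).prodMk (h.measurable _)).prodMk (measurable_pi_apply t))
  predictable_x t ξ ξ' hξ := h.runPair_congr t hξ
  adapted_y t ξ ξ' hξ := by
    simp only [runLabel, h.runPair_congr t fun s hs => hξ s hs.le, hξ t le_rfl]
  action_bound t ξ := ⟨h.norm_le hσ hρ ha₀ _ ξ, h.norm_le hσ hρ ha₀ _ ξ⟩
  label_bound t ξ := ⟨abs_reward_le hσ hθs (h.norm_le hσ hρ ha₀ t.succ ξ),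
    abs_reward_le hσ hθs (h.norm_le hσ hρ ha₀ t.castSucc ξ)⟩

/-- The expected loss of the learner in round `t`, averaged over the noise of that round. -/
noncomputable def runLoss (σ : ℝ → ℝ) (κ₁ κ₂ : ℝ) (R : Learner m d) (θs : Param m d)
    (a : Fin (T + 1) → (Fin T → Noise d) → Act d) (t : Fin T) (ξ : Fin T → Noise d) : ℝ :=
  ∫ θ : Theta m d, meanLoss σ κ₁ κ₂ θs (runPair a t ξ) (θ : Param m d)
    ∂(R.dist t (history (runPair a) (runLabel σ θs a) ξ t))

lemma runLoss_nonneg (κ₁ κ₂ : ℝ) (t : Fin T) (ξ : Fin T → Noise d) :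
    0 ≤ runLoss σ κ₁ κ₂ R θs a t ξ := integral_nonneg fun _ => meanLoss_nonneg _ _ _ _ _

/-- The distribution of the learner in round `t` depends on earlier noise only; after resampling
that round, Fubini exchanges the averages over θ and over the fresh noise. -/
lemma IsRun.integral_runLoss (hσ : IsSmoothActivation σ) (h : IsRun σ R θs a₀ a) (hρ : 2 ≤ ρ)
    (hθs : θs ∈ Theta m d) (ha₀ : ‖a₀‖ ≤ ρ) (κ₁ κ₂ : ℝ) (t : Fin T) :
    Integrable (runLoss σ κ₁ κ₂ R θs a t) (noiseLaw d T) ∧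
    ∫ ξ, runLoss σ κ₁ κ₂ R θs a t ξ ∂noiseLaw d T =
      ∫ ξ, ∫ θ : Theta m d, loss σ κ₁ κ₂ ((runPair a t ξ, ξ t), runLabel σ θs a t ξ)
        (θ : Param m d) ∂(R.dist t (history (runPair a) (runLabel σ θs a) ξ t)) ∂noiseLaw d T := by
  have hs := h.isStrategy hσ hρ hθs ha₀
  have hprob : ∀ ξ, IsProbabilityMeasure
      (R.dist t (history (runPair a) (runLabel σ θs a) ξ t)) := fun ξ =>
    (R.isMarkov t).isProbabilityMeasure _
  let F : (Fin T → Noise d) → ℝ := fun ξ => ∫ θ : Theta m d,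
    loss σ κ₁ κ₂ ((runPair a t ξ, ξ t), runLabel σ θs a t ξ)
        (θ : Param m d) ∂(R.dist t (history (runPair a) (runLabel σ θs a) ξ t))
  have hFint : Integrable F (noiseLaw d T) := by
    refine integrable_of_bounded (measurable_learnerLoss hσ κ₁ κ₂ R hs.measurable_x
      hs.measurable_y t) (C := lossBound ρ κ₁ κ₂) fun ξ => ?_
    have := hprob ξ
    have := norm_integral_le_of_norm_le_const (μ := R.dist t
      (history (runPair a) (runLabel σ θs a) ξ t)) (C := lossBound ρ κ₁ κ₂)
      (f := fun θ : Theta m d => loss σ κ₁ κ₂ ((runPair a t ξ, ξ t), runLabel σ θs a t ξ)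
        (θ : Param m d))
      (Filter.Eventually.of_forall fun θ => abs_loss_le hσ κ₁ κ₂ (hs.admissible t ξ (ξ t)) θ.2)
    simpa [F] using this
  have e : (fun ξ => ∫ w, F (Function.update ξ t w) ∂roundLaw d)
      = runLoss σ κ₁ κ₂ R θs a t := by
    ext ξ
    have := hprob ξ
    have hupd : ∀ w s, s < t → Function.update ξ t w s = ξ s := fun w s hs =>
      Function.update_of_ne hs.ne _ _
    have e1 : ∀ w, F (Function.update ξ t w) = ∫ θ : Theta m d,
        loss σ κ₁ κ₂ ((runPair a t ξ, w), predict σ θs (runPair a t ξ, w))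
          (θ : Param m d) ∂(R.dist t (history (runPair a) (runLabel σ θs a) ξ t)) := by
      intro w
      simp only [F]
      rw [history_congr hs t (hupd w)]
      simp only [runLabel, Function.update_self]
      rw [h.runPair_congr t (hupd w)]
    simp only [e1, runLoss, meanLoss]
    refine integral_integral_swap (integrable_of_bounded (measurable_loss_predict hσ κ₁ κ₂ θs _)
      (C := lossBound ρ κ₁ κ₂) fun p => ?_)
    exact abs_loss_le hσ κ₁ κ₂ (isAdmissible_predict hσ hθs (hs.action_bound t ξ).1
      (hs.action_bound t ξ).2 _) p.2.2
  have k1 := integrable_resample t hFint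
  have k2 := integral_resample t hFint
  rw [e] at k1
  exact ⟨k1, k2.symm ▸ by rw [← e]⟩

/-- The guarantee of the learner bounds the expected losses along a run. -/
lemma IsRun.sum_runLoss_le (hσ : IsSmoothActivation σ) (h : IsRun σ R θs a₀ a) (hρ : 2 ≤ ρ)
    (hθs : θs ∈ Theta m d) (ha₀ : ‖a₀‖ ≤ ρ) {κ₁ κ₂ : ℝ} (hR : HasGuarantee T ρ σ κ₁ κ₂ R) :
    ∑ t, ∫ ξ, runLoss σ κ₁ κ₂ R θs a t ξ ∂noiseLaw d T
      ≤ 2 * seqRademacher m d T ρ σ κ₁ κ₂ + 1 := by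
  have hs := h.isStrategy hσ hρ hθs ha₀
  refine le_trans (le_of_eq ?_) (hR _ _ hs)
  -- The ground truth belongs to Θ and predicts its own labels, so the comparator term vanishes and
  -- the regret is the whole loss of the learner.
  have hinf : ∀ ξ : Fin T → Noise d, ⨅ θ : Theta m d, ∑ t : Fin T,
      loss σ κ₁ κ₂ ((runPair a t ξ, ξ t), runLabel σ θs a t ξ) (θ : Param m d) = 0 := by
    intro ξ
    refine le_antisymm ?_ (iInf_loss_sum_nonneg _ _ _)
    have hb : BddBelow (Set.range fun θ : Theta m d => ∑ t : Fin T,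
        loss σ κ₁ κ₂ ((runPair a t ξ, ξ t), runLabel σ θs a t ξ) (θ : Param m d)) :=
      ⟨0, by rintro _ ⟨θ, rfl⟩; exact Finset.sum_nonneg fun _ _ => loss_nonneg _ _ _ _⟩
    refine (ciInf_le hb ⟨θs, hθs⟩).trans (le_of_eq ?_)
    exact Finset.sum_eq_zero fun t _ => loss_truth _ _
  unfold onlineRegret
  simp only [hinf, sub_zero]
  rw [integral_finsetSum]
  · exact Finset.sum_congr rfl fun t _ => (h.integral_runLoss hσ hρ hθs ha₀ κ₁ κ₂ t).2
  · intro t _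
    refine integrable_of_bounded (measurable_learnerLoss hσ κ₁ κ₂ R hs.measurable_x
      hs.measurable_y t) (C := lossBound ρ κ₁ κ₂) fun ξ => ?_
    have := (R.isMarkov t).isProbabilityMeasure (history (runPair a) (runLabel σ θs a) ξ t)
    have := norm_integral_le_of_norm_le_const (μ := R.dist t
      (history (runPair a) (runLabel σ θs a) ξ t)) (C := lossBound ρ κ₁ κ₂)
      (f := fun θ : Theta m d => loss σ κ₁ κ₂ ((runPair a t ξ, ξ t), runLabel σ θs a t ξ)
        (θ : Param m d))
      (Filter.Eventually.of_forall fun θ => abs_loss_le hσ κ₁ κ₂ (hs.admissible t ξ (ξ t)) θ.2)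
    simpa using this

end run

end ViOlin

namespace ViOlin

variable {m d T : ℕ} {σ : ℝ → ℝ}

/-! ### The truncated loss controls the prediction errors -/

/-- The truncated second moment of a standard Gaussian. -/
noncomputable def gaussConst : ℝ := ∫ z, min 1 (z ^ 2) ∂gaussianReal 0 1

lemma integrable_min_sq {Ω : Type*} [MeasurableSpace Ω] {μ : Measure Ω} [IsFiniteMeasure μ]
    {f : Ω → ℝ} (hf : Measurable f) (κ : ℝ) (hκ : 0 ≤ κ) :
    Integrable (fun ω => min κ (f ω ^ 2)) μ :=
  integrable_of_bounded (by fun_prop) (C := κ) fun ω => by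
    rw [abs_of_nonneg (le_min hκ (sq_nonneg _))]
    exact min_le_left _ _

lemma gaussConst_pos : 0 < gaussConst := by
  unfold gaussConst
  have hint : Integrable (fun z : ℝ => min 1 (z ^ 2)) (gaussianReal 0 1) :=
    integrable_min_sq measurable_id 1 zero_le_one
  rw [integral_pos_iff_support_of_nonneg (fun z => le_min zero_le_one (sq_nonneg z)) hint]
  have hs : Function.support (fun z : ℝ => min 1 (z ^ 2)) = {0}ᶜ := by
    ext z
    simp only [Function.mem_support, Set.mem_compl_iff, Set.mem_singleton_iff]
    constructor
    · rintro h rfl; simp at h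
    · intro h
      have : 0 < z ^ 2 := by positivity
      exact (lt_min one_pos this).ne'
  have : NullSingletonClass (gaussianReal 0 1) := nullSingletonClass_gaussianReal (by norm_num)
  rw [hs, measure_compl (MeasurableSet.singleton 0) (by simp), measure_singleton]
  simp

lemma gaussConst_le_one : gaussConst ≤ 1 := by
  unfold gaussConst
  have := integral_mono (μ := gaussianReal 0 1) (integrable_min_sq measurable_id 1 zero_le_one)
    (integrable_const 1) fun z => min_le_left (1 : ℝ) (z ^ 2)
  simpa using this

/-- The inner product has the law of ‖g‖z with z standard normal, and min(κ², ‖g‖²z²) ≥ min(κ²,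
‖g‖²)·min(1, z²). -/
lemma gaussConst_mul_le (g : Act d) (κ : ℝ) :
    gaussConst * min (κ ^ 2) (‖g‖ ^ 2)
      ≤ ∫ u, min (κ ^ 2) (inner ℝ g u ^ 2) ∂stdGaussian (Act d) := by
  have e1 : ∫ u, min (κ ^ 2) (inner ℝ g u ^ 2) ∂stdGaussian (Act d)
      = ∫ z, min (κ ^ 2) (z ^ 2) ∂gaussianReal 0 (‖g‖ ^ 2).toNNReal := by
    rw [← map_inner_stdGaussian, integral_map (by fun_prop)]
    exact Measurable.aestronglyMeasurable (by fun_prop)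
  have e2 : (gaussianReal 0 1).map (‖g‖ * ·) = gaussianReal 0 (‖g‖ ^ 2).toNNReal := by
    rw [gaussianReal_map_const_mul]
    congr 1
    · simp
    · ext; simp
  rw [e1, ← e2, integral_map (by fun_prop) (Measurable.aestronglyMeasurable (by fun_prop)),
    gaussConst, ← integral_mul_const]
  refine integral_mono ((integrable_min_sq measurable_id 1 zero_le_one).mul_const _)
    (integrable_min_sq (f := fun z => ‖g‖ * z) (by fun_prop) _ (sq_nonneg _)) fun z => ?_
  have n1 : 0 ≤ min (κ ^ 2) (‖g‖ ^ 2) := le_min (sq_nonneg _) (sq_nonneg _)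
  refine le_min ?_ ?_
  · exact (mul_le_mul (min_le_left _ _) (min_le_left _ _) n1 zero_le_one).trans_eq (one_mul _)
  · exact (mul_le_mul (min_le_right _ _) (min_le_right _ _) n1 (sq_nonneg _)).trans_eq
      (by ring)

/-- The error of the gradient. -/
noncomputable def gradErr (σ : ℝ → ℝ) (θ θs : Param m d) (a : Act d) : Act d :=
  gradient (reward σ θ) a - gradient (reward σ θs) a

/-- The error of the Hessian. -/
noncomputable def hessErr (σ : ℝ → ℝ) (θ θs : Param m d) (a : Act d) : Act d →L[ℝ] Act d :=
  hess (reward σ θ) a - hess (reward σ θs) a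

lemma inner_gradErr (hσ : IsSmoothActivation σ) (θ θs : Param m d) (a u : Act d) :
    inner ℝ (gradErr σ θ θs a) u = netGrad σ θ a u - netGrad σ θs a u := by
  rw [gradErr, inner_sub_left, inner_gradient_reward hσ, inner_gradient_reward hσ]; ring

lemma inner_hessErr (hσ : IsSmoothActivation σ) (θ θs : Param m d) (a u v : Act d) :
    inner ℝ (hessErr σ θ θs a u) v = netHess σ θ a u v - netHess σ θs a u v := by
  rw [hessErr, sub_apply, inner_sub_left, inner_hess_reward hσ,
    inner_hess_reward hσ]; ring

lemma netHess_comm (θ : Param m d) (a u v : Act d) : netHess σ θ a u v = netHess σ θ a v u := by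
  simp only [netHess, mul_comm (lin _ u)]

/-- The error is tested against itself; the regularizer cancels. Since this bound, like the one for
the Hessian, does not exceed the truncation levels, truncation does not weaken the control of the
errors. -/
lemma norm_gradErr_le (hσ : IsSmoothActivation σ) {θ θs : Param m d} (hθ : θ ∈ Theta m d)
    (hθs : θs ∈ Theta m d) (a : Act d) : ‖gradErr σ θ θs a‖ ≤ 2 := by
  have h := inner_gradErr hσ θ θs a (gradErr σ θ θs a)
  rw [real_inner_self_eq_norm_sq] at h
  have h1 := abs_le.1 (abs_netGrad_le hσ hθ a (gradErr σ θ θs a))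
  have h2 := abs_le.1 (abs_netGrad_le hσ hθs a (gradErr σ θ θs a))
  nlinarith [norm_nonneg (gradErr σ θ θs a)]

lemma norm_hessErr_le (hσ : IsSmoothActivation σ) {θ θs : Param m d} (hθ : θ ∈ Theta m d)
    (hθs : θs ∈ Theta m d) (a : Act d) {e : Act d} (he : ‖e‖ = 1) :
    ‖hessErr σ θ θs a e‖ ≤ 2 := by
  have h := inner_hessErr hσ θ θs a e (hessErr σ θ θs a e)
  rw [real_inner_self_eq_norm_sq] at h
  have h1 := abs_le.1 (abs_netHess_le hσ hθ a e (hessErr σ θ θs a e))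
  have h2 := abs_le.1 (abs_netHess_le hσ hθs a e (hessErr σ θ θs a e))
  rw [he, one_mul] at h1 h2
  nlinarith [norm_nonneg (hessErr σ θ θs a e)]

lemma loss_predict (θ θs : Param m d) (κ₁ κ₂ : ℝ) (x : Pair d) (w : Noise d) :
    loss σ κ₁ κ₂ ((x, w), predict σ θs (x, w)) θ =
      (reward σ θ x.1 - reward σ θs x.1) ^ 2 + (reward σ θ x.2 - reward σ θs x.2) ^ 2
      + min (κ₁ ^ 2) (inner ℝ (gradErr σ θ θs x.2) w.1 ^ 2)
      + min (κ₂ ^ 2) (inner ℝ (hessErr σ θ θs x.2 w.1) w.2 ^ 2) := by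
  simp [loss, predict, gradErr, hessErr, inner_sub_left]

/-- The mean loss controls all prediction errors. -/
lemma gaussConst_sq_mul_le (hσ : IsSmoothActivation σ) {θ θs : Param m d} (hθ : θ ∈ Theta m d)
    (hθs : θs ∈ Theta m d) {κ₁ κ₂ : ℝ} (hκ₁ : 2 ≤ κ₁) (hκ₂ : 2 ≤ κ₂) (x : Pair d) :
    gaussConst ^ 2 * (reward σ θ x.1 - reward σ θs x.1) ^ 2 ≤ meanLoss σ κ₁ κ₂ θs x θ ∧
    gaussConst ^ 2 * (reward σ θ x.2 - reward σ θs x.2) ^ 2 ≤ meanLoss σ κ₁ κ₂ θs x θ ∧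
    gaussConst ^ 2 * ‖gradErr σ θ θs x.2‖ ^ 2 ≤ meanLoss σ κ₁ κ₂ θs x θ ∧
    ∀ e : Act d, ‖e‖ = 1 →
      gaussConst ^ 2 * ‖hessErr σ θ θs x.2 e‖ ^ 2 ≤ meanLoss σ κ₁ κ₂ θs x θ := by
  set H := hessErr σ θ θs x.2 with hH
  set g := gradErr σ θ θs x.2 with hg
  have hc0 := gaussConst_pos
  have hc1 := gaussConst_le_one
  have hcsq : gaussConst ^ 2 ≤ gaussConst := by nlinarith
  have i2 : Integrable (fun w : Noise d => min (κ₁ ^ 2) (inner ℝ g w.1 ^ 2)) (roundLaw d) :=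
    integrable_min_sq (f := fun w : Noise d => inner ℝ g w.1) (by fun_prop) _ (sq_nonneg _)
  have i3 : Integrable (fun w : Noise d => min (κ₂ ^ 2) (inner ℝ (H w.1) w.2 ^ 2)) (roundLaw d) :=
    integrable_min_sq (f := fun w : Noise d => inner ℝ (H w.1) w.2)
      (Continuous.measurable (by fun_prop)) _ (sq_nonneg _)
  have e : meanLoss σ κ₁ κ₂ θs x θ =
      (reward σ θ x.1 - reward σ θs x.1) ^ 2 + (reward σ θ x.2 - reward σ θs x.2) ^ 2
      + ∫ w, min (κ₁ ^ 2) (inner ℝ g w.1 ^ 2) ∂roundLaw d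
      + ∫ w, min (κ₂ ^ 2) (inner ℝ (H w.1) w.2 ^ 2) ∂roundLaw d := by
    unfold meanLoss
    simp only [loss_predict, ← hg, ← hH]
    have i12 : Integrable (fun w : Noise d => (reward σ θ x.1 - reward σ θs x.1) ^ 2
        + (reward σ θ x.2 - reward σ θs x.2) ^ 2 + min (κ₁ ^ 2) (inner ℝ g w.1 ^ 2))
        (roundLaw d) := (integrable_const _).add i2
    rw [integral_add i12 i3, integral_add (integrable_const _) i2]
    simp
  have n2 : 0 ≤ ∫ w, min (κ₁ ^ 2) (inner ℝ g w.1 ^ 2) ∂roundLaw d :=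
    integral_nonneg fun w => le_min (sq_nonneg _) (sq_nonneg _)
  have n3 : 0 ≤ ∫ w, min (κ₂ ^ 2) (inner ℝ (H w.1) w.2 ^ 2) ∂roundLaw d :=
    integral_nonneg fun w => le_min (sq_nonneg _) (sq_nonneg _)
  have l2 : gaussConst * ‖g‖ ^ 2 ≤ ∫ w, min (κ₁ ^ 2) (inner ℝ g w.1 ^ 2) ∂roundLaw d := by
    have h1 := gaussConst_mul_le g κ₁
    have h2 : ‖g‖ ^ 2 ≤ κ₁ ^ 2 := by
      gcongr
      exact (norm_gradErr_le hσ hθ hθs x.2).trans hκ₁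
    rw [min_eq_right h2] at h1
    refine h1.trans (le_of_eq ?_)
    rw [integral_prod _ i2]
    simp
  -- Averaging over the second noise vector leaves min(κ₂², ‖Hu‖²). By symmetry of H this dominates
  -- the truncated square of ⟨He, u⟩, and averaging over u costs a second factor `gaussConst`.
  have l3 : ∀ e : Act d, ‖e‖ = 1 → gaussConst ^ 2 * ‖H e‖ ^ 2
      ≤ ∫ w, min (κ₂ ^ 2) (inner ℝ (H w.1) w.2 ^ 2) ∂roundLaw d := by
    intro e he
    rw [integral_prod _ i3]
    have h1 := gaussConst_mul_le (H e) κ₂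
    have h2 : ‖H e‖ ^ 2 ≤ κ₂ ^ 2 := by
      gcongr
      exact (norm_hessErr_le hσ hθ hθs x.2 he).trans hκ₂
    rw [min_eq_right h2] at h1
    have h3 : ∀ u : Act d, gaussConst * min (κ₂ ^ 2) (inner ℝ (H e) u ^ 2)
        ≤ ∫ v, min (κ₂ ^ 2) (inner ℝ (H u) v ^ 2) ∂stdGaussian (Act d) := by
      intro u
      refine le_trans ?_ (gaussConst_mul_le (H u) κ₂)
      have h4 : inner ℝ (H e) u = inner ℝ (H u) e := by
        rw [hH, inner_hessErr hσ, inner_hessErr hσ, netHess_comm θ, netHess_comm θs]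
      have h5 : inner ℝ (H u) e ^ 2 ≤ ‖H u‖ ^ 2 := by
        rw [← sq_abs]
        gcongr
        have := abs_real_inner_le_norm (H u) e
        rwa [he, mul_one] at this
      rw [h4]
      gcongr
    have h6 := integral_mono ((integrable_min_sq (f := fun u : Act d => inner ℝ (H e) u)
      (by fun_prop) _ (sq_nonneg κ₂)).const_mul gaussConst) i3.integral_prod_left h3
    rw [integral_const_mul] at h6
    calc gaussConst ^ 2 * ‖H e‖ ^ 2 = gaussConst * (gaussConst * ‖H e‖ ^ 2) := by ring
      _ ≤ gaussConst * ∫ u, min (κ₂ ^ 2) (inner ℝ (H e) u ^ 2) ∂stdGaussian (Act d) := by gcongr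
      _ ≤ _ := h6
  rw [e]
  have hsq : ∀ y : ℝ, gaussConst ^ 2 * y ^ 2 ≤ y ^ 2 := fun y =>
    mul_le_of_le_one_left (sq_nonneg y) (by nlinarith)
  have s0 := sq_nonneg (reward σ θ x.1 - reward σ θs x.1)
  have s1 := sq_nonneg (reward σ θ x.2 - reward σ θs x.2)
  refine ⟨by linarith [hsq (reward σ θ x.1 - reward σ θs x.1)],
    by linarith [hsq (reward σ θ x.2 - reward σ θs x.2)], ?_, fun v hv => ?_⟩
  · have : gaussConst ^ 2 * ‖g‖ ^ 2 ≤ gaussConst * ‖g‖ ^ 2 := by gcongr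
    linarith
  · linarith [l3 v hv]

/-- The inequality of arithmetic and geometric means makes the error bound linear in the loss, so
that it can be integrated and summed; `μ` is tuned at the end. -/
lemma abs_le_half_add {c x I μ : ℝ} (hc : 0 < c) (hμ : 0 < μ) (h : c * x ^ 2 ≤ I) :
    |x| ≤ 1 / 2 * (μ + I / (c * μ)) := by
  have h1 : x ^ 2 ≤ I / c := by rw [le_div_iff₀ hc]; linarith
  have h2 : I / (c * μ) = I / c / μ := by rw [div_div]
  have h3 : |x| ^ 2 / μ ≤ I / c / μ := by rw [sq_abs]; gcongr
  have h4 : 2 * |x| ≤ μ + |x| ^ 2 / μ := by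
    have : 0 ≤ (|x| - μ) ^ 2 / μ := by positivity
    have e : (|x| - μ) ^ 2 / μ = |x| ^ 2 / μ - 2 * |x| + μ := by field_simp; ring
    linarith
  rw [h2]; linarith

/-! ### Progress in one round -/

/-- The next action improves the true reward as much as every step from the previous action
would, up to the prediction errors. -/
lemma reward_progress (hσ : IsSmoothActivation σ) {ρ κ₁ κ₂ : ℝ} (hκ₁ : 2 ≤ κ₁) (hκ₂ : 2 ≤ κ₂)
    {θs : Param m d} (hθs : θs ∈ Theta m d) (p : Measure (Theta m d)) [IsProbabilityMeasure p]
    {b a : Act d} (hb : ‖b‖ ≤ ρ) (ha : ‖a‖ ≤ ρ)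
    (hmax : ∀ b', ∫ θ : Theta m d, reward σ (θ : Param m d) b' ∂p
      ≤ ∫ θ : Theta m d, reward σ (θ : Param m d) b ∂p) {μ : ℝ} (hμ : 0 < μ) (s : Act d)
    (hs : ‖s‖ ≤ 1) :
    reward σ θs a + inner ℝ (gradient (reward σ θs) a) s
      + 1 / 2 * inner ℝ (hess (reward σ θs) a s) s - ‖s‖ ^ 3
      - 2 * (μ + (∫ θ : Theta m d, meanLoss σ κ₁ κ₂ θs (b, a) (θ : Param m d) ∂p)
        / (gaussConst ^ 2 * μ)) ≤ reward σ θs b := by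
  have hc : 0 < gaussConst ^ 2 := pow_pos gaussConst_pos 2
  set V := reward σ θs a + inner ℝ (gradient (reward σ θs) a) s
      + 1 / 2 * inner ℝ (hess (reward σ θs) a s) s - ‖s‖ ^ 3 with hV
  let E : Theta m d → ℝ := fun θ => 1 / 2 * (μ + meanLoss σ κ₁ κ₂ θs (b, a) (θ : Param m d)
    / (gaussConst ^ 2 * μ))
  have hEint : Integrable E p :=
    ((integrable_const _).add ((integrable_meanLoss hσ κ₁ κ₂ hθs (x := (b, a)) hb ha p).div_const
      _)).const_mul _
  have hEval : ∫ θ, E θ ∂p = 1 / 2 * (μ + (∫ θ : Theta m d,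
      meanLoss σ κ₁ κ₂ θs (b, a) (θ : Param m d) ∂p) / (gaussConst ^ 2 * μ)) := by
    simp only [E]
    rw [integral_const_mul, integral_add (integrable_const _)
      ((integrable_meanLoss hσ κ₁ κ₂ hθs (x := (b, a)) hb ha p).div_const _), integral_div]
    simp
  have hE0 : ∀ θ, 0 ≤ E θ := fun θ => by
    have := meanLoss_nonneg (σ := σ) κ₁ κ₂ θs (b, a) (θ : Param m d)
    simp only [E]; positivity
  have key1 : ∀ θ : Theta m d, reward σ (θ : Param m d) b ≤ reward σ θs b + E θ := by
    intro θ
    have := abs_le_half_add hc hμ (gaussConst_sq_mul_le hσ θ.2 hθs hκ₁ hκ₂ (b, a)).1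
    have := (abs_le.1 this).2
    simp only [E]
    linarith
  -- At the previous action the errors of the reward and the gradient cost `E θ` each, that of the
  -- Hessian half of it. Together with the error at the new action the total is at most `4 * E θ`.
  have key2 : ∀ θ : Theta m d, V - 3 * E θ ≤ reward σ (θ : Param m d) (a + s) := by
    intro θ
    obtain ⟨-, h1, h2, h3⟩ := gaussConst_sq_mul_le hσ θ.2 hθs hκ₁ hκ₂ (b, a)
    have b1 := (abs_le.1 (abs_le_half_add hc hμ h1)).1
    have hE : E θ = 1 / 2 * (μ + meanLoss σ κ₁ κ₂ θs (b, a) (θ : Param m d)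
      / (gaussConst ^ 2 * μ)) := rfl
    have b2 : -E θ ≤ inner ℝ (gradErr σ θ θs a) s := by
      have h4 := abs_le_half_add hc hμ h2
      rw [abs_of_nonneg (norm_nonneg _), ← hE] at h4
      have h5 := (abs_le.1 (abs_real_inner_le_norm (gradErr σ θ θs a) s)).1
      have h6 : ‖gradErr σ θ θs a‖ * ‖s‖ ≤ E θ * 1 :=
        mul_le_mul h4 hs (norm_nonneg _) (hE0 θ)
      linarith
    -- The control of the Hessian is for unit vectors, so the step is normalized; its length at most
    -- one makes the rescaling harmless.
    have b3 : -E θ ≤ inner ℝ (hessErr σ θ θs a s) s := by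
      rcases eq_or_ne s 0 with rfl | hs0
      · simpa using hE0 θ
      have hn : 0 < ‖s‖ := norm_pos_iff.2 hs0
      set e := ‖s‖⁻¹ • s with he
      have he1 : ‖e‖ = 1 := by
        rw [he, norm_smul, norm_inv, norm_norm, inv_mul_cancel₀ hn.ne']
      have hse : s = ‖s‖ • e := by
        rw [he, smul_smul, mul_inv_cancel₀ hn.ne', one_smul]
      have h4 := abs_le_half_add hc hμ (h3 e he1)
      rw [abs_of_nonneg (norm_nonneg _), ← hE] at h4
      have h5 := (abs_le.1 (abs_real_inner_le_norm (hessErr σ θ θs a e) e)).1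
      rw [he1, mul_one] at h5
      have h6 : inner ℝ (hessErr σ θ θs a s) s
          = ‖s‖ ^ 2 * inner ℝ (hessErr σ θ θs a e) e := by
        conv_lhs => rw [hse]
        rw [map_smul, real_inner_smul_left, real_inner_smul_right]; ring
      rw [h6]
      have h7 : ‖s‖ ^ 2 ≤ 1 := pow_le_one₀ hn.le hs
      have h8 : -E θ ≤ inner ℝ (hessErr σ θ θs a e) e := by
        simp only at h4; linarith
      nlinarith [hE0 θ, sq_nonneg ‖s‖]
    have b4 := (abs_le.1 (reward_taylor hσ θ.2 a s)).1
    rw [gradErr, inner_sub_left] at b2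
    rw [hessErr, sub_apply, inner_sub_left] at b3
    simp only [← hE] at b1
    have := hE0 θ
    linarith
  have hint := integrable_reward hσ (m := m) (d := d) (σ := σ)
  have I1 := integral_mono (hint b p) ((integrable_const (reward σ θs b)).add hEint) key1
  have I2 := integral_mono ((integrable_const V).sub (hEint.const_mul 3)) (hint (a + s) p) key2
  simp only [Pi.add_apply, Pi.sub_apply] at I1 I2
  rw [integral_add (integrable_const _) hEint, hEval] at I1
  rw [integral_sub (integrable_const _) (hEint.const_mul 3), integral_const_mul, hEval] at I2
  simp only [integral_const, probReal_univ, one_smul] at I1 I2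
  have I3 := hmax (a + s)
  linarith

end ViOlin

namespace ViOlin

variable {m d T : ℕ} {σ : ℝ → ℝ}

/-! ### Steps that increase the reward -/

lemma abs_inner_hess_reward_le (hσ : IsSmoothActivation σ) {θ : Param m d} (hθ : θ ∈ Theta m d)
    (a s : Act d) : |inner ℝ (hess (reward σ θ) a s) s| ≤ 2 * ‖s‖ ^ 2 := by
  rw [inner_hess_reward hσ, real_inner_self_eq_norm_sq]
  have h := abs_le.1 (abs_netHess_le hσ hθ a s s)
  rw [abs_le]
  constructor <;> nlinarith [sq_nonneg ‖s‖]

/-- From every point that is not an approximate local maximum, some step increases the reward. -/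
lemma exists_step (hσ : IsSmoothActivation σ) {θ : Param m d} (hθ : θ ∈ Theta m d) {ε ζ : ℝ}
    (hε : 0 < ε) (hε1 : ε ≤ 1) (hζ : 1 ≤ ζ) {a : Act d}
    (ha : ¬ IsApproxLocalMax (reward σ θ) ε (6 * √(ζ * ε)) a) :
    ∃ s : Act d, ‖s‖ ≤ 1 ∧ ε ^ 2 / 8 ≤ inner ℝ (gradient (reward σ θ) a) s
      + 1 / 2 * inner ℝ (hess (reward σ θ) a s) s - ‖s‖ ^ 3 := by
  unfold IsApproxLocalMax at ha
  set g := gradient (reward σ θ) a with hg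
  by_cases h1 : ‖g‖ ≤ ε
  · have h2 : ∃ v : Act d, 6 * √(ζ * ε) * ‖v‖ ^ 2 < inner ℝ (hess (reward σ θ) a v) v := by
      by_contra! h
      exact ha ⟨h1, h⟩
    obtain ⟨v, hv⟩ := h2
    have hv0 : v ≠ 0 := by rintro rfl; simp at hv
    have hn : 0 < ‖v‖ := norm_pos_iff.2 hv0
    -- The quadratic form is even, so the sign of the direction can be chosen to make the gradient
    -- term nonnegative.
    obtain ⟨w, hw1, hw2, hw3⟩ : ∃ w : Act d, ‖w‖ = ‖v‖ ∧ 0 ≤ inner ℝ g w ∧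
        inner ℝ (hess (reward σ θ) a w) w = inner ℝ (hess (reward σ θ) a v) v := by
      rcases le_total 0 (inner ℝ g v) with h | h
      · exact ⟨v, rfl, h, rfl⟩
      · exact ⟨-v, norm_neg v, by rw [inner_neg_right]; linarith, by simp⟩
    have hse : √ε ^ 2 = ε := Real.sq_sqrt hε.le
    have hs0 : 0 < √ε := Real.sqrt_pos.2 hε
    have hs1 : √ε ≤ 1 := Real.sqrt_le_one.2 hε1
    have hsn : ‖(√ε / ‖v‖) • w‖ = √ε := by
      rw [norm_smul, hw1, Real.norm_of_nonneg (by positivity)]; field_simp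
    -- A curvature step of length √ε gains at least ½·ε·6√ε - ε√ε = 2ε√ε.
    refine ⟨(√ε / ‖v‖) • w, by rw [hsn]; exact hs1, ?_⟩
    rw [hsn, map_smul, real_inner_smul_left, real_inner_smul_right, real_inner_smul_right, hw3]
    have e1 : √ε / ‖v‖ * (√ε / ‖v‖ * inner ℝ (hess (reward σ θ) a v) v)
        = ε * (inner ℝ (hess (reward σ θ) a v) v / ‖v‖ ^ 2) := by
      field_simp; rw [hse, mul_comm]
    have h3 : 6 * √ε ≤ inner ℝ (hess (reward σ θ) a v) v / ‖v‖ ^ 2 := by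
      rw [le_div_iff₀ (by positivity)]
      refine le_trans ?_ hv.le
      gcongr
      nlinarith
    have h4 : 0 ≤ √ε / ‖v‖ * inner ℝ g w := by positivity
    have h5 : ε * (6 * √ε) ≤ ε * (inner ℝ (hess (reward σ θ) a v) v / ‖v‖ ^ 2) := by gcongr
    rw [e1]
    have h6 : √ε ^ 3 = ε * √ε := by rw [pow_succ, hse]
    have h7 : ε ^ 2 ≤ ε * √ε := by nlinarith
    rw [h6]
    nlinarith
  · push Not at h1
    have hn : 0 < ‖g‖ := hε.trans h1
    have hsn : ‖(ε / 4 / ‖g‖) • g‖ = ε / 4 := by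
      rw [norm_smul, Real.norm_of_nonneg (by positivity)]; field_simp
    -- A gradient step of length ε/4 gains at least ε²/4 - ε²/16 - ε³/64; the second term comes from
    -- the bound 2 on the Hessian.
    refine ⟨(ε / 4 / ‖g‖) • g, by rw [hsn]; linarith, ?_⟩
    have h2 := (abs_le.1 (abs_inner_hess_reward_le hσ hθ a ((ε / 4 / ‖g‖) • g))).1
    rw [hsn] at h2 ⊢
    have h3 : inner ℝ g ((ε / 4 / ‖g‖) • g) = ε / 4 * ‖g‖ := by
      rw [real_inner_smul_right, real_inner_self_eq_norm_sq]; field_simp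
    rw [h3]
    nlinarith [mul_pos hε hε]

/-- Paired with `a`, the gradient is at most ‖a‖ - ‖a‖², since the network has directional
derivative at most ‖a‖. Approximate local maxima are therefore bounded and the comparator of the
local regret is a genuine infimum. -/
lemma norm_le_of_norm_gradient_le (hσ : IsSmoothActivation σ) {θ : Param m d}
    (hθ : θ ∈ Theta m d) {ε : ℝ} {a : Act d} (ha : ‖gradient (reward σ θ) a‖ ≤ ε) :
    ‖a‖ ≤ 1 + ε := by
  have h1 := inner_gradient_reward hσ θ a a
  rw [real_inner_self_eq_norm_sq] at h1
  have h2 := (abs_le.1 (abs_netGrad_le hσ hθ a a)).2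
  have h3 := (abs_le.1 (abs_real_inner_le_norm (gradient (reward σ θ) a) a)).1
  rcases eq_or_ne a 0 with rfl | h0
  · simpa using add_nonneg zero_le_one ((norm_nonneg _).trans ha)
  have hn : 0 < ‖a‖ := norm_pos_iff.2 h0
  have h4 : ‖gradient (reward σ θ) a‖ * ‖a‖ ≤ ε * ‖a‖ := by gcongr
  nlinarith

lemma bddBelow_image_approxLocalMax (hσ : IsSmoothActivation σ) {θ : Param m d}
    (hθ : θ ∈ Theta m d) (εg εh : ℝ) :
    BddBelow (reward σ θ '' {b | IsApproxLocalMax (reward σ θ) εg εh b}) := by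
  refine ⟨-1 - (1 + εg) ^ 2 / 2, ?_⟩
  rintro _ ⟨b, hb, rfl⟩
  have h1 := norm_le_of_norm_gradient_le hσ hθ hb.1
  have h2 := le_reward hσ hθ b
  have h3 : ‖b‖ ^ 2 ≤ (1 + εg) ^ 2 := by gcongr
  linarith

lemma reward_le_one (hσ : IsSmoothActivation σ) {θ : Param m d} (hθ : θ ∈ Theta m d) (a : Act d) :
    reward σ θ a ≤ 1 := by
  have := reward_le hσ hθ a
  nlinarith [sq_nonneg ‖a‖]

lemma sInf_image_approxLocalMax_le (hσ : IsSmoothActivation σ) {θ : Param m d}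
    (hθ : θ ∈ Theta m d) (εg εh : ℝ) :
    sInf (reward σ θ '' {b | IsApproxLocalMax (reward σ θ) εg εh b}) ≤ 1 := by
  rcases Set.eq_empty_or_nonempty (reward σ θ '' {b | IsApproxLocalMax (reward σ θ) εg εh b})
    with h | ⟨_, b, hb, rfl⟩
  -- Absence of approximate local maxima need not be excluded: the infimum of the empty set is zero.
  · rw [h, Real.sInf_empty]; exact zero_le_one
  · exact (csInf_le (bddBelow_image_approxLocalMax hσ hθ εg εh) ⟨b, hb, rfl⟩).trans
      (reward_le_one hσ hθ b)

/-- A continuous function that is dominated by a regularizer attains its maximum. -/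
lemma exists_argmax {f : Act d → ℝ} (hf : Continuous f) (h1 : ∀ b, f b ≤ 1 - ‖b‖ ^ 2 / 2)
    (h0 : -1 ≤ f 0) : ∃ b, ‖b‖ ≤ 2 ∧ ∀ b', f b' ≤ f b := by
  obtain ⟨b, hb, hmax⟩ := (isCompact_closedBall (0 : Act d) 2).exists_isMaxOn
    ⟨0, by simp⟩ hf.continuousOn
  refine ⟨b, by simpa using hb, fun b' => ?_⟩
  by_cases h : ‖b'‖ ≤ 2
  · exact hmax (by simpa using h)
  · push Not at h
    have h2 : f 0 ≤ f b := hmax (by simp)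
    have h3 := h1 b'
    nlinarith

/-- A step towards a maximizer of an input-concave reward. -/
lemma exists_step_of_concave (hσ : IsSmoothActivation σ) {θ : Param m d} (hθ : θ ∈ Theta m d)
    (hconc : ConcaveOn ℝ (Metric.closedBall 0 2) (net σ θ)) {a b : Act d} (ha : ‖a‖ ≤ 2)
    (hb : ‖b‖ ≤ 2) : ∃ s : Act d, ‖s‖ ≤ 1 ∧ 1 / 8 * (reward σ θ b - reward σ θ a)
      ≤ inner ℝ (gradient (reward σ θ) a) s
      + 1 / 2 * inner ℝ (hess (reward σ θ) a s) s - ‖s‖ ^ 3 := by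
  have hD : ‖b - a‖ ≤ 4 := (norm_sub_le b a).trans (by linarith)
  have hsn : ‖(1 / 8 : ℝ) • (b - a)‖ = 1 / 8 * ‖b - a‖ := by
    rw [norm_smul, Real.norm_of_nonneg (by norm_num)]
  -- The strong concavity of the regularizer adds 7/128·‖b - a‖² to the reward one eighth of the way
  -- to `b`. This pays for the Taylor remainder and the subtracted cube, together 2·‖b - a‖³/512 ≤
  -- ‖b - a‖²/64, as ‖b - a‖ ≤ 4.
  refine ⟨(1 / 8 : ℝ) • (b - a), by rw [hsn]; linarith, ?_⟩
  have h1 := (abs_le.1 (reward_taylor hσ hθ a ((1 / 8 : ℝ) • (b - a)))).2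
  have h2 := hconc.2 (show a ∈ Metric.closedBall 0 2 by simpa using ha)
    (show b ∈ Metric.closedBall 0 2 by simpa using hb) (show (0 : ℝ) ≤ 7 / 8 by norm_num)
    (show (0 : ℝ) ≤ 1 / 8 by norm_num) (by norm_num)
  have e1 : (7 / 8 : ℝ) • a + (1 / 8 : ℝ) • b = a + (1 / 8 : ℝ) • (b - a) := by
    module
  rw [e1] at h2
  have e2 : ‖a + (1 / 8 : ℝ) • (b - a)‖ ^ 2
      = 7 / 8 * ‖a‖ ^ 2 + 1 / 8 * ‖b‖ ^ 2 - 7 / 64 * ‖b - a‖ ^ 2 := by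
    have e3 := norm_sub_sq_real b a
    rw [norm_add_sq_real, hsn, real_inner_smul_right, inner_sub_right, real_inner_self_eq_norm_sq,
      real_inner_comm, mul_pow, e3]
    ring
  have h3 : 7 / 8 * reward σ θ a + 1 / 8 * reward σ θ b + 7 / 128 * ‖b - a‖ ^ 2
      ≤ reward σ θ (a + (1 / 8 : ℝ) • (b - a)) := by
    simp only [reward, e2]
    simp only [smul_eq_mul] at h2
    linarith
  rw [hsn] at h1 ⊢
  have h4 : ‖b - a‖ ^ 3 ≤ 4 * ‖b - a‖ ^ 2 := by
    rw [pow_succ]; nlinarith [sq_nonneg ‖b - a‖]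
  nlinarith [sq_nonneg ‖b - a‖]

/-! ### Summing the progress -/

/-- All inequalities are added; the two sums of gaps differ only in their end terms, and the last
gap is nonnegative. Each error thus counts at most 1/r times. -/
lemma sum_succ_le_of_contraction {b : Fin (T + 1) → ℝ} {E : Fin T → ℝ} {r : ℝ} (hr1 : r ≤ 1)
    (hr : 0 ≤ r) (hb : ∀ t, 0 ≤ b t) (h : ∀ t : Fin T, b t.succ ≤ (1 - r) * b t.castSucc + E t) :
    r * ∑ t : Fin T, b t.succ ≤ b 0 + ∑ t, E t := by
  have h1 := Finset.sum_le_sum fun t (_ : t ∈ Finset.univ) => h t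
  rw [Finset.sum_add_distrib, ← Finset.mul_sum] at h1
  have h2 : ∑ t : Fin T, b t.castSucc + b (Fin.last T) = b 0 + ∑ t : Fin T, b t.succ := by
    rw [← Fin.sum_univ_castSucc, Fin.sum_univ_succ]
  have h3 := hb (Fin.last T)
  have h4 : (1 - r) * ∑ t : Fin T, b t.castSucc ≤ (1 - r) * (b 0 + ∑ t : Fin T, b t.succ) := by
    have : 0 ≤ 1 - r := by linarith
    gcongr
    linarith
  have h5 : 0 ≤ r * b 0 := mul_nonneg hr (hb 0)
  nlinarith

section run

variable {ρ : ℝ} {R : Learner m d} {θs : Param m d} {a₀ : Act d}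
  {a : Fin (T + 1) → (Fin T → Noise d) → Act d}

/-- The bound on the loss of progress in one round. -/
noncomputable def roundErr (σ : ℝ → ℝ) (κ₁ κ₂ : ℝ) (R : Learner m d) (θs : Param m d)
    (a : Fin (T + 1) → (Fin T → Noise d) → Act d) (μ : ℝ) (t : Fin T) (ξ : Fin T → Noise d) : ℝ :=
  2 * (μ + runLoss σ κ₁ κ₂ R θs a t ξ / (gaussConst ^ 2 * μ))

lemma roundErr_nonneg {μ : ℝ} (hμ : 0 < μ) (κ₁ κ₂ : ℝ) (t : Fin T) (ξ : Fin T → Noise d) :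
    0 ≤ roundErr σ κ₁ κ₂ R θs a μ t ξ := by
  have := runLoss_nonneg (σ := σ) (R := R) (θs := θs) (a := a) κ₁ κ₂ t ξ
  have := gaussConst_pos
  unfold roundErr; positivity

lemma IsRun.progress (hσ : IsSmoothActivation σ) (h : IsRun σ R θs a₀ a) (hρ : 2 ≤ ρ)
    (hθs : θs ∈ Theta m d) (ha₀ : ‖a₀‖ ≤ ρ) {κ₁ κ₂ : ℝ} (hκ₁ : 2 ≤ κ₁) (hκ₂ : 2 ≤ κ₂) {μ : ℝ}
    (hμ : 0 < μ) (t : Fin T) (ξ : Fin T → Noise d) (s : Act d) (hs : ‖s‖ ≤ 1) :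
    reward σ θs (a t.castSucc ξ) + (inner ℝ (gradient (reward σ θs) (a t.castSucc ξ)) s
      + 1 / 2 * inner ℝ (hess (reward σ θs) (a t.castSucc ξ) s) s - ‖s‖ ^ 3)
      - roundErr σ κ₁ κ₂ R θs a μ t ξ ≤ reward σ θs (a t.succ ξ) := by
  have := (R.isMarkov t).isProbabilityMeasure (history (runPair a) (runLabel σ θs a) ξ t)
  have h1 := reward_progress hσ hκ₁ hκ₂ hθs
    (R.dist t (history (runPair a) (runLabel σ θs a) ξ t)) (h.norm_le hσ hρ ha₀ t.succ ξ)
    (h.norm_le hσ hρ ha₀ t.castSucc ξ) (h.argmax t ξ) hμ s hs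
  simp only [roundErr, runLoss, runPair] at h1 ⊢
  linarith

/-- Turns a pathwise bound by the round errors into one in expectation, for both notions of regret.
The guarantee of the learner enters only here, through `IsRun.sum_runLoss_le`. -/
lemma IsRun.integral_le (hσ : IsSmoothActivation σ) (h : IsRun σ R θs a₀ a) (hρ : 2 ≤ ρ)
    (hθs : θs ∈ Theta m d) (ha₀ : ‖a₀‖ ≤ ρ) {κ₁ κ₂ : ℝ} (hR : HasGuarantee T ρ σ κ₁ κ₂ R)
    {μ : ℝ} (hμ : 0 < μ) {G : (Fin T → Noise d) → ℝ} (hG : Integrable G (noiseLaw d T)) {r A : ℝ}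
    (hr : 0 ≤ r) (hle : ∀ ξ, G ξ ≤ r * (A + ∑ t, roundErr σ κ₁ κ₂ R θs a μ t ξ)) :
    ∫ ξ, G ξ ∂noiseLaw d T ≤ r * (A + 2 * (T * μ
      + (2 * seqRademacher m d T ρ σ κ₁ κ₂ + 1) / (gaussConst ^ 2 * μ))) := by
  have hc := gaussConst_pos
  have hI := fun t => h.integral_runLoss hσ hρ hθs ha₀ κ₁ κ₂ t
  have hE : ∀ t, Integrable (roundErr σ κ₁ κ₂ R θs a μ t) (noiseLaw d T) := fun t =>
    ((integrable_const _).add ((hI t).1.div_const _)).const_mul _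
  have hS : Integrable (fun ξ => ∑ t, roundErr σ κ₁ κ₂ R θs a μ t ξ) (noiseLaw d T) :=
    integrable_finsetSum _ fun t _ => hE t
  have hAS : Integrable (fun ξ => A + ∑ t, roundErr σ κ₁ κ₂ R θs a μ t ξ) (noiseLaw d T) :=
    (integrable_const A).add hS
  refine (integral_mono hG (hAS.const_mul r) hle).trans ?_
  have hEv : ∀ t, ∫ ξ, roundErr σ κ₁ κ₂ R θs a μ t ξ ∂noiseLaw d T
      = 2 * (μ + (∫ ξ, runLoss σ κ₁ κ₂ R θs a t ξ ∂noiseLaw d T) / (gaussConst ^ 2 * μ)) := by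
    intro t
    simp only [roundErr]
    rw [integral_const_mul, integral_add (integrable_const _) ((hI t).1.div_const _),
      integral_div]
    simp
  have e : ∫ ξ, r * (A + ∑ t, roundErr σ κ₁ κ₂ R θs a μ t ξ) ∂noiseLaw d T
      = r * (A + 2 * (T * μ + (∑ t, ∫ ξ, runLoss σ κ₁ κ₂ R θs a t ξ ∂noiseLaw d T)
        / (gaussConst ^ 2 * μ))) := by
    rw [integral_const_mul, integral_add (integrable_const _) hS,
      integral_finsetSum _ fun t _ => hE t]
    simp only [hEv, ← Finset.mul_sum, Finset.sum_add_distrib, ← Finset.sum_div]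
    simp
  rw [e]
  have := h.sum_runLoss_le hσ hρ hθs ha₀ hR
  gcongr

lemma IsRun.integrable_reward_comp (hσ : IsSmoothActivation σ) (h : IsRun σ R θs a₀ a)
    (hθs : θs ∈ Theta m d) (t : Fin T) :
    Integrable (fun ξ => reward σ θs (a t.succ ξ)) (noiseLaw d T) :=
  integrable_of_bounded ((continuous_reward hσ).measurable.comp
    (measurable_const.prodMk (h.measurable t.succ))) (C := 1 + 2 ^ 2 / 2) fun ξ =>
    abs_reward_le hσ hθs (h.norm_succ_le hσ t ξ)

lemma IsRun.le_reward (hσ : IsSmoothActivation σ) (h : IsRun σ R θs a₀ a) (hρ : 2 ≤ ρ)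
    (hθs : θs ∈ Theta m d) (ha₀ : ‖a₀‖ ≤ ρ) (t : Fin (T + 1)) (ξ : Fin T → Noise d) :
    -(1 + ρ ^ 2 / 2) ≤ reward σ θs (a t ξ) :=
  (abs_le.1 (abs_reward_le hσ hθs (h.norm_le hσ hρ ha₀ t ξ))).1

/-- The local regret is controlled by the sum of the round errors. -/
lemma IsRun.localRegret_le (hσ : IsSmoothActivation σ) (h : IsRun σ R θs a₀ a) (hρ : 2 ≤ ρ)
    (hθs : θs ∈ Theta m d) (ha₀ : ‖a₀‖ ≤ ρ) {κ₁ κ₂ : ℝ} (hκ₁ : 2 ≤ κ₁) (hκ₂ : 2 ≤ κ₂) {μ : ℝ}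
    (hμ : 0 < μ) {ε ζ : ℝ} (hε : 0 < ε) (hε1 : ε ≤ 1) (hζ : 1 ≤ ζ) (ξ : Fin T → Noise d) :
    localRegret (reward σ θs) ε (6 * √(ζ * ε)) a ξ ≤ 8 * (2 + ρ ^ 2 / 2) * ε⁻¹ ^ 2 *
      ((2 + ρ ^ 2 / 2) + ∑ t, roundErr σ κ₁ κ₂ R θs a μ t ξ) := by
  set v := sInf (reward σ θs '' {b | IsApproxLocalMax (reward σ θs) ε (6 * √(ζ * ε)) b}) with hv
  set C := 2 + ρ ^ 2 / 2 with hC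
  have hC0 : 4 ≤ C := by nlinarith
  have hv1 : v ≤ 1 := sInf_image_approxLocalMax_le hσ hθs _ _
  -- The positive part is taken because an action may beat the worst approximate local maximum, in
  -- which case no gain can be promised.
  let b : Fin (T + 1) → ℝ := fun t => max 0 (v - reward σ θs (a t ξ))
  have hb0 : ∀ t, 0 ≤ b t := fun t => le_max_left _ _
  have hbC : ∀ t, b t ≤ C := fun t => by
    have := h.le_reward hσ hρ hθs ha₀ t ξ
    exact max_le (by linarith) (by linarith)
  have hr : ε ^ 2 / (8 * C) ≤ 1 := by
    rw [div_le_one (by linarith)]; nlinarith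
  have hstep : ∀ t : Fin T, b t.succ ≤ (1 - ε ^ 2 / (8 * C)) * b t.castSucc
      + roundErr σ κ₁ κ₂ R θs a μ t ξ := by
    intro t
    have hE := roundErr_nonneg (σ := σ) (R := R) (θs := θs) (a := a) hμ κ₁ κ₂ t ξ
    have hp := h.progress hσ hρ hθs ha₀ hκ₁ hκ₂ hμ t ξ
    refine max_le (add_nonneg (mul_nonneg (by linarith) (hb0 _)) hE) ?_
    by_cases hpos : v ≤ reward σ θs (a t.castSucc ξ)
    -- The zero step: an action at least as good as the comparator is followed by one that is worse
    -- by at most the round error.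
    · have h0 := hp 0 (by simp)
      simp only [inner_zero_right, norm_zero] at h0
      have hb : b t.castSucc = 0 := max_eq_left (by linarith)
      rw [hb]; linarith
    · push Not at hpos
      have hnot : ¬ IsApproxLocalMax (reward σ θs) ε (6 * √(ζ * ε)) (a t.castSucc ξ) :=
        fun hA => absurd (csInf_le (bddBelow_image_approxLocalMax hσ hθs _ _) ⟨_, hA, rfl⟩)
          (not_le.2 hpos)
      obtain ⟨s, hs1, hs2⟩ := exists_step hσ hθs hε hε1 hζ hnot
      have h1 := hp s hs1
      have hb : b t.castSucc = v - reward σ θs (a t.castSucc ξ) := max_eq_right (by linarith)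
      -- As the gap never exceeds `C`, the constant gain ε²/8 is at least the fraction ε²/(8C) of
      -- it, which puts the recursion into contractive form.
      have h2 : ε ^ 2 / (8 * C) * b t.castSucc ≤ ε ^ 2 / 8 := by
        calc ε ^ 2 / (8 * C) * b t.castSucc ≤ ε ^ 2 / (8 * C) * C := by
              have := hbC t.castSucc
              gcongr
          _ = ε ^ 2 / 8 := by field_simp
      rw [sub_mul, one_mul]
      linarith
  have hsum := sum_succ_le_of_contraction hr (by positivity) hb0 hstep
  have h1 : localRegret (reward σ θs) ε (6 * √(ζ * ε)) a ξ ≤ ∑ t : Fin T, b t.succ :=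
    Finset.sum_le_sum fun t _ => le_max_right _ _
  have h2 : ∑ t : Fin T, b t.succ
      = 8 * C * ε⁻¹ ^ 2 * (ε ^ 2 / (8 * C) * ∑ t : Fin T, b t.succ) := by
    field_simp
  refine h1.trans ?_
  rw [h2]
  have := hbC 0
  gcongr
  linarith

/-- The global regret is controlled by the sum of the round errors if the network is
input-concave. -/
lemma IsRun.globalRegret_le (hσ : IsSmoothActivation σ) (h : IsRun σ R θs a₀ a) (hρ : 2 ≤ ρ)
    (hθs : θs ∈ Theta m d) (ha₀ : ‖a₀‖ ≤ ρ) {κ₁ κ₂ : ℝ} (hκ₁ : 2 ≤ κ₁) (hκ₂ : 2 ≤ κ₂) {μ : ℝ}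
    (hμ : 0 < μ) (hconc : ConcaveOn ℝ (Metric.closedBall 0 2) (net σ θs))
    (ξ : Fin T → Noise d) :
    globalRegret (reward σ θs) a ξ ≤ 8 *
      (2 * (2 + ρ ^ 2 / 2) + ∑ t, roundErr σ κ₁ κ₂ R θs a μ t ξ) := by
  obtain ⟨bs, hbs, hmax⟩ := exists_argmax (f := reward σ θs)
    ((continuous_reward hσ).comp (by fun_prop : Continuous fun b : Act d => (θs, b)))
    (reward_le hσ hθs) (by simpa using ViOlin.le_reward hσ hθs (0 : Act d))
  have hsup : ⨆ b, reward σ θs b = reward σ θs bs :=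
    le_antisymm (ciSup_le hmax) (le_ciSup ⟨_, Set.forall_mem_range.2 hmax⟩ bs)
  set C := 2 + ρ ^ 2 / 2 with hC
  let b : Fin (T + 1) → ℝ := fun t => reward σ θs bs - reward σ θs (a t ξ)
  have hb0 : ∀ t, 0 ≤ b t := fun t => sub_nonneg.2 (hmax _)
  have hbC : b 0 ≤ C := by
    have h1 := h.le_reward hσ hρ hθs ha₀ 0 ξ
    have h2 := reward_le_one hσ hθs bs
    simp only [b]; linarith
  have hp := fun t => h.progress hσ hρ hθs ha₀ hκ₁ hκ₂ hμ t ξ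
  cases T with
  | zero =>
    simp only [globalRegret, Finset.univ_eq_empty, Finset.sum_empty, add_zero]
    positivity
  | succ T =>
    -- The initial action may lie outside the ball of radius 2 where concavity is assumed. The first
    -- round uses only the zero step, and the missing contraction is charged as an additional error
    -- `b 0`.
    let E : Fin (T + 1) → ℝ := fun t => roundErr σ κ₁ κ₂ R θs a μ t ξ + if t = 0 then b 0 else 0
    have hstep : ∀ t : Fin (T + 1), b t.succ ≤ (1 - 1 / 8) * b t.castSucc + E t := by
      intro t
      induction t using Fin.cases with
      | zero =>
        have h0 := hp 0 0 (by simp)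
        simp only [inner_zero_right, norm_zero] at h0
        have h1 := hb0 0
        simp only [b, E, if_true, Fin.castSucc_zero] at h0 h1 ⊢
        linarith
      | succ t =>
        have hn : ‖a t.succ.castSucc ξ‖ ≤ 2 := by
          rw [← Fin.succ_castSucc]; exact h.norm_succ_le hσ _ ξ
        obtain ⟨s, hs1, hs2⟩ := exists_step_of_concave hσ hθs hconc hn hbs
        have h1 := hp t.succ s hs1
        simp only [b, E, Fin.succ_ne_zero, if_false]
        linarith
    have hsum := sum_succ_le_of_contraction (by norm_num) (by norm_num) hb0 hstep
    simp only [E, Finset.sum_add_distrib, Finset.sum_ite_eq', Finset.mem_univ, if_true] at hsum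
    have h1 : globalRegret (reward σ θs) a ξ = ∑ t : Fin (T + 1), b t.succ := by
      simp only [globalRegret, hsup, b]
    rw [h1]
    linarith

lemma IsRun.integrable_localRegret (hσ : IsSmoothActivation σ) (h : IsRun σ R θs a₀ a)
    (hθs : θs ∈ Theta m d) (εg εh : ℝ) :
    Integrable (localRegret (reward σ θs) εg εh a) (noiseLaw d T) :=
  integrable_finsetSum _ fun t _ =>
    (integrable_const _).sub (h.integrable_reward_comp hσ hθs t)

lemma IsRun.integrable_globalRegret (hσ : IsSmoothActivation σ) (h : IsRun σ R θs a₀ a)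
    (hθs : θs ∈ Theta m d) : Integrable (globalRegret (reward σ θs) a) (noiseLaw d T) :=
  integrable_finsetSum _ fun t _ =>
    (integrable_const _).sub (h.integrable_reward_comp hσ hθs t)

end run

/-! ### The regret bounds -/

/-- The choice μ = T^(-1/4) balances Tμ against √T/μ. -/
lemma mul_rpow_facts (hT : 1 ≤ T) : (T : ℝ) * (T : ℝ) ^ (-(1 / 4) : ℝ) = (T : ℝ) ^ (3 / 4 : ℝ) ∧
    √T / (T : ℝ) ^ (-(1 / 4) : ℝ) = (T : ℝ) ^ (3 / 4 : ℝ) ∧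
    1 / (T : ℝ) ^ (-(1 / 4) : ℝ) ≤ (T : ℝ) ^ (3 / 4 : ℝ) ∧ 1 ≤ (T : ℝ) ^ (3 / 4 : ℝ) := by
  have h1 : (1 : ℝ) ≤ T := by exact_mod_cast hT
  have h0 : (0 : ℝ) < T := by linarith
  refine ⟨?_, ?_, ?_, Real.one_le_rpow h1 (by norm_num)⟩
  · nth_rewrite 1 [← Real.rpow_one (T : ℝ)]
    rw [← Real.rpow_add h0]; norm_num
  · rw [Real.sqrt_eq_rpow, ← Real.rpow_sub h0]; norm_num
  · rw [one_div, ← Real.rpow_neg h0.le]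
    exact Real.rpow_le_rpow_of_exponent_le h1 (by norm_num)

lemma one_le_log_two (hd : 1 ≤ d) (hT : 1 ≤ T) : 1 ≤ Real.log (d * T + 2) := by
  rw [Real.le_log_iff_exp_le (by positivity)]
  have h1 : (1 : ℝ) ≤ d := by exact_mod_cast hd
  have h2 : (1 : ℝ) ≤ T := by exact_mod_cast hT
  have := Real.exp_one_lt_d9
  nlinarith

/-- Dimension zero is separate: `exists_seqRademacher_le` and `one_le_log_two` need `1 ≤ d`, but
there the action space is a single point. -/
lemma localRegret_eq_zero {θ : Param m 0} {ε ε' : ℝ} (hε : 0 ≤ ε)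
    (a : Fin (T + 1) → (Fin T → Noise 0) → Act 0) (ξ : Fin T → Noise 0) :
    localRegret (reward σ θ) ε ε' a ξ = 0 := by
  refine Finset.sum_eq_zero fun t _ => ?_
  have e : {b | IsApproxLocalMax (reward σ θ) ε ε' b} = {a t.succ ξ} := by
    ext b
    simp only [Set.mem_ofPred_eq, Set.mem_singleton_iff]
    refine ⟨fun _ => Subsingleton.elim _ _, fun _ => ⟨?_, fun v => ?_⟩⟩
    · rw [Subsingleton.elim (gradient (reward σ θ) b) 0, norm_zero]; exact hε
    · rw [Subsingleton.elim v 0, inner_zero_right, norm_zero]; simp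
  rw [e, Set.image_singleton, csInf_singleton, sub_self]

lemma globalRegret_eq_zero (f : Act 0 → ℝ)
    (a : Fin (T + 1) → (Fin T → Noise 0) → Act 0) (ξ : Fin T → Noise 0) :
    globalRegret f a ξ = 0 := by
  refine Finset.sum_eq_zero fun t _ => ?_
  have : ∀ b, f b = f (a t.succ ξ) := fun b => by rw [Subsingleton.elim b]
  simp only [this, ciSup_const, sub_self]

/-- The regret of every run with a good learner. -/
lemma exists_regret_le {ρ κ₁ κ₂ : ℝ} (hρ : 2 ≤ ρ) (hκ₁ : 2 ≤ κ₁) (hκ₂ : 2 ≤ κ₂) :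
    ∃ K : ℝ, 0 < K ∧ ∀ (m d T : ℕ) (σ : ℝ → ℝ), IsSmoothActivation σ → ∀ R : Learner m d,
      HasGuarantee T ρ σ κ₁ κ₂ R → ∀ θs ∈ Theta m d, ∀ a₀ : Act d, ‖a₀‖ ≤ ρ →
      ∀ a : Fin (T + 1) → (Fin T → Noise d) → Act d, IsRun σ R θs a₀ a →
        (∀ ε ζ : ℝ, 0 < ε → ε ≤ 1 → 1 ≤ ζ →
          ∫ ξ, localRegret (reward σ θs) ε (6 * √(ζ * ε)) a ξ ∂noiseLaw d T
            ≤ K * Real.log (d * T + 2) ^ 16 * ε⁻¹ ^ 2 * (T : ℝ) ^ (3 / 4 : ℝ)) ∧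
        (ConcaveOn ℝ (Metric.closedBall 0 2) (net σ θs) →
          ∫ ξ, globalRegret (reward σ θs) a ξ ∂noiseLaw d T
            ≤ K * Real.log (d * T + 2) ^ 16 * (T : ℝ) ^ (3 / 4 : ℝ)) := by
  obtain ⟨C, hC, hrad⟩ := exists_seqRademacher_le (ρ := ρ) (κ₁ := κ₁) (κ₂ := κ₂)
    (by linarith) (by linarith) (by linarith)
  have hc := gaussConst_pos
  set B := 2 + ρ ^ 2 / 2 with hB
  have hB4 : 4 ≤ B := by nlinarith
  set M := 2 * B + 2 * (1 + (2 * C + 1) / gaussConst ^ 2) with hM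
  have hM0 : 0 < M := by positivity
  refine ⟨8 * B * M, by positivity, fun m d T σ hσ R hR θs hθs a₀ ha₀ a h => ?_⟩
  have hlog0 : 0 ≤ Real.log ((d : ℝ) * T + 2) := Real.log_nonneg (by
    have : (0 : ℝ) ≤ (d : ℝ) * T := by positivity
    linarith)
  rcases Nat.eq_zero_or_pos d with rfl | hd
  · refine ⟨fun ε ζ hε _ _ => ?_, fun _ => ?_⟩
    · simp only [localRegret_eq_zero hε.le,
        integral_zero]
      positivity
    · simp only [globalRegret_eq_zero, integral_zero]
      positivity
  rcases Nat.eq_zero_or_pos T with rfl | hT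
  · simp only [localRegret, globalRegret, Finset.univ_eq_empty, Finset.sum_empty, integral_zero]
    exact ⟨fun ε ζ hε _ _ => by positivity, fun _ => by positivity⟩
  set Λ := Real.log ((d : ℝ) * T + 2) with hΛ
  have hΛ1 : 1 ≤ Λ ^ 16 := one_le_pow₀ (one_le_log_two hd hT)
  obtain ⟨f1, f2, f3, f4⟩ := mul_rpow_facts hT
  set μ := (T : ℝ) ^ (-(1 / 4) : ℝ) with hμ
  set τ := (T : ℝ) ^ (3 / 4 : ℝ) with hτ
  have hT0 : (0 : ℝ) < T := by exact_mod_cast hT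
  have hμ0 : 0 < μ := Real.rpow_pos_of_pos hT0 _
  have hr := hrad m d T σ hσ hd hT
  have hτ0 : 0 < τ := by linarith
  have hΛτ : τ ≤ Λ ^ 16 * τ := le_mul_of_one_le_left hτ0.le hΛ1
  have key : ∀ A ≤ 2 * B, A + 2 * (T * μ + (2 * seqRademacher m d T ρ σ κ₁ κ₂ + 1)
      / (gaussConst ^ 2 * μ)) ≤ M * (Λ ^ 16 * τ) := by
    intro A hA
    have g1 : (2 * seqRademacher m d T ρ σ κ₁ κ₂ + 1) / (gaussConst ^ 2 * μ)
        ≤ (2 * (C * Λ ^ 16 * √T) + 1) / (gaussConst ^ 2 * μ) := by gcongr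
    have g2 : (2 * (C * Λ ^ 16 * √T) + 1) / (gaussConst ^ 2 * μ)
        = (2 * C * Λ ^ 16 * (√T / μ) + 1 / μ) / gaussConst ^ 2 := by field_simp
    have g3 : (2 * C * Λ ^ 16 * (√T / μ) + 1 / μ) / gaussConst ^ 2
        ≤ (2 * C + 1) / gaussConst ^ 2 * (Λ ^ 16 * τ) := by
      rw [f2, div_mul_eq_mul_div]
      gcongr
      linarith
    have g4 : 2 * B ≤ 2 * B * (Λ ^ 16 * τ) :=
      le_mul_of_one_le_right (by linarith) (f4.trans hΛτ)
    rw [f1]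
    have e : M * (Λ ^ 16 * τ) = 2 * B * (Λ ^ 16 * τ) + 2 * (Λ ^ 16 * τ
      + (2 * C + 1) / gaussConst ^ 2 * (Λ ^ 16 * τ)) := by rw [hM]; ring
    linarith
  refine ⟨fun ε ζ hε hε1 hζ => ?_, fun hconc => ?_⟩
  · have h1 := h.integral_le hσ hρ hθs ha₀ hR hμ0 (h.integrable_localRegret hσ hθs ε (6 * √(ζ * ε)))
      (r := 8 * B * ε⁻¹ ^ 2) (by positivity)
      (h.localRegret_le hσ hρ hθs ha₀ hκ₁ hκ₂ hμ0 hε hε1 hζ)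
    refine h1.trans ?_
    calc _ ≤ 8 * B * ε⁻¹ ^ 2 * (M * (Λ ^ 16 * τ)) := by
          gcongr
          exact key B (by linarith)
      _ = _ := by ring
  · have h1 := h.integral_le hσ hρ hθs ha₀ hR hμ0 (h.integrable_globalRegret hσ hθs)
      (r := 8) (by norm_num) (h.globalRegret_le hσ hρ hθs ha₀ hκ₁ hκ₂ hμ0 hconc)
    refine h1.trans ?_
    have h2 := key (2 * B) le_rfl
    have h3 : 0 ≤ M * (Λ ^ 16 * τ) := by positivity
    calc _ ≤ 8 * (M * (Λ ^ 16 * τ)) := by gcongr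
      _ ≤ B * (8 * (M * (Λ ^ 16 * τ))) := le_mul_of_one_le_left (by positivity) (by linarith)
      _ = _ := by ring

end ViOlin

/-! ### Existence of a good learner by a minimax argument -/

namespace ViOlin

/-! ### Potentials of repeated games -/

section game

variable {Ω ι : Type*} [MeasurableSpace Ω]

/-- A potential: a convex and antitone function of the vector of cumulative losses that decreases at
unit rate if all losses grow at unit rate. -/
structure IsPotential (Φ : (ι → ℝ) → ℝ) : Prop where
  convex : ConvexOn ℝ Set.univ Φ
  anti : Antitone Φ
  shift : ∀ L c, Φ (fun i => L i + c) = Φ L - c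

/-- Monotonicity and the shift rule give a one-sided Lipschitz bound in the supremum norm; every
rounding to the grid is paid for by it. -/
lemma IsPotential.le_add {Φ : (ι → ℝ) → ℝ} (h : IsPotential Φ) {L L' : ι → ℝ} {c : ℝ}
    (hc : ∀ i, L' i - c ≤ L i) : Φ L ≤ Φ L' + c := by
  have h1 := h.shift L' (-c)
  rw [sub_neg_eq_add] at h1
  rw [← h1]
  exact h.anti fun i => by have := hc i; simpa [sub_eq_add_neg] using this

/-- The potential at the end of the game: the negative loss of the best comparator. -/
noncomputable def endPotential (L : ι → ℝ) : ℝ := ⨆ i, -L i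

/-- A class of moves: bounded random loss vectors. -/
structure IsMoveClass (𝒢 : Set (Ω → ι → ℝ)) (B : ℝ) : Prop where
  nonempty : 𝒢.Nonempty
  measurable : ∀ g ∈ 𝒢, Measurable g
  bound : ∀ g ∈ 𝒢, ∀ ω i, |g ω i| ≤ B

variable (ν : Measure Ω)

/-- The symmetrized value of a move. -/
noncomputable def symValue (Φ : (ι → ℝ) → ℝ) (g : Ω → ι → ℝ) (L : ι → ℝ) : ℝ :=
  ∫ ω, 1 / 2 * (Φ (fun i => L i + 2 * g ω i) + Φ (fun i => L i - 2 * g ω i)) ∂ν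

/-- The potential one round earlier. -/
noncomputable def gameStep (𝒢 : Set (Ω → ι → ℝ)) (Φ : (ι → ℝ) → ℝ) (L : ι → ℝ) : ℝ :=
  ⨆ g : 𝒢, symValue ν Φ g L

/-- The potential if `n` rounds are left. -/
noncomputable def potential (𝒢 : Set (Ω → ι → ℝ)) : ℕ → (ι → ℝ) → ℝ
  | 0 => endPotential
  | n + 1 => gameStep ν 𝒢 (potential 𝒢 n)

variable {ν} {𝒢 : Set (Ω → ι → ℝ)} {B : ℝ} {Φ : (ι → ℝ) → ℝ}

lemma exists_symValue_ge (h𝒢 : IsMoveClass 𝒢 B) (L : ι → ℝ) {δ : ℝ}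
    (hδ : 0 < δ) : ∃ g ∈ 𝒢, gameStep ν 𝒢 Φ L - δ ≤ symValue ν Φ g L := by
  have := h𝒢.nonempty.to_subtype
  obtain ⟨⟨g, hg⟩, hlt⟩ := exists_lt_of_lt_ciSup (f := fun g : 𝒢 => symValue ν Φ g L)
    (show gameStep ν 𝒢 Φ L - δ < _ from sub_lt_self _ hδ)
  exact ⟨g, hg, hlt.le⟩

lemma integrable_move_apply [IsFiniteMeasure ν] (h𝒢 : IsMoveClass 𝒢 B) {g : Ω → ι → ℝ} (hg : g ∈ 𝒢) (i : ι) :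
    Integrable (fun ω => g ω i) ν :=
  integrable_of_bounded ((measurable_pi_apply i).comp (h𝒢.measurable g hg))
    fun ω => h𝒢.bound g hg ω i

lemma IsPotential.abs_sub_le (h : IsPotential Φ) {L L' : ι → ℝ} {c : ℝ}
    (hc : ∀ i, |L i - L' i| ≤ c) : |Φ L - Φ L'| ≤ c := by
  have h1 := h.le_add (L := L) (L' := L') (c := c) fun i => by linarith [(abs_le.1 (hc i)).1]
  have h2 := h.le_add (L := L') (L' := L) (c := c) fun i => by linarith [(abs_le.1 (hc i)).2]
  exact abs_le.2 ⟨by linarith, by linarith⟩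

lemma IsPotential.lipschitz [Fintype ι] (h : IsPotential Φ) : LipschitzWith 1 Φ := by
  refine LipschitzWith.of_le_add fun L L' => h.le_add fun i => ?_
  have := (abs_le.1 (Real.dist_eq (L i) (L' i) ▸ dist_le_pi_dist L L' i)).1
  linarith

lemma IsPotential.continuous [Fintype ι] (h : IsPotential Φ) : Continuous Φ :=
  h.lipschitz.continuous

variable [Fintype ι] [IsProbabilityMeasure ν]

lemma IsPotential.integrable (h : IsPotential Φ) (h𝒢 : IsMoveClass 𝒢 B) {g : Ω → ι → ℝ}
    (hg : g ∈ 𝒢) (L : ι → ℝ) (c : ℝ) :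
    Integrable (fun ω => Φ (fun i => L i + c * g ω i)) ν := by
  have hm := h𝒢.measurable g hg
  refine integrable_of_bounded (C := |Φ L| + |c| * B) (h.continuous.measurable.comp
    (by fun_prop)) fun ω => ?_
  have h1 := h.abs_sub_le (L := fun i => L i + c * g ω i) (L' := L) (c := |c| * B) fun i => by
    simp only [add_sub_cancel_left, abs_mul]
    exact mul_le_mul_of_nonneg_left (h𝒢.bound g hg ω i) (abs_nonneg c)
  have h2 := abs_sub_abs_le_abs_sub (Φ fun i => L i + c * g ω i) (Φ L)
  linarith

lemma IsPotential.integrable_sub (h : IsPotential Φ) (h𝒢 : IsMoveClass 𝒢 B) {g : Ω → ι → ℝ}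
    (hg : g ∈ 𝒢) (L : ι → ℝ) (c : ℝ) :
    Integrable (fun ω => Φ (fun i => L i - c * g ω i)) ν := by
  have := h.integrable (ν := ν) h𝒢 hg L (-c)
  simpa [sub_eq_add_neg] using this

lemma IsPotential.integrable_sym (h : IsPotential Φ) (h𝒢 : IsMoveClass 𝒢 B) {g : Ω → ι → ℝ}
    (hg : g ∈ 𝒢) (L : ι → ℝ) :
    Integrable (fun ω => 1 / 2 * (Φ (fun i => L i + 2 * g ω i) + Φ (fun i => L i - 2 * g ω i)))
      ν := by
  have h1 := h.integrable (ν := ν) h𝒢 hg L 2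
  have h2 := h.integrable_sub (ν := ν) h𝒢 hg L 2
  exact (h1.add h2).const_mul _

lemma bddAbove_symValue (h : IsPotential Φ) (h𝒢 : IsMoveClass 𝒢 B) (L : ι → ℝ) :
    BddAbove (Set.range fun g : 𝒢 => symValue ν Φ g L) := by
  refine ⟨Φ L + 2 * B, ?_⟩
  rintro _ ⟨⟨g, hg⟩, rfl⟩
  have := integral_mono (h.integrable_sym (ν := ν) h𝒢 hg L) (integrable_const (Φ L + 2 * B))
    fun ω => by
      have hb := fun i => abs_le.1 (h𝒢.bound g hg ω i)
      have h1 := h.le_add (L := fun i => L i + 2 * g ω i) (L' := L) (c := 2 * B) fun i => by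
        linarith [(hb i).1]
      have h2 := h.le_add (L := fun i => L i - 2 * g ω i) (L' := L) (c := 2 * B) fun i => by
        linarith [(hb i).2]
      show _ ≤ Φ L + 2 * B
      linarith
  simpa [symValue] using this

lemma symValue_le_gameStep (h : IsPotential Φ) (h𝒢 : IsMoveClass 𝒢 B) {g : Ω → ι → ℝ}
    (hg : g ∈ 𝒢) (L : ι → ℝ) : symValue ν Φ g L ≤ gameStep ν 𝒢 Φ L :=
  le_ciSup (f := fun g : 𝒢 => symValue ν Φ g L) (bddAbove_symValue h h𝒢 L) ⟨g, hg⟩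

/-- The three properties hold for each fixed move and noise, and survive averages and suprema;
boundedness of the moves keeps the supremum finite. -/
lemma isPotential_gameStep (h : IsPotential Φ) (h𝒢 : IsMoveClass 𝒢 B) :
    IsPotential (gameStep ν 𝒢 Φ) where
  convex := by
    have := h𝒢.nonempty.to_subtype
    refine ⟨convex_univ, fun x _ y _ a b ha hb hab => ciSup_le ?_⟩
    rintro ⟨g, hg⟩
    have h1 := mul_le_mul_of_nonneg_left (symValue_le_gameStep (ν := ν) h h𝒢 hg x) ha
    have h2 := mul_le_mul_of_nonneg_left (symValue_le_gameStep (ν := ν) h h𝒢 hg y) hb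
    have i1 := h.integrable_sym (ν := ν) h𝒢 hg x
    have i2 := h.integrable_sym (ν := ν) h𝒢 hg y
    have h3 : symValue ν Φ g (a • x + b • y) ≤ a * symValue ν Φ g x + b * symValue ν Φ g y := by
      unfold symValue
      rw [← integral_const_mul, ← integral_const_mul, ← integral_add (i1.const_mul a)
        (i2.const_mul b)]
      refine integral_mono (h.integrable_sym h𝒢 hg _) ((i1.const_mul a).add (i2.const_mul b))
        fun ω => ?_
      have k : ∀ c : ℝ, Φ (fun i => (a • x + b • y) i + c * g ω i)
          ≤ a * Φ (fun i => x i + c * g ω i) + b * Φ (fun i => y i + c * g ω i) := by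
        intro c
        refine le_trans (le_of_eq (congrArg Φ ?_)) (h.convex.2 (Set.mem_univ _) (Set.mem_univ _)
          ha hb hab)
        ext i
        simp only [Pi.add_apply, Pi.smul_apply, smul_eq_mul]
        linear_combination -(c * g ω i) * hab
      have k1 := k 2
      have k2 := k (-2)
      simp only [neg_mul, ← sub_eq_add_neg] at k2
      simp only [Pi.add_apply] at k1 k2 ⊢
      linarith
    simp only [smul_eq_mul]
    linarith
  anti := fun L L' hL => by
    refine ciSup_mono (bddAbove_symValue h h𝒢 L) ?_
    rintro ⟨g, hg⟩
    refine integral_mono (h.integrable_sym h𝒢 hg _) (h.integrable_sym h𝒢 hg _) fun ω => ?_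
    have h1 := h.anti (show (fun i => L i + 2 * g ω i) ≤ fun i => L' i + 2 * g ω i from
      fun i => by simpa using hL i)
    have h2 := h.anti (show (fun i => L i - 2 * g ω i) ≤ fun i => L' i - 2 * g ω i from
      fun i => by simpa using hL i)
    simp only
    linarith
  shift := by
    have := h𝒢.nonempty.to_subtype
    have key : ∀ (L : ι → ℝ) c, gameStep ν 𝒢 Φ (fun i => L i + c) ≤ gameStep ν 𝒢 Φ L - c := by
      refine fun L c => ciSup_le ?_
      rintro ⟨g, hg⟩
      have h1 := symValue_le_gameStep (ν := ν) h h𝒢 hg L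
      have h2 : symValue ν Φ g (fun i => L i + c) = symValue ν Φ g L - c := by
        have e : ∀ ω, 1 / 2 * (Φ (fun i => L i + c + 2 * g ω i) + Φ (fun i => L i + c - 2 * g ω i))
            = 1 / 2 * (Φ (fun i => L i + 2 * g ω i) + Φ (fun i => L i - 2 * g ω i)) - c := by
          intro ω
          have s1 := h.shift (fun i => L i + 2 * g ω i) c
          have s2 := h.shift (fun i => L i - 2 * g ω i) c
          simp only [add_right_comm _ _ c, sub_add_eq_add_sub] at s1 s2
          rw [s1, s2]
          ring
        simp only [symValue, e]
        rw [integral_sub (h.integrable_sym h𝒢 hg L) (integrable_const _)]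
        simp
      simp only
      rw [h2]; linarith
    intro L c
    refine le_antisymm (key L c) ?_
    have := key (fun i => L i + c) (-c)
    simp only [add_neg_cancel_right] at this
    linarith

variable [Nonempty ι]

lemma isPotential_endPotential : IsPotential (endPotential (ι := ι)) where
  convex := by
    refine ⟨convex_univ, fun x _ y _ a b ha hb _ => ciSup_le fun i => ?_⟩
    have h1 : -x i ≤ endPotential x := le_ciSup (f := fun i => -x i) (Set.finite_range _).bddAbove i
    have h2 : -y i ≤ endPotential y := le_ciSup (f := fun i => -y i) (Set.finite_range _).bddAbove i
    have h3 := mul_le_mul_of_nonneg_left h1 ha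
    have h4 := mul_le_mul_of_nonneg_left h2 hb
    simp only [Pi.add_apply, Pi.smul_apply, smul_eq_mul]
    linarith
  anti := fun L L' h => ciSup_mono (Set.finite_range _).bddAbove fun i => neg_le_neg (h i)
  shift := by
    have key : ∀ (L : ι → ℝ) c, endPotential (fun i => L i + c) ≤ endPotential L - c :=
      fun L c => ciSup_le fun i => by
        have h1 : -L i ≤ endPotential L :=
          le_ciSup (f := fun i => -L i) (Set.finite_range _).bddAbove i
        linarith
    intro L c
    refine le_antisymm (key L c) ?_
    have := key (fun i => L i + c) (-c)
    simp only [add_neg_cancel_right] at this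
    linarith

lemma isPotential_potential (h𝒢 : IsMoveClass 𝒢 B) (n : ℕ) : IsPotential (potential ν 𝒢 n) := by
  induction n with
  | zero => exact isPotential_endPotential
  | succ n ih => exact isPotential_gameStep ih h𝒢

lemma integrable_move (h𝒢 : IsMoveClass 𝒢 B) {g : Ω → ι → ℝ} (hg : g ∈ 𝒢) :
    Integrable g ν := by
  refine Integrable.of_bound (h𝒢.measurable g hg).aestronglyMeasurable B
    (Filter.Eventually.of_forall fun ω => ?_)
  have i : ι := Classical.arbitrary ι
  exact (pi_norm_le_iff_of_nonneg ((abs_nonneg _).trans (h𝒢.bound g hg ω i))).2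
    fun i => h𝒢.bound g hg ω i

/-- Against a known mixture of moves, the best action of the learner keeps the potential below the
symmetrized one. -/
lemma exists_response (h : IsPotential Φ) (h𝒢 : IsMoveClass 𝒢 B) (L : ι → ℝ) {κ : Type*}
    [Fintype κ] (w : κ → ℝ) (hw : ∀ k, 0 ≤ w k) (hw1 : ∑ k, w k = 1) (g : κ → Ω → ι → ℝ)
    (hg : ∀ k, g k ∈ 𝒢) :
    ∃ i, ∑ k, w k * (∫ ω, g k ω i ∂ν + ∫ ω, Φ (fun j => L j + g k ω j) ∂ν)
      ≤ gameStep ν 𝒢 Φ L := by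
  let G : ι → ℝ := fun i => ∑ k, w k * ∫ ω, g k ω i ∂ν
  obtain ⟨i, hi⟩ := Finite.exists_min G
  refine ⟨i, ?_⟩
  have i1 : ∀ k, Integrable (fun ω => Φ (fun j => L j + g k ω j)) ν := fun k => by
    simpa using h.integrable (ν := ν) h𝒢 (hg k) L 1
  have i2 := fun k => h.integrable (ν := ν) h𝒢 (hg k) L 2
  have i3 := fun k => h.integrable_sub (ν := ν) h𝒢 (hg k) L 2
  have step1 : ∀ k, ∫ ω, Φ (fun j => L j + g k ω j) ∂ν
      ≤ 1 / 2 * ∫ ω, Φ (fun j => L j + 2 * g k ω j) ∂ν + 1 / 2 * Φ (fun j => L j - 2 * G j)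
        - G i := by
    intro k
    have e : 1 / 2 * ∫ ω, Φ (fun j => L j + 2 * g k ω j) ∂ν + 1 / 2 * Φ (fun j => L j - 2 * G j)
        - G i = ∫ ω, (1 / 2 * Φ (fun j => L j + 2 * g k ω j)
          + (1 / 2 * Φ (fun j => L j - 2 * G j) - G i)) ∂ν := by
      rw [integral_add ((i2 k).const_mul _) (integrable_const _), integral_const_mul]
      simp; ring
    rw [e]
    refine integral_mono (i1 k) (((i2 k).const_mul _).add (integrable_const _)) fun ω => ?_
    -- Action `i` has the least mean loss, so lowering every coordinate by its own mean, instead of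
    -- by `G i`, can only raise the potential; the term `-G i` then cancels the mean loss of the
    -- learner. The shifted point is the midpoint of `L + 2g` and `L - 2G`, and convexity does the
    -- symmetrization.
    have c1 : Φ (fun j => L j + g k ω j) ≤ Φ (fun j => L j + g k ω j - G j) - G i := by
      rw [← h.shift]
      exact h.anti fun j => by have := hi j; simp only; linarith
    have c2 := h.convex.2 (Set.mem_univ (fun j => L j + 2 * g k ω j))
      (Set.mem_univ (fun j => L j - 2 * G j)) (show (0 : ℝ) ≤ 1 / 2 by norm_num)
      (show (0 : ℝ) ≤ 1 / 2 by norm_num) (by norm_num)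
    have e2 : (1 / 2 : ℝ) • (fun j => L j + 2 * g k ω j) + (1 / 2 : ℝ) • (fun j => L j - 2 * G j)
        = fun j => L j + g k ω j - G j := by
      ext j; simp only [Pi.add_apply, Pi.smul_apply, smul_eq_mul]; ring
    rw [e2] at c2
    simp only [smul_eq_mul] at c2 ⊢
    linarith
  -- Jensen's inequality, first over the mixture and then over the noise, replaces the mean by the
  -- random losses.
  have step2 : Φ (fun j => L j - 2 * G j) ≤ ∑ k, w k * ∫ ω, Φ (fun j => L j - 2 * g k ω j) ∂ν := by
    have c1 := h.convex.map_sum_le (t := Finset.univ) (w := w)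
      (p := fun k j => L j - 2 * ∫ ω, g k ω j ∂ν) (fun k _ => hw k) hw1 (fun _ _ => Set.mem_univ _)
    have e : ∑ k, w k • (fun j => L j - 2 * ∫ ω, g k ω j ∂ν) = fun j => L j - 2 * G j := by
      ext j
      simp only [Finset.sum_apply, Pi.smul_apply, smul_eq_mul, G, mul_sub, Finset.sum_sub_distrib,
        ← Finset.sum_mul, hw1, one_mul, Finset.mul_sum]
      congr 1
      exact Finset.sum_congr rfl fun k _ => by ring
    rw [e] at c1
    refine c1.trans (Finset.sum_le_sum fun k _ => ?_)
    rw [smul_eq_mul]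
    refine mul_le_mul_of_nonneg_left ?_ (hw k)
    have hint : Integrable (fun ω j => L j - 2 * g k ω j) ν :=
      (integrable_const L).sub ((integrable_move h𝒢 (hg k)).smul (2 : ℝ))
    have c2 := h.convex.map_integral_le (μ := ν) (f := fun ω j => L j - 2 * g k ω j)
      h.continuous.continuousOn isClosed_univ (Filter.Eventually.of_forall fun _ => Set.mem_univ _)
      hint (i3 k)
    refine le_trans (le_of_eq (congrArg Φ ?_)) c2
    ext j
    rw [eval_integral (fun j => hint.eval j)]
    rw [integral_sub (integrable_const _) ((integrable_move_apply h𝒢 (hg k) j).const_mul 2),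
      integral_const_mul]
    simp
  have step3 : ∀ k, 1 / 2 * ∫ ω, Φ (fun j => L j + 2 * g k ω j) ∂ν
      + 1 / 2 * ∫ ω, Φ (fun j => L j - 2 * g k ω j) ∂ν ≤ gameStep ν 𝒢 Φ L := by
    intro k
    refine le_trans (le_of_eq ?_) (symValue_le_gameStep (ν := ν) h h𝒢 (hg k) L)
    unfold symValue
    rw [integral_const_mul, integral_add (i2 k) (i3 k)]; ring
  have t1 := Finset.sum_le_sum fun k (_ : k ∈ Finset.univ) =>
    mul_le_mul_of_nonneg_left (step1 k) (hw k)
  have t3 := Finset.sum_le_sum fun k (_ : k ∈ Finset.univ) =>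
    mul_le_mul_of_nonneg_left (step3 k) (hw k)
  have hG : G i = ∑ k, w k * ∫ ω, g k ω i ∂ν := rfl
  simp only [mul_sub, mul_add, Finset.sum_sub_distrib, Finset.sum_add_distrib, ← Finset.sum_mul,
    hw1, one_mul, mul_left_comm (w _) (1 / 2 : ℝ), ← Finset.mul_sum] at t1 t3 ⊢
  rw [← hG]
  linarith

/-- The minimax argument: the learner has a mixed action that is good against every move. -/
lemma exists_mixed_action (h : IsPotential Φ) (h𝒢 : IsMoveClass 𝒢 B) (L : ι → ℝ) :
    ∃ p ∈ stdSimplex ℝ ι, ∀ g ∈ 𝒢, ∑ i, p i * ∫ ω, g ω i ∂ν + ∫ ω, Φ (fun j => L j + g ω j) ∂ν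
      ≤ gameStep ν 𝒢 Φ L := by
  classical
  set v := gameStep ν 𝒢 Φ L with hv
  let pay : 𝒢 → ι → ℝ := fun g i =>
    ∫ ω, (g : Ω → ι → ℝ) ω i ∂ν + ∫ ω, Φ (fun j => L j + (g : Ω → ι → ℝ) ω j) ∂ν
  -- By `exists_response` no mixture of payoff vectors exceeds `v` in all coordinates. A hyperplane
  -- separating their hull from this open orthant has coefficients that are proportional to the
  -- desired mixed action.
  let D : Set (ι → ℝ) := Set.univ.pi fun _ => Set.Ioi v
  have hdisj : Disjoint D (convexHull ℝ (Set.range pay)) := by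
    rw [Set.disjoint_left]
    intro x hx hxc
    obtain ⟨κ, hκ, w, z, hw, hw1, hz, hsum⟩ := mem_convexHull_iff_exists_fintype.1 hxc
    choose gk hgk using hz
    obtain ⟨i, hi⟩ := exists_response (ν := ν) h h𝒢 L w hw hw1 (fun k => (gk k : Ω → ι → ℝ))
      fun k => (gk k).2
    have h1 : v < x i := hx i (Set.mem_univ i)
    have h2 : x i = ∑ k, w k * pay (gk k) i := by
      rw [← hsum]; simp [Finset.sum_apply, hgk]
    simp only [h2, pay] at h1
    linarith
  obtain ⟨f, u, hf1, hf2⟩ := geometric_hahn_banach_open (convex_pi fun _ _ => convex_Ioi v)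
    (isOpen_set_pi Set.finite_univ fun _ _ => isOpen_Ioi) (convex_convexHull ℝ _) hdisj
  have hfsum : ∀ x : ι → ℝ, f x = ∑ i, x i * f (Pi.single i 1) := by
    intro x
    conv_lhs => rw [← Finset.univ_sum_single x]
    rw [map_sum]
    refine Finset.sum_congr rfl fun i _ => ?_
    have : Pi.single i (x i) = x i • (Pi.single i (1 : ℝ) : ι → ℝ) := by
      rw [← Pi.single_smul]; simp
    rw [this, map_smul, smul_eq_mul]
  set q : ι → ℝ := fun i => -f (Pi.single i 1) with hq
  have hfq : ∀ x : ι → ℝ, f x = -∑ i, x i * q i := by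
    intro x; rw [hfsum]; simp [q]
  -- The orthant is unbounded in direction `i`, so a negative coefficient would violate the
  -- separating bound far out.
  have hq0 : ∀ i, 0 ≤ q i := by
    intro i
    by_contra! hneg
    let x : ℝ → ι → ℝ := fun s j => v + 1 + if j = i then s else 0
    have hx : ∀ s, 0 ≤ s → -(∑ j, (v + 1) * q j) - s * q i < u := by
      intro s hs
      have h1 := hf1 (x s) fun j _ => by
        simp only [x, Set.mem_Ioi]
        split_ifs <;> linarith
      rw [hfq] at h1
      simp only [x, add_mul, Finset.sum_add_distrib, ite_mul, zero_mul, Finset.sum_ite_eq',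
        Finset.mem_univ, if_true] at h1
      simp only [add_mul, Finset.sum_add_distrib]
      linarith
    have h0 := hx 0 le_rfl
    have h1 := hx ((u + ∑ j, (v + 1) * q j) / (-q i)) (by
      refine div_nonneg ?_ (by linarith)
      linarith)
    have h2 : (u + ∑ j, (v + 1) * q j) / (-q i) * q i = -(u + ∑ j, (v + 1) * q j) := by
      rw [div_neg, neg_mul, div_mul_cancel₀ _ hneg.ne]
    rw [h2] at h1
    linarith
  have hlim : v * ∑ i, q i ≥ -u := by
    have h1 : ∀ s : ℝ, 0 < s → -u < (v + s) * ∑ i, q i := by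
      intro s hs
      have h1 := hf1 (fun _ => v + s) fun j _ => by simp [hs]
      rw [hfq, ← Finset.mul_sum] at h1
      linarith
    refine ge_of_tendsto (x := nhdsWithin (0 : ℝ) (Set.Ioi 0)) (f := fun s : ℝ => (v + s) * ∑ i, q i)
      ?_ (by filter_upwards [self_mem_nhdsWithin] with s hs using (h1 s hs).le)
    have : Filter.Tendsto (fun s : ℝ => (v + s) * ∑ i, q i) (nhds 0)
        (nhds ((v + 0) * ∑ i, q i)) := Continuous.tendsto (by fun_prop) 0
    rw [add_zero] at this
    exact this.mono_left nhdsWithin_le_nhds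
  have hpay : ∀ g : 𝒢, ∑ i, pay g i * q i ≤ -u := by
    intro g
    have := hf2 _ (subset_convexHull ℝ _ ⟨g, rfl⟩)
    rw [hfq] at this
    linarith
  -- If all coefficients vanished, strict separation on the open side would be impossible.
  have hQ : 0 < ∑ i, q i := by
    refine lt_of_le_of_ne (Finset.sum_nonneg fun i _ => hq0 i) fun h0 => ?_
    have hq00 : ∀ i, q i = 0 := fun i =>
      (Finset.sum_eq_zero_iff_of_nonneg fun i _ => hq0 i).1 h0.symm i (Finset.mem_univ i)
    obtain ⟨g, hg⟩ := h𝒢.nonempty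
    have h1 := hpay ⟨g, hg⟩
    have h2 := hf1 (fun _ => v + 1) fun j _ => by simp
    rw [hfq] at h2
    simp only [hq00, mul_zero, Finset.sum_const_zero, neg_zero] at h1 h2
    linarith
  refine ⟨fun i => q i / ∑ j, q j, ⟨fun i => div_nonneg (hq0 i) hQ.le, ?_⟩, fun g hg => ?_⟩
  · rw [← Finset.sum_div, div_self hQ.ne']
  · have h1 := (hpay ⟨g, hg⟩).trans hlim.le
    simp only [pay, add_mul, Finset.sum_add_distrib, ← Finset.mul_sum] at h1
    have e : ∑ i, q i / (∑ j, q j) * ∫ ω, g ω i ∂ν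
        = (∑ i, (∫ ω, g ω i ∂ν) * q i) / ∑ j, q j := by
      rw [Finset.sum_div]; exact Finset.sum_congr rfl fun i _ => by ring
    rw [e, ← le_sub_iff_add_le, div_le_iff₀ hQ]
    linarith

end game

end ViOlin

namespace ViOlin

variable {m d T : ℕ} {σ : ℝ → ℝ}

/-! ### Suprema over the parameters -/

lemma isCompact_Theta (m d : ℕ) : IsCompact (Theta m d) := by
  refine Metric.isCompact_of_isClosed_isBounded ?_ ?_
  · have e : Theta m d = (⋂ i, {θ : Param m d | ∑ j, |θ.1 i j| ≤ 1})
        ∩ {θ : Param m d | ∑ i, |θ.2 i| ≤ 1} := by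
      ext θ; simp [Theta]
    rw [e]
    refine (isClosed_iInter fun i => isClosed_le ?_ continuous_const).inter
      (isClosed_le ?_ continuous_const) <;> fun_prop
  · refine (Metric.isBounded_closedBall (x := (0 : Param m d)) (r := 1)).subset fun θ hθ => ?_
    rw [mem_closedBall_zero_iff, Prod.norm_def]
    refine max_le ((pi_norm_le_iff_of_nonneg zero_le_one).2 fun i =>
      (pi_norm_le_iff_of_nonneg zero_le_one).2 fun j => ?_)
      ((pi_norm_le_iff_of_nonneg zero_le_one).2 fun i => ?_)
    · exact (Finset.single_le_sum (f := fun j => |θ.1 i j|) (fun _ _ => abs_nonneg _)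
        (Finset.mem_univ j)).trans (hθ.1 i)
    · exact (Finset.single_le_sum (f := fun i => |θ.2 i|) (fun _ _ => abs_nonneg _)
        (Finset.mem_univ i)).trans hθ.2

lemma continuous_sum_loss (hσ : IsSmoothActivation σ) (κ₁ κ₂ : ℝ) (c : Fin T → ℝ) :
    Continuous fun p : (Fin T → Data d) × Param m d => ∑ t, c t * loss σ κ₁ κ₂ (p.1 t) p.2 := by
  refine continuous_finsetSum _ fun t _ => continuous_const.mul ?_
  have := (continuous_loss (m := m) (d := d) hσ κ₁ κ₂).comp
    (((continuous_apply t).comp continuous_fst).prodMk continuous_snd :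
      Continuous fun p : (Fin T → Data d) × Param m d => (p.1 t, p.2))
  exact this

lemma bddAbove_sum_loss (hσ : IsSmoothActivation σ) (κ₁ κ₂ : ℝ) (c : Fin T → ℝ)
    (z : Fin T → Data d) :
    BddAbove (Set.range fun θ : Theta m d => ∑ t, c t * loss σ κ₁ κ₂ (z t) (θ : Param m d)) := by
  have hc : Continuous fun θ : Param m d => ∑ t, c t * loss σ κ₁ κ₂ (z t) θ := by
    have := (continuous_sum_loss (m := m) hσ κ₁ κ₂ c).comp
      (continuous_const.prodMk continuous_id : Continuous fun θ : Param m d => (z, θ))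
    exact this
  have h := ((isCompact_Theta m d).image hc).bddAbove
  rw [Set.image_eq_range] at h
  exact h

/-- The supremum over the parameters is a measurable function of the data. -/
lemma measurable_iSup_sum_loss (hσ : IsSmoothActivation σ) (κ₁ κ₂ : ℝ) (c : Fin T → ℝ) :
    Measurable fun z : Fin T → Data d =>
      ⨆ θ : Theta m d, ∑ t, c t * loss σ κ₁ κ₂ (z t) (θ : Param m d) := by
  have : OpensMeasurableSpace (Fin T → Data d) := Pi.opensMeasurableSpace
  refine LowerSemicontinuous.measurable (lowerSemicontinuous_ciSup
    (bddAbove_sum_loss hσ κ₁ κ₂ c) fun θ => ?_)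
  have := (continuous_sum_loss (m := m) hσ κ₁ κ₂ c).comp
      (continuous_id.prodMk continuous_const :
        Continuous fun z : Fin T → Data d => (z, (θ : Param m d)))
  exact this.lowerSemicontinuous

lemma measurable_iInf_sum_loss (hσ : IsSmoothActivation σ) (κ₁ κ₂ : ℝ) :
    Measurable fun z : Fin T → Data d =>
      ⨅ θ : Theta m d, ∑ t, loss σ κ₁ κ₂ (z t) (θ : Param m d) := by
  have h := (measurable_iSup_sum_loss (m := m) (d := d) hσ κ₁ κ₂ (fun _ : Fin T => -1)).neg
  have e : (fun z : Fin T → Data d => -⨆ θ : Theta m d,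
      ∑ t, (-1) * loss σ κ₁ κ₂ (z t) (θ : Param m d)) = fun z : Fin T → Data d =>
      ⨅ θ : Theta m d, ∑ t, loss σ κ₁ κ₂ (z t) (θ : Param m d) := by
    ext z
    simp only [neg_mul, one_mul, Finset.sum_neg_distrib]
    rw [iSup, iInf, Real.sInf_def]
    congr 2
    ext r
    simp only [Set.mem_range, Set.mem_neg]
    exact exists_congr fun θ => neg_eq_iff_eq_neg
  rw [← e]; exact h

lemma abs_iSup_sum_loss_le (hσ : IsSmoothActivation σ) {ρ : ℝ} (κ₁ κ₂ : ℝ) (ε : Fin T → ℤˣ)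
    {z : Fin T → Data d} (hz : ∀ t, IsAdmissible ρ (z t)) :
    |(⨆ θ : Theta m d, ∑ t, sg (ε t) * loss σ κ₁ κ₂ (z t) (θ : Param m d))|
      ≤ T * lossBound ρ κ₁ κ₂ := by
  have h : ∀ θ : Theta m d, |(∑ t, sg (ε t) * loss σ κ₁ κ₂ (z t) (θ : Param m d))|
      ≤ T * lossBound ρ κ₁ κ₂ := fun θ => by
    refine (Finset.abs_sum_le_sum_abs _ _).trans ?_
    refine (Finset.sum_le_sum fun t _ => ?_).trans_eq (b := ∑ _t : Fin T, lossBound ρ κ₁ κ₂)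
      (by simp)
    rw [abs_mul, abs_sg, one_mul]
    exact abs_loss_le hσ κ₁ κ₂ (hz t) θ.2
  have hb : BddAbove (Set.range fun θ : Theta m d =>
      ∑ t, sg (ε t) * loss σ κ₁ κ₂ (z t) (θ : Param m d)) :=
    ⟨T * lossBound ρ κ₁ κ₂, by rintro _ ⟨θ, rfl⟩; exact (abs_le.1 (h θ)).2⟩
  have θ0 : Theta m d := Classical.arbitrary _
  refine abs_le.2 ⟨(abs_le.1 (h θ0)).1.trans (le_ciSup hb θ0), ciSup_le fun θ => (abs_le.1 (h θ)).2⟩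

section tree

variable {ρ : ℝ} {x : Fin T → (Fin T → ℤˣ) → (Fin T → Noise d) → Pair d}
  {y : Fin T → (Fin T → ℤˣ) → (Fin T → Noise d) → Fin 4 → ℝ}

lemma IsTree.integrable (hσ : IsSmoothActivation σ) (κ₁ κ₂ : ℝ) (h : IsTree ρ x y)
    (ε : Fin T → ℤˣ) : Integrable (fun ξ => ⨆ θ : Theta m d, ∑ t, sg (ε t) *
      loss σ κ₁ κ₂ ((x t ε ξ, ξ t), y t ε ξ) (θ : Param m d)) (noiseLaw d T) := by
  have hs := h.1 ε
  have hm : Measurable fun (ξ : Fin T → Noise d) (t : Fin T) =>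
      (((x t ε ξ, ξ t), y t ε ξ) : Data d) :=
    measurable_pi_iff.2 fun t =>
      ((hs.measurable_x t).prodMk (measurable_pi_apply t)).prodMk (hs.measurable_y t)
  exact integrable_of_bounded ((measurable_iSup_sum_loss hσ κ₁ κ₂ fun t => sg (ε t)).comp hm)
    fun ξ => abs_iSup_sum_loss_le hσ κ₁ κ₂ ε fun t => hs.admissible t ξ (ξ t)

lemma IsTree.treeComplexity_eq (hσ : IsSmoothActivation σ) (κ₁ κ₂ : ℝ) (h : IsTree ρ x y) :
    treeComplexity m σ κ₁ κ₂ x y = signAvg fun ε => ∫ ξ, ⨆ θ : Theta m d, ∑ t, sg (ε t) *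
      loss σ κ₁ κ₂ ((x t ε ξ, ξ t), y t ε ξ) (θ : Param m d) ∂noiseLaw d T := by
  unfold treeComplexity signAvg
  rw [integral_const_mul, integral_finsetSum _ fun ε _ => h.integrable hσ κ₁ κ₂ ε]

lemma IsTree.treeComplexity_le (hσ : IsSmoothActivation σ) (κ₁ κ₂ : ℝ) (h : IsTree ρ x y) :
    treeComplexity m σ κ₁ κ₂ x y ≤ seqRademacher m d T ρ σ κ₁ κ₂ := by
  refine le_csSup ⟨T * lossBound ρ κ₁ κ₂, ?_⟩ ⟨x, y, h, rfl⟩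
  rintro _ ⟨x', y', h', rfl⟩
  rw [h'.treeComplexity_eq hσ, ← signAvg_const T (T * lossBound ρ κ₁ κ₂)]
  refine signAvg_mono fun ε => ?_
  have := integral_mono (h'.integrable (m := m) hσ κ₁ κ₂ ε)
    (integrable_const (T * lossBound ρ κ₁ κ₂)) fun ξ => (abs_le.1 (abs_iSup_sum_loss_le hσ κ₁ κ₂ ε
      fun t => (h'.1 ε).admissible t ξ (ξ t))).2
  simpa using this

end tree

/-! ### A finite net of parameters -/

/-- Joint continuity becomes uniform on the compact product of Θ and a ball, which yields the finite
net. In finite dimension, operator-norm continuity of the Hessian can be checked vector by vector.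
-/
lemma continuous_jet (hσ : IsSmoothActivation σ) : Continuous fun p : Param m d × Act d =>
    (reward σ p.1 p.2, gradient (reward σ p.1) p.2, hess (reward σ p.1) p.2) := by
  refine (continuous_reward hσ).prodMk (Continuous.prodMk ?_ (continuous_clm_apply.2 fun u => ?_))
  · have := hσ.diff_deriv.continuous
    simp only [gradient_reward hσ, lin]
    fun_prop
  · have := hσ.continuous_deriv2
    simp only [hess_reward hσ, lin]
    fun_prop

/-- Thanks to truncation the squares act as Lipschitz functions, so the noise enters only through
‖u‖ and ‖u‖‖v‖, which are integrable. -/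
lemma abs_loss_sub_le (hσ : IsSmoothActivation σ) {ρ κ₁ κ₂ δ : ℝ} (hκ₁ : 0 ≤ κ₁) (hκ₂ : 0 ≤ κ₂)
    (hδ : 0 ≤ δ) {θ θ' : Param m d} (hθ : θ ∈ Theta m d) (hθ' : θ' ∈ Theta m d) {z : Data d}
    (hz : IsAdmissible ρ z) (h0 : ∀ b, ‖b‖ ≤ ρ → |reward σ θ b - reward σ θ' b| ≤ δ)
    (h1 : ∀ b, ‖b‖ ≤ ρ → ‖gradient (reward σ θ) b - gradient (reward σ θ') b‖ ≤ δ)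
    (h2 : ∀ b, ‖b‖ ≤ ρ → ‖hess (reward σ θ) b - hess (reward σ θ') b‖ ≤ δ) :
    |loss σ κ₁ κ₂ z θ - loss σ κ₁ κ₂ z θ'|
      ≤ δ * (8 * (1 + ρ ^ 2 / 2) + 2 * κ₁ + 2 * κ₂) *
        (1 + ‖z.1.2.1‖ + ‖z.1.2.1‖ * ‖z.1.2.2‖) := by
  have sq : ∀ b, ‖b‖ ≤ ρ → ∀ y, |y| ≤ 1 + ρ ^ 2 / 2 →
      |(reward σ θ b - y) ^ 2 - (reward σ θ' b - y) ^ 2| ≤ δ * (4 * (1 + ρ ^ 2 / 2)) := by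
    intro b hb y hy
    have e : (reward σ θ b - y) ^ 2 - (reward σ θ' b - y) ^ 2
        = (reward σ θ b - reward σ θ' b) * (reward σ θ b + reward σ θ' b - 2 * y) := by ring
    rw [e, abs_mul]
    have b1 := abs_le.1 (abs_reward_le hσ hθ hb)
    have b2 := abs_le.1 (abs_reward_le hσ hθ' hb)
    have b3 := abs_le.1 hy
    refine mul_le_mul (h0 b hb) (abs_le.2 ⟨?_, ?_⟩) (abs_nonneg _) hδ <;> linarith
  have c0 := sq _ hz.fst _ hz.label₀
  have c1 := sq _ hz.snd _ hz.label₁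
  have c2 : |min (κ₁ ^ 2) ((predict σ θ z.1 2 - z.2 2) ^ 2)
      - min (κ₁ ^ 2) ((predict σ θ' z.1 2 - z.2 2) ^ 2)| ≤ 2 * κ₁ * (δ * ‖z.1.2.1‖) := by
    refine (abs_min_sq_sub_le hκ₁ _ _).trans ?_
    gcongr
    have e : predict σ θ z.1 2 - z.2 2 - (predict σ θ' z.1 2 - z.2 2)
        = inner ℝ (gradient (reward σ θ) z.1.1.2 - gradient (reward σ θ') z.1.1.2) z.1.2.1 := by
      simp [predict, inner_sub_left]
    rw [e]
    refine (abs_real_inner_le_norm _ _).trans ?_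
    gcongr
    exact h1 _ hz.snd
  have c3 : |min (κ₂ ^ 2) ((predict σ θ z.1 3 - z.2 3) ^ 2)
      - min (κ₂ ^ 2) ((predict σ θ' z.1 3 - z.2 3) ^ 2)|
      ≤ 2 * κ₂ * (δ * (‖z.1.2.1‖ * ‖z.1.2.2‖)) := by
    refine (abs_min_sq_sub_le hκ₂ _ _).trans ?_
    gcongr
    have e : predict σ θ z.1 3 - z.2 3 - (predict σ θ' z.1 3 - z.2 3)
        = inner ℝ ((hess (reward σ θ) z.1.1.2 - hess (reward σ θ') z.1.1.2) z.1.2.1) z.1.2.2 := by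
      simp [predict, inner_sub_left]
    rw [e]
    refine (abs_real_inner_le_norm _ _).trans ?_
    rw [← mul_assoc]
    gcongr
    refine (ContinuousLinearMap.le_opNorm _ _).trans ?_
    gcongr
    exact h2 _ hz.snd
  have e0 : ∀ θ : Param m d, predict σ θ z.1 0 = reward σ θ z.1.1.1 := fun _ => rfl
  have e1 : ∀ θ : Param m d, predict σ θ z.1 1 = reward σ θ z.1.1.2 := fun _ => rfl
  have n1 := norm_nonneg z.1.2.1
  have n2 : 0 ≤ ‖z.1.2.1‖ * ‖z.1.2.2‖ := by positivity
  simp only [loss, e0, e1]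
  rw [abs_le] at c0 c1 c2 c3 ⊢
  have r0 : δ * (4 * (1 + ρ ^ 2 / 2)) + δ * (4 * (1 + ρ ^ 2 / 2))
      + 2 * κ₁ * (δ * ‖z.1.2.1‖) + 2 * κ₂ * (δ * (‖z.1.2.1‖ * ‖z.1.2.2‖))
      ≤ δ * (8 * (1 + ρ ^ 2 / 2) + 2 * κ₁ + 2 * κ₂) *
        (1 + ‖z.1.2.1‖ + ‖z.1.2.1‖ * ‖z.1.2.2‖) := by
    have p0 : 0 ≤ δ * (8 * (1 + ρ ^ 2 / 2)) := by positivity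
    have p1 : 0 ≤ δ * (2 * κ₁) := by positivity
    have p2 : 0 ≤ δ * (2 * κ₂) := by positivity
    have q0 := mul_nonneg p0 (add_nonneg n1 n2)
    have q1 := mul_nonneg p1 (add_nonneg zero_le_one n2)
    have q2 := mul_nonneg p2 (add_nonneg zero_le_one n1)
    nlinarith
  constructor <;> linarith [c0.1, c0.2, c1.1, c1.2, c2.1, c2.2, c3.1, c3.2]

/-- The size of the noise that enters the Lipschitz bounds. -/
noncomputable def noiseSize (w : Noise d) : ℝ := 1 + ‖w.1‖ + ‖w.1‖ * ‖w.2‖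

lemma integrable_noiseSize : Integrable (noiseSize (d := d)) (roundLaw d) := by
  have h : Integrable (fun u : Act d => ‖u‖) (stdGaussian (Act d)) :=
    (memLp_one_iff_integrable.1 (IsGaussian.memLp_id (stdGaussian (Act d)) 1 (by norm_num))).norm
  have h1 : Integrable (fun w : Noise d => ‖w.1‖) (roundLaw d) := h.comp_fst _
  have h2 : Integrable (fun w : Noise d => ‖w.1‖ * ‖w.2‖) (roundLaw d) := h.mul_prod h
  exact ((integrable_const 1).add h1).add h2

lemma one_le_noiseSize (w : Noise d) : 1 ≤ noiseSize w := by
  unfold noiseSize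
  have := norm_nonneg w.1
  have : 0 ≤ ‖w.1‖ * ‖w.2‖ := by positivity
  linarith

/-- A finite set of parameters represents all losses up to a small multiple of the size of the
noise. -/
lemma exists_param_net (hσ : IsSmoothActivation σ) {ρ κ₁ κ₂ η : ℝ} (hκ₁ : 0 ≤ κ₁) (hκ₂ : 0 ≤ κ₂)
    (hη : 0 < η) : ∃ (N : ℕ) (θn : Fin (N + 1) → Theta m d), ∀ θ : Theta m d, ∃ i, ∀ z : Data d,
      IsAdmissible ρ z → |loss σ κ₁ κ₂ z (θ : Param m d) - loss σ κ₁ κ₂ z (θn i : Param m d)|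
        ≤ η * noiseSize z.1.2 := by
  set C := 8 * (1 + ρ ^ 2 / 2) + 2 * κ₁ + 2 * κ₂ with hC
  have hC0 : 0 < C := by positivity
  have huc := ((isCompact_Theta m d).prod (isCompact_closedBall (0 : Act d) ρ)
    ).uniformContinuousOn_of_continuous (continuous_jet (m := m) (d := d) hσ).continuousOn
  rw [Metric.uniformContinuousOn_iff] at huc
  obtain ⟨δ, hδ, hJ⟩ := huc (η / C) (by positivity)
  obtain ⟨t, htΘ, htf, hcov⟩ := (isCompact_Theta m d).finite_cover_balls hδ
  have hne : t.Nonempty := by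
    obtain ⟨θ0⟩ := (inferInstance : Nonempty (Theta m d))
    have := hcov θ0.2
    simp only [Set.mem_iUnion] at this
    obtain ⟨θ, hθ, -⟩ := this
    exact ⟨θ, hθ⟩
  have : Finite t := htf
  have : Nonempty t := hne.to_subtype
  obtain ⟨n, ⟨e⟩⟩ := Finite.exists_equiv_fin t
  cases n with
  | zero => exact (e (Classical.arbitrary t)).elim0
  | succ N =>
    refine ⟨N, fun i => ⟨(e.symm i : Param m d), htΘ (e.symm i).2⟩, fun θ => ?_⟩
    have h := hcov θ.2
    simp only [Set.mem_iUnion, Metric.mem_ball] at h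
    obtain ⟨θ', hθ't, hd⟩ := h
    refine ⟨e ⟨θ', hθ't⟩, fun z hz => ?_⟩
    simp only [Equiv.symm_apply_apply]
    have hJ' : ∀ b : Act d, ‖b‖ ≤ ρ → dist (reward σ (θ : Param m d) b,
        gradient (reward σ (θ : Param m d)) b, hess (reward σ (θ : Param m d)) b)
        (reward σ θ' b, gradient (reward σ θ') b, hess (reward σ θ') b) < η / C := by
      intro b hb
      have hb' : b ∈ Metric.closedBall (0 : Act d) ρ := by simpa using hb
      exact hJ (θ, b) ⟨θ.2, hb'⟩ (θ', b) ⟨htΘ hθ't, hb'⟩ (by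
        rw [Prod.dist_eq]; exact max_lt hd (by simpa using hδ))
    simp only [Prod.dist_eq, max_lt_iff] at hJ'
    simp only [dist_eq_norm] at hJ'
    have := abs_loss_sub_le hσ hκ₁ hκ₂ (by positivity) θ.2 (htΘ hθ't) hz
      (fun b hb => (hJ' b hb).1.le) (fun b hb => (hJ' b hb).2.1.le) (fun b hb => (hJ' b hb).2.2.le)
    rwa [← hC, div_mul_cancel₀ _ hC0.ne'] at this

end ViOlin

namespace ViOlin

variable {m d T N : ℕ} {σ : ℝ → ℝ}

/-! ### The learner -/

lemma sum_add_le_of_step {T : ℕ} {c : Fin T → ℝ} {ψ : ℕ → ℝ} {e : ℝ}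
    (h : ∀ t : Fin T, c t + ψ (t + 1) ≤ ψ t + e) : ∑ t, c t + ψ T ≤ ψ 0 + T * e := by
  induction T with
  | zero => simp
  | succ T ih =>
    have h1 := ih fun t => h t.castSucc
    have h2 := h (Fin.last T)
    rw [Fin.sum_univ_castSucc]
    simp only [Fin.val_last] at h2
    push_cast
    linarith

section grid

variable {ι : Type*}

/-- The cell of a grid that contains a given vector. -/
noncomputable def cell (δ : ℝ) (L : ι → ℝ) : ι → ℤ := fun i => ⌊L i / δ⌋

/-- The representative of a cell. -/
def corner (δ : ℝ) (z : ι → ℤ) : ι → ℝ := fun i => δ * z i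

lemma abs_sub_corner_le {δ : ℝ} (hδ : 0 < δ) (L : ι → ℝ) (i : ι) :
    |L i - corner δ (cell δ L) i| ≤ δ := by
  have h1 := Int.floor_le (L i / δ)
  have h2 := Int.lt_floor_add_one (L i / δ)
  rw [le_div_iff₀ hδ] at h1
  rw [div_lt_iff₀ hδ] at h2
  simp only [cell, corner]
  rw [abs_le]
  constructor <;> nlinarith

lemma measurable_cell (δ : ℝ) : Measurable (cell (ι := ι) δ) :=
  measurable_pi_iff.2 fun i => Int.measurable_floor.comp (by fun_prop : Measurable fun L : ι → ℝ => L i / δ)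

variable [Fintype ι]

/-- A mixture of finitely many parameters. -/
noncomputable def mixture (θn : ι → Theta m d) (p : ι → ℝ) : Measure (Theta m d) :=
  ∑ i, ENNReal.ofReal (p i) • Measure.dirac (θn i)

lemma isProbabilityMeasure_mixture (θn : ι → Theta m d) {p : ι → ℝ} (hp : p ∈ stdSimplex ℝ ι) :
    IsProbabilityMeasure (mixture θn p) := by
  refine ⟨?_⟩
  simp only [mixture, Measure.finsetSum_apply, Measure.smul_apply, measure_univ, smul_eq_mul,
    mul_one]
  rw [← ENNReal.ofReal_sum_of_nonneg fun i _ => hp.1 i, hp.2, ENNReal.ofReal_one]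

lemma integral_mixture (θn : ι → Theta m d) {p : ι → ℝ} (hp : p ∈ stdSimplex ℝ ι)
    (f : Theta m d → ℝ) : ∫ θ, f θ ∂mixture θn p = ∑ i, p i * f (θn i) := by
  rw [mixture, integral_finsetSum_measure]
  · refine Finset.sum_congr rfl fun i _ => ?_
    rw [integral_smul_measure, integral_dirac, ENNReal.toReal_ofReal (hp.1 i), smul_eq_mul]
  · intro i _
    exact (integrable_dirac (by simp)).smul_measure ENNReal.ofReal_ne_top

end grid

/-- The losses of finitely many parameters at a data point. -/
noncomputable def lossVec (σ : ℝ → ℝ) (κ₁ κ₂ : ℝ) (θn : Fin (N + 1) → Theta m d) (z : Data d) :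
    Fin (N + 1) → ℝ := fun i => loss σ κ₁ κ₂ z (θn i : Param m d)

lemma Measurable.lossVec (hσ : IsSmoothActivation σ) (κ₁ κ₂ : ℝ) (θn : Fin (N + 1) → Theta m d)
    {α : Type*} [MeasurableSpace α] {F : α → Data d} (hF : Measurable F) :
    Measurable fun x => lossVec σ κ₁ κ₂ θn (F x) :=
  measurable_pi_iff.2 fun _ => Measurable.loss hσ κ₁ κ₂ hF measurable_const

/-- The moves of nature in the game against the learner. -/
def moves (ρ : ℝ) (σ : ℝ → ℝ) (κ₁ κ₂ : ℝ) (θn : Fin (N + 1) → Theta m d) :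
    Set (Noise d → Fin (N + 1) → ℝ) :=
  {g | ∃ (x : Pair d) (y : Noise d → Fin 4 → ℝ), Measurable y ∧
    (∀ w, IsAdmissible ρ ((x, w), y w)) ∧ g = fun w => lossVec σ κ₁ κ₂ θn ((x, w), y w)}

lemma isMoveClass_moves (hσ : IsSmoothActivation σ) {ρ : ℝ} (hρ : 0 ≤ ρ) (κ₁ κ₂ : ℝ)
    (θn : Fin (N + 1) → Theta m d) :
    IsMoveClass (moves ρ σ κ₁ κ₂ θn) (lossBound ρ κ₁ κ₂) where
  nonempty := ⟨_, 0, 0, measurable_const,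
    fun w => ⟨by simpa, by simpa, by simp; positivity, by simp; positivity⟩, rfl⟩
  measurable := by
    rintro _ ⟨x, y, hy, -, rfl⟩
    exact Measurable.lossVec hσ κ₁ κ₂ θn (by fun_prop)
  bound := by
    rintro _ ⟨x, y, -, hxy, rfl⟩ w i
    exact abs_loss_le hσ κ₁ κ₂ (hxy w) (θn i).2

/-- The learner that plays a mixture of finitely many parameters, which depends on the cell of the
vector of their cumulative losses. -/
noncomputable def gridLearner (hσ : IsSmoothActivation σ) (κ₁ κ₂ δ : ℝ)
    (θn : Fin (N + 1) → Theta m d) (p : ℕ → (Fin (N + 1) → ℤ) → Fin (N + 1) → ℝ)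
    (hp : ∀ t z, p t z ∈ stdSimplex ℝ (Fin (N + 1))) : Learner m d where
  -- The mixed actions come from arbitrary choices, one for each cell; as there are countably many
  -- cells the resulting map is measurable.
  dist t := (Kernel.ofFunOfCountable fun z => mixture θn (p t z)).comap
    (fun h : Fin t → Data d => cell δ fun i => ∑ s, lossVec σ κ₁ κ₂ θn (h s) i)
    ((measurable_cell δ).comp (measurable_pi_iff.2 fun i => Finset.measurable_fun_sum _ fun s _ =>
      Measurable.loss hσ κ₁ κ₂ (measurable_pi_apply s) measurable_const))
  isMarkov t := by
    have : IsMarkovKernel (Kernel.ofFunOfCountable fun z => mixture θn (p t z)) :=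
      ⟨fun z => isProbabilityMeasure_mixture θn (hp t z)⟩
    infer_instance

lemma gridLearner_dist (hσ : IsSmoothActivation σ) (κ₁ κ₂ δ : ℝ)
    (θn : Fin (N + 1) → Theta m d) (p : ℕ → (Fin (N + 1) → ℤ) → Fin (N + 1) → ℝ)
    (hp : ∀ t z, p t z ∈ stdSimplex ℝ (Fin (N + 1))) (t : ℕ) (h : Fin t → Data d) :
    (gridLearner hσ κ₁ κ₂ δ θn p hp).dist t h
      = mixture θn (p t (cell δ fun i => ∑ s, lossVec σ κ₁ κ₂ θn (h s) i)) := rfl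

section strategy

variable {ρ κ₁ κ₂ : ℝ} {θn : Fin (N + 1) → Theta m d} {x : Fin T → (Fin T → Noise d) → Pair d}
  {y : Fin T → (Fin T → Noise d) → Fin 4 → ℝ}

/-- The cumulative losses before round `k`. -/
noncomputable def cumLoss (σ : ℝ → ℝ) (κ₁ κ₂ : ℝ) (θn : Fin (N + 1) → Theta m d)
    (x : Fin T → (Fin T → Noise d) → Pair d) (y : Fin T → (Fin T → Noise d) → Fin 4 → ℝ)
    (k : ℕ) (ξ : Fin T → Noise d) : Fin (N + 1) → ℝ :=
  ∑ s ∈ Finset.range k, if h : s < T then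
    lossVec σ κ₁ κ₂ θn ((x ⟨s, h⟩ ξ, ξ ⟨s, h⟩), y ⟨s, h⟩ ξ) else 0

lemma cumLoss_zero (ξ : Fin T → Noise d) : cumLoss σ κ₁ κ₂ θn x y 0 ξ = 0 := by simp [cumLoss]

lemma cumLoss_succ (t : Fin T) (ξ : Fin T → Noise d) :
    cumLoss σ κ₁ κ₂ θn x y (t + 1) ξ = cumLoss σ κ₁ κ₂ θn x y t ξ
      + lossVec σ κ₁ κ₂ θn ((x t ξ, ξ t), y t ξ) := by
  simp [cumLoss, Finset.sum_range_succ]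

lemma cumLoss_history (t : Fin T) (ξ : Fin T → Noise d) :
    (fun i => ∑ s, lossVec σ κ₁ κ₂ θn (history x y ξ t s) i) = cumLoss σ κ₁ κ₂ θn x y t ξ := by
  ext i
  simp only [cumLoss, Finset.sum_range, Finset.sum_apply]
  refine Finset.sum_congr rfl fun s _ => ?_
  rw [dif_pos (s.2.trans t.2)]
  rfl

lemma cumLoss_last (ξ : Fin T → Noise d) (i : Fin (N + 1)) :
    cumLoss σ κ₁ κ₂ θn x y T ξ i
      = ∑ t, loss σ κ₁ κ₂ ((x t ξ, ξ t), y t ξ) (θn i : Param m d) := by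
  simp only [cumLoss, Finset.sum_range, Finset.sum_apply]
  refine Finset.sum_congr rfl fun s _ => ?_
  rw [dif_pos s.2]
  rfl

lemma measurable_cumLoss (hσ : IsSmoothActivation σ) (hx : ∀ t, Measurable (x t))
    (hy : ∀ t, Measurable (y t)) (k : ℕ) : Measurable (cumLoss σ κ₁ κ₂ θn x y k) := by
  refine Finset.measurable_fun_sum _ fun s _ => ?_
  by_cases h : s < T
  · simp only [h, dite_true]
    exact Measurable.lossVec hσ κ₁ κ₂ θn (((hx _).prodMk (measurable_pi_apply _)).prodMk (hy _))
  · simp only [h, dite_false]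
    exact measurable_const

lemma IsStrategy.cumLoss_congr (h : IsStrategy ρ x y) (t : Fin T) {ξ ξ' : Fin T → Noise d}
    (hξ : ∀ s, s < t → ξ s = ξ' s) :
    cumLoss σ κ₁ κ₂ θn x y t ξ = cumLoss σ κ₁ κ₂ θn x y t ξ' := by
  rw [← cumLoss_history, ← cumLoss_history, history_congr h t hξ]

lemma IsStrategy.abs_cumLoss_le (hσ : IsSmoothActivation σ) (h : IsStrategy ρ x y) (k : ℕ)
    (ξ : Fin T → Noise d) (i : Fin (N + 1)) :
    |cumLoss σ κ₁ κ₂ θn x y k ξ i| ≤ k * lossBound ρ κ₁ κ₂ := by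
  simp only [cumLoss, Finset.sum_apply]
  refine (Finset.abs_sum_le_sum_abs _ _).trans ?_
  refine (Finset.sum_le_sum fun s _ => ?_).trans_eq
    (b := ∑ _s ∈ Finset.range k, lossBound ρ κ₁ κ₂) (by simp)
  split_ifs with hs
  · exact abs_loss_le hσ κ₁ κ₂ (h.admissible _ ξ _) (θn i).2
  · simpa using lossBound_nonneg ρ κ₁ κ₂

lemma IsPotential.integrable_comp {ι Ω : Type*} [Fintype ι] [Nonempty ι] [MeasurableSpace Ω]
    {ν : Measure Ω} [IsFiniteMeasure ν] {Φ : (ι → ℝ) → ℝ} (hΦ : IsPotential Φ) {f : Ω → ι → ℝ}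
    (hf : Measurable f) {C : ℝ} (hC : ∀ ω i, |f ω i| ≤ C) : Integrable (fun ω => Φ (f ω)) ν := by
  refine integrable_of_bounded (C := |Φ 0| + C) (hΦ.continuous.measurable.comp hf) fun ω => ?_
  have h1 := hΦ.abs_sub_le (L := f ω) (L' := 0) (c := C) fun i => by simpa using hC ω i
  have h2 := abs_sub_abs_le_abs_sub (Φ (f ω)) (Φ 0)
  linarith

/-- The expected loss of the grid learner in one round. -/
noncomputable def gridCost (σ : ℝ → ℝ) (κ₁ κ₂ δ : ℝ) (θn : Fin (N + 1) → Theta m d)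
    (p : ℕ → (Fin (N + 1) → ℤ) → Fin (N + 1) → ℝ)
    (x : Fin T → (Fin T → Noise d) → Pair d) (y : Fin T → (Fin T → Noise d) → Fin 4 → ℝ)
    (t : Fin T) (ξ : Fin T → Noise d) : ℝ :=
  ∑ i, p t (cell δ (cumLoss σ κ₁ κ₂ θn x y t ξ)) i
    * lossVec σ κ₁ κ₂ θn ((x t ξ, ξ t), y t ξ) i

variable {δ : ℝ} {p : ℕ → (Fin (N + 1) → ℤ) → Fin (N + 1) → ℝ}

lemma IsStrategy.integrable_gridCost (hσ : IsSmoothActivation σ) (h : IsStrategy ρ x y)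
    (hp : ∀ t z, p t z ∈ stdSimplex ℝ (Fin (N + 1))) (t : Fin T) :
    Integrable (gridCost σ κ₁ κ₂ δ θn p x y t) (noiseLaw d T) := by
  have hm := measurable_cumLoss (κ₁ := κ₁) (κ₂ := κ₂) (θn := θn) hσ h.measurable_x h.measurable_y t
  have hl : Measurable fun ξ : Fin T → Noise d =>
      lossVec σ κ₁ κ₂ θn ((x t ξ, ξ t), y t ξ) :=
    Measurable.lossVec hσ κ₁ κ₂ θn
      (((h.measurable_x t).prodMk (measurable_pi_apply t)).prodMk (h.measurable_y t))
  have hpm : Measurable (p t) := measurable_of_countable _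
  refine integrable_of_bounded (C := lossBound ρ κ₁ κ₂) ?_ fun ξ => ?_
  · refine Finset.measurable_fun_sum _ fun i _ => Measurable.mul ?_ ?_
    · exact (measurable_pi_apply i).comp (hpm.comp ((measurable_cell δ).comp hm))
    · exact (measurable_pi_apply i).comp hl
  · refine (Finset.abs_sum_le_sum_abs _ _).trans ?_
    have hz := hp t (cell δ (cumLoss σ κ₁ κ₂ θn x y t ξ))
    calc _ ≤ ∑ i, p t (cell δ (cumLoss σ κ₁ κ₂ θn x y t ξ)) i * lossBound ρ κ₁ κ₂ := by
          refine Finset.sum_le_sum fun i _ => ?_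
          rw [abs_mul, abs_of_nonneg (hz.1 i)]
          exact mul_le_mul_of_nonneg_left
            (abs_loss_le hσ κ₁ κ₂ (h.admissible t ξ _) (θn i).2) (hz.1 i)
      _ = lossBound ρ κ₁ κ₂ := by rw [← Finset.sum_mul, hz.2, one_mul]

lemma IsStrategy.round_mem_moves (h : IsStrategy ρ x y) (t : Fin T) (ξ : Fin T → Noise d) :
    (fun w => lossVec σ κ₁ κ₂ θn ((x t ξ, w), y t (Function.update ξ t w)))
      ∈ moves ρ σ κ₁ κ₂ θn := by
  refine ⟨x t ξ, fun w => y t (Function.update ξ t w),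
    (h.measurable_y t).comp (measurable_update ξ), fun w => ?_, rfl⟩
  have := h.admissible t (Function.update ξ t w) w
  rwa [h.predictable_x t (Function.update ξ t w) ξ fun s hs =>
    Function.update_of_ne hs.ne _ _] at this

/-- In every round the potential pays for the loss of the learner. -/
lemma IsStrategy.gridCost_add_potential_le (hσ : IsSmoothActivation σ) (hρ : 0 ≤ ρ)
    (h : IsStrategy ρ x y) (hδ : 0 < δ) (hp : ∀ t z, p t z ∈ stdSimplex ℝ (Fin (N + 1)))
    (hbest : ∀ t : Fin T, ∀ z, ∀ g ∈ moves ρ σ κ₁ κ₂ θn,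
      ∑ i, p t z i * ∫ w, g w i ∂roundLaw d
        + ∫ w, potential (roundLaw d) (moves ρ σ κ₁ κ₂ θn) (T - (t + 1))
          (fun j => corner δ z j + g w j) ∂roundLaw d
        ≤ potential (roundLaw d) (moves ρ σ κ₁ κ₂ θn) (T - t) (corner δ z)) (t : Fin T) :
    ∫ ξ, gridCost σ κ₁ κ₂ δ θn p x y t ξ ∂noiseLaw d T
      + ∫ ξ, potential (roundLaw d) (moves ρ σ κ₁ κ₂ θn) (T - (t + 1))
        (cumLoss σ κ₁ κ₂ θn x y (t + 1) ξ) ∂noiseLaw d T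
      ≤ ∫ ξ, potential (roundLaw d) (moves ρ σ κ₁ κ₂ θn) (T - t)
        (cumLoss σ κ₁ κ₂ θn x y t ξ) ∂noiseLaw d T + 2 * δ := by
  have h𝒢 := isMoveClass_moves hσ hρ κ₁ κ₂ θn
  have hΦ := fun n => isPotential_potential (ν := roundLaw d) h𝒢 n
  set Φ := potential (roundLaw d) (moves ρ σ κ₁ κ₂ θn) (T - (t + 1)) with hΦdef
  set Ψ := potential (roundLaw d) (moves ρ σ κ₁ κ₂ θn) (T - t) with hΨdef
  have hΦ1 : IsPotential Φ := hΦ _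
  have hΨ1 : IsPotential Ψ := hΦ _
  have hcum := fun k => measurable_cumLoss (κ₁ := κ₁) (κ₂ := κ₂) (θn := θn) hσ h.measurable_x
    h.measurable_y k
  have hi1 := h.integrable_gridCost (κ₁ := κ₁) (κ₂ := κ₂) (θn := θn) (δ := δ) hσ hp t
  have hi2 : Integrable (fun ξ => Φ (cumLoss σ κ₁ κ₂ θn x y (t + 1) ξ)) (noiseLaw d T) :=
    hΦ1.integrable_comp (hcum _) fun ξ i => h.abs_cumLoss_le hσ _ ξ i
  have hi3 : Integrable (fun ξ => Ψ (cumLoss σ κ₁ κ₂ θn x y t ξ)) (noiseLaw d T) :=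
    hΨ1.integrable_comp (hcum _) fun ξ i => h.abs_cumLoss_le hσ _ ξ i
  have hF : Integrable (fun ξ => gridCost σ κ₁ κ₂ δ θn p x y t ξ
      + Φ (cumLoss σ κ₁ κ₂ θn x y (t + 1) ξ)) (noiseLaw d T) := hi1.add hi2
  rw [← integral_add hi1 hi2, integral_resample t hF]
  have e : ∫ ξ, Ψ (cumLoss σ κ₁ κ₂ θn x y t ξ) ∂noiseLaw d T + 2 * δ
      = ∫ ξ, (Ψ (cumLoss σ κ₁ κ₂ θn x y t ξ) + 2 * δ) ∂noiseLaw d T := by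
    rw [integral_add hi3 (integrable_const _)]; simp
  rw [e]
  refine integral_mono (integrable_resample t hF) (hi3.add (integrable_const _)) fun ξ => ?_
  set L := cumLoss σ κ₁ κ₂ θn x y t ξ with hL
  set z := cell δ L with hz
  set g : Noise d → Fin (N + 1) → ℝ :=
    fun w => lossVec σ κ₁ κ₂ θn ((x t ξ, w), y t (Function.update ξ t w)) with hg
  have hgm : g ∈ moves ρ σ κ₁ κ₂ θn := h.round_mem_moves t ξ
  have hupd : ∀ w s, s < t → Function.update ξ t w s = ξ s := fun w s hs =>
    Function.update_of_ne hs.ne _ _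
  have e1 : ∀ w, gridCost σ κ₁ κ₂ δ θn p x y t (Function.update ξ t w)
      + Φ (cumLoss σ κ₁ κ₂ θn x y (t + 1) (Function.update ξ t w))
      = ∑ i, p t z i * g w i + Φ (fun j => L j + g w j) := by
    intro w
    rw [cumLoss_succ, gridCost, h.cumLoss_congr t (hupd w), ← hL, ← hz,
      h.predictable_x t _ ξ (hupd w), Function.update_self]
    rfl
  simp only [e1]
  -- Moving from the state to the corner of its cell before the response, and back afterwards, costs
  -- `δ` each time.
  have hclose := fun i => abs_sub_corner_le hδ L i
  have j1 : ∀ i, Integrable (fun w => p t z i * g w i) (roundLaw d) := fun i =>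
    (integrable_move_apply h𝒢 hgm i).const_mul _
  have j2 : Integrable (fun w => Φ (fun j => L j + g w j)) (roundLaw d) := by
    simpa using hΦ1.integrable (ν := roundLaw d) h𝒢 hgm L 1
  have j3 : Integrable (fun w => Φ (fun j => corner δ z j + g w j)) (roundLaw d) := by
    simpa using hΦ1.integrable (ν := roundLaw d) h𝒢 hgm (corner δ z) 1
  have j4 : Integrable (fun w => ∑ i, p t z i * g w i) (roundLaw d) :=
    integrable_finsetSum _ fun i _ => j1 i
  rw [integral_add j4 j2, integral_finsetSum _ fun i _ => j1 i]
  simp only [integral_const_mul]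
  have k1 := hbest t z g hgm
  have k2 : ∫ w, Φ (fun j => L j + g w j) ∂roundLaw d
      ≤ ∫ w, Φ (fun j => corner δ z j + g w j) ∂roundLaw d + δ := by
    have := integral_mono j2 (j3.add (integrable_const δ)) fun w =>
      hΦ1.le_add (c := δ) fun i => by
        have := (abs_le.1 (hclose i)).1
        simp only [← hz] at this
        linarith
    simp only [Pi.add_apply] at this
    rwa [integral_add j3 (integrable_const δ), integral_const, probReal_univ, one_smul] at this
  have k3 : Ψ (corner δ z) ≤ Ψ L + δ := hΨ1.le_add fun i => by
    have := (abs_le.1 (hclose i)).2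
    simp only [← hz] at this
    linarith
  show _ ≤ Ψ L + 2 * δ
  linarith

/-- The regret of the grid learner is at most the potential of the game. -/
lemma IsStrategy.onlineRegret_gridLearner_le (hσ : IsSmoothActivation σ) (hρ : 0 ≤ ρ)
    (h : IsStrategy ρ x y) (hδ : 0 < δ) (hp : ∀ t z, p t z ∈ stdSimplex ℝ (Fin (N + 1)))
    (hbest : ∀ t : Fin T, ∀ z, ∀ g ∈ moves ρ σ κ₁ κ₂ θn,
      ∑ i, p t z i * ∫ w, g w i ∂roundLaw d
        + ∫ w, potential (roundLaw d) (moves ρ σ κ₁ κ₂ θn) (T - (t + 1))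
          (fun j => corner δ z j + g w j) ∂roundLaw d
        ≤ potential (roundLaw d) (moves ρ σ κ₁ κ₂ θn) (T - t) (corner δ z)) {η : ℝ}
    (hnet : ∀ θ : Theta m d, ∃ i, ∀ z : Data d, IsAdmissible ρ z →
      |loss σ κ₁ κ₂ z (θ : Param m d) - loss σ κ₁ κ₂ z (θn i : Param m d)|
        ≤ η * noiseSize z.1.2) :
    onlineRegret σ κ₁ κ₂ (gridLearner hσ κ₁ κ₂ δ θn p hp) x y
      ≤ potential (roundLaw d) (moves ρ σ κ₁ κ₂ θn) T 0
        + T * (2 * δ + η * ∫ w, noiseSize w ∂roundLaw d) := by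
  have h𝒢 := isMoveClass_moves hσ hρ κ₁ κ₂ θn
  have htel := sum_add_le_of_step (T := T)
    (c := fun t => ∫ ξ, gridCost σ κ₁ κ₂ δ θn p x y t ξ ∂noiseLaw d T)
    (ψ := fun k => ∫ ξ, potential (roundLaw d) (moves ρ σ κ₁ κ₂ θn) (T - k)
        (cumLoss σ κ₁ κ₂ θn x y k ξ) ∂noiseLaw d T)
    (h.gridCost_add_potential_le hσ hρ hδ hp hbest)
  simp only [Nat.sub_self, Nat.sub_zero, cumLoss_zero, integral_const, probReal_univ,
    one_smul] at htel
  have hcost : ∀ (t : Fin T) ξ, ∫ θ : Theta m d, loss σ κ₁ κ₂ ((x t ξ, ξ t), y t ξ) (θ : Param m d)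
      ∂((gridLearner hσ κ₁ κ₂ δ θn p hp).dist t (history x y ξ t))
      = gridCost σ κ₁ κ₂ δ θn p x y t ξ := by
    intro t ξ
    rw [gridLearner_dist, integral_mixture θn (hp _ _), cumLoss_history]
    rfl
  have i1 := fun t => h.integrable_gridCost (κ₁ := κ₁) (κ₂ := κ₂) (θn := θn) (δ := δ) hσ hp t
  have i2 : Integrable (fun ξ => potential (roundLaw d) (moves ρ σ κ₁ κ₂ θn) 0
      (cumLoss σ κ₁ κ₂ θn x y T ξ)) (noiseLaw d T) :=
    (isPotential_potential h𝒢 0).integrable_comp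
      (measurable_cumLoss hσ h.measurable_x h.measurable_y T)
      fun ξ i => h.abs_cumLoss_le hσ _ ξ i
  have i3 : ∀ t : Fin T, Integrable (fun ξ : Fin T → Noise d => η * noiseSize (ξ t))
      (noiseLaw d T) := fun t =>
    ((measurePreserving_noise t).integrable_comp_of_integrable integrable_noiseSize).const_mul η
  have hz : Measurable fun (ξ : Fin T → Noise d) (t : Fin T) =>
      (((x t ξ, ξ t), y t ξ) : Data d) :=
    measurable_pi_iff.2 fun t =>
      ((h.measurable_x t).prodMk (measurable_pi_apply t)).prodMk (h.measurable_y t)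
  have hbdd : ∀ ξ : Fin T → Noise d, BddBelow (Set.range fun θ : Theta m d =>
      ∑ t : Fin T, loss σ κ₁ κ₂ ((x t ξ, ξ t), y t ξ) (θ : Param m d)) := fun ξ =>
    ⟨0, by rintro _ ⟨θ, rfl⟩; exact Finset.sum_nonneg fun _ _ => loss_nonneg _ _ _ _⟩
  have i4 : Integrable (fun ξ : Fin T → Noise d => ⨅ θ : Theta m d, ∑ t : Fin T,
      loss σ κ₁ κ₂ ((x t ξ, ξ t), y t ξ) (θ : Param m d)) (noiseLaw d T) := by
    refine integrable_of_bounded ((measurable_iInf_sum_loss hσ κ₁ κ₂).comp hz)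
      (C := T * lossBound ρ κ₁ κ₂) fun ξ => ?_
    rw [abs_of_nonneg (iInf_loss_sum_nonneg _ _ _)]
    refine (ciInf_le (hbdd ξ) (θn 0)).trans ?_
    refine (Finset.sum_le_sum fun t _ => ?_).trans_eq (b := ∑ _t : Fin T, lossBound ρ κ₁ κ₂)
      (by simp)
    exact loss_le hσ κ₁ κ₂ (h.admissible t ξ _) (θn 0).2
  -- The comparator over all of Θ is replaced by one in the net, at a price proportional to the size
  -- of the noise.
  have hpoint : ∀ ξ : Fin T → Noise d, -(⨅ θ : Theta m d, ∑ t : Fin T,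
      loss σ κ₁ κ₂ ((x t ξ, ξ t), y t ξ) (θ : Param m d))
      ≤ potential (roundLaw d) (moves ρ σ κ₁ κ₂ θn) 0 (cumLoss σ κ₁ κ₂ θn x y T ξ)
        + ∑ t, η * noiseSize (ξ t) := by
    intro ξ
    rw [neg_le]
    refine le_ciInf fun θ => ?_
    obtain ⟨i, hi⟩ := hnet θ
    have h1 : -cumLoss σ κ₁ κ₂ θn x y T ξ i
        ≤ potential (roundLaw d) (moves ρ σ κ₁ κ₂ θn) 0 (cumLoss σ κ₁ κ₂ θn x y T ξ) :=
      le_ciSup (f := fun i => -cumLoss σ κ₁ κ₂ θn x y T ξ i) (Set.finite_range _).bddAbove i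
    rw [cumLoss_last] at h1
    have h2 := Finset.sum_le_sum fun t (_ : t ∈ Finset.univ) =>
      (abs_le.1 (hi ((x t ξ, ξ t), y t ξ) (h.admissible t ξ _))).1
    simp only [Finset.sum_neg_distrib, Finset.sum_sub_distrib] at h2
    linarith
  unfold onlineRegret
  simp only [hcost]
  have i5 : Integrable (fun ξ => ∑ t, gridCost σ κ₁ κ₂ δ θn p x y t ξ) (noiseLaw d T) :=
    integrable_finsetSum _ fun t _ => i1 t
  have i6 : Integrable (fun ξ : Fin T → Noise d => ∑ t, η * noiseSize (ξ t)) (noiseLaw d T) :=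
    integrable_finsetSum _ fun t _ => i3 t
  rw [integral_sub i5 i4, integral_finsetSum _ fun t _ => i1 t]
  have k1 := integral_mono i4.neg (i2.add i6) hpoint
  simp only [Pi.neg_apply, Pi.add_apply] at k1
  rw [integral_neg, integral_add i2 i6, integral_finsetSum _ fun t _ => i3 t] at k1
  have k2 : ∀ t : Fin T, ∫ ξ : Fin T → Noise d, η * noiseSize (ξ t) ∂noiseLaw d T
      = η * ∫ w, noiseSize w ∂roundLaw d := by
    intro t
    have hmap : (noiseLaw d T).map (fun ξ : Fin T → Noise d => ξ t) = roundLaw d :=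
      (measurePreserving_noise t).map_eq
    rw [integral_const_mul, ← hmap, integral_map (measurable_pi_apply t).aemeasurable]
    rw [hmap]
    exact integrable_noiseSize.aestronglyMeasurable
  simp only [k2, Finset.sum_const, Finset.card_univ, Fintype.card_fin, nsmul_eq_mul] at k1
  rw [mul_add]
  linarith

end strategy

end ViOlin

namespace ViOlin

variable {m d T N : ℕ} {σ : ℝ → ℝ}

/-! ### Processes that are driven by noise -/

/-- The state before round `k` of a process that is updated by the noise of each round. -/
def driven {S Ω : Type*} (step : Fin T → S → Ω → S) (s₀ : S) : ℕ → (Fin T → Ω) → S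
  | 0, _ => s₀
  | k + 1, ξ => if h : k < T then step ⟨k, h⟩ (driven step s₀ k ξ) (ξ ⟨k, h⟩)
      else driven step s₀ k ξ

lemma driven_succ {S Ω : Type*} (step : Fin T → S → Ω → S) (s₀ : S) (t : Fin T) (ξ : Fin T → Ω) :
    driven step s₀ (t + 1) ξ = step t (driven step s₀ t ξ) (ξ t) := by
  simp [driven]

lemma driven_congr {S Ω : Type*} {step step' : Fin T → S → Ω → S} (s₀ : S) {k : ℕ}
    {ξ ξ' : Fin T → Ω} (h : ∀ s : Fin T, (s : ℕ) < k → step s = step' s ∧ ξ s = ξ' s) :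
    driven step s₀ k ξ = driven step' s₀ k ξ' := by
  induction k with
  | zero => rfl
  | succ k ih =>
    have h1 := ih fun s hs => h s (hs.trans (Nat.lt_succ_self k))
    simp only [driven]
    split_ifs with hk
    · obtain ⟨h2, h3⟩ := h ⟨k, hk⟩ (Nat.lt_succ_self k)
      rw [h1, h2, h3]
    · exact h1

lemma measurable_driven {S Ω : Type*} [MeasurableSpace S] [MeasurableSpace Ω]
    {step : Fin T → S → Ω → S} (hstep : ∀ t, Measurable fun p : S × Ω => step t p.1 p.2) (s₀ : S)
    (k : ℕ) : Measurable (driven step s₀ k) := by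
  induction k with
  | zero => exact measurable_const
  | succ k ih =>
    simp only [driven]
    split_ifs with hk
    · exact (hstep ⟨k, hk⟩).comp (ih.prodMk (measurable_pi_apply _))
    · exact ih

/-! ### The potential is bounded by the sequential Rademacher complexity -/

/-- Each sign sequence is paired with the one flipped in round `t`. Since the state before that
round ignores this sign, the pair produces the two terms of `symValue`. -/
lemma signAvg_flip (t : Fin T) (g : (Fin T → ℤˣ) → ℝ) :
    signAvg g = signAvg fun ε => 1 / 2 * (g ε + g (Function.update ε t (-ε t))) := by
  have hinv : Function.Involutive fun ε : Fin T → ℤˣ => Function.update ε t (-ε t) := by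
    intro ε; simp
  have h : ∑ ε, g (Function.update ε t (-ε t)) = ∑ ε, g ε :=
    Equiv.sum_comp hinv.toPerm g
  unfold signAvg
  rw [← Finset.mul_sum, Finset.sum_add_distrib, h]
  ring

lemma symValue_le_add {Ω ι : Type*} [MeasurableSpace Ω] [Fintype ι] [Nonempty ι] {ν : Measure Ω}
    [IsProbabilityMeasure ν] {𝒢 : Set (Ω → ι → ℝ)} {B : ℝ} {Φ : (ι → ℝ) → ℝ} (h : IsPotential Φ)
    (h𝒢 : IsMoveClass 𝒢 B) {g : Ω → ι → ℝ} (hg : g ∈ 𝒢) {L L' : ι → ℝ} {c : ℝ}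
    (hc : ∀ i, L' i - c ≤ L i) : symValue ν Φ g L ≤ symValue ν Φ g L' + c := by
  have i1 := h.integrable_sym (ν := ν) h𝒢 hg L
  have i2 := h.integrable_sym (ν := ν) h𝒢 hg L'
  have e : symValue ν Φ g L' + c = ∫ ω, (1 / 2 * (Φ (fun i => L' i + 2 * g ω i)
      + Φ (fun i => L' i - 2 * g ω i)) + c) ∂ν := by
    rw [integral_add i2 (integrable_const c)]; simp [symValue]
  rw [e]
  refine integral_mono i1 (i2.add (integrable_const c)) fun ω => ?_
  have h1 := h.le_add (L := fun i => L i + 2 * g ω i) (L' := fun i => L' i + 2 * g ω i) (c := c)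
    fun i => by linarith [hc i]
  have h2 := h.le_add (L := fun i => L i - 2 * g ω i) (L' := fun i => L' i - 2 * g ω i) (c := c)
    fun i => by linarith [hc i]
  simp only
  linarith

section tree

variable {ρ κ₁ κ₂ δ : ℝ} {θn : Fin (N + 1) → Theta m d}
  {X : ℕ → (Fin (N + 1) → ℤ) → Pair d} {Y : ℕ → (Fin (N + 1) → ℤ) → Noise d → Fin 4 → ℝ}

/-- The state of the symmetrized game in which nature chooses its moves according to the cell of the
state. -/
noncomputable def treeState (σ : ℝ → ℝ) (κ₁ κ₂ δ : ℝ) (θn : Fin (N + 1) → Theta m d)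
    (X : ℕ → (Fin (N + 1) → ℤ) → Pair d) (Y : ℕ → (Fin (N + 1) → ℤ) → Noise d → Fin 4 → ℝ)
    (ε : Fin T → ℤˣ) : ℕ → (Fin T → Noise d) → Fin (N + 1) → ℝ :=
  driven (fun t L w i => L i - 2 * (sg (ε t)
    * lossVec σ κ₁ κ₂ θn ((X t (cell δ L), w), Y t (cell δ L) w) i)) 0

/-- The actions of nature in the symmetrized game. -/
noncomputable def treeAction (σ : ℝ → ℝ) (κ₁ κ₂ δ : ℝ) (θn : Fin (N + 1) → Theta m d)
    (X : ℕ → (Fin (N + 1) → ℤ) → Pair d) (Y : ℕ → (Fin (N + 1) → ℤ) → Noise d → Fin 4 → ℝ)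
    (t : Fin T) (ε : Fin T → ℤˣ) (ξ : Fin T → Noise d) : Pair d :=
  X t (cell δ (treeState σ κ₁ κ₂ δ θn X Y ε t ξ))

/-- The labels of nature in the symmetrized game. -/
noncomputable def treeLabel (σ : ℝ → ℝ) (κ₁ κ₂ δ : ℝ) (θn : Fin (N + 1) → Theta m d)
    (X : ℕ → (Fin (N + 1) → ℤ) → Pair d) (Y : ℕ → (Fin (N + 1) → ℤ) → Noise d → Fin 4 → ℝ)
    (t : Fin T) (ε : Fin T → ℤˣ) (ξ : Fin T → Noise d) : Fin 4 → ℝ :=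
  Y t (cell δ (treeState σ κ₁ κ₂ δ θn X Y ε t ξ)) (ξ t)

lemma measurable_uncurry_label (hY : ∀ k z, Measurable (Y k z)) (k : ℕ) :
    Measurable fun p : (Fin (N + 1) → ℤ) × Noise d => Y k p.1 p.2 :=
  measurable_from_prod_countable_right fun z => hY k z

lemma measurable_treeState (hσ : IsSmoothActivation σ) (hY : ∀ k z, Measurable (Y k z))
    (ε : Fin T → ℤˣ) (k : ℕ) : Measurable (treeState σ κ₁ κ₂ δ θn X Y ε k) := by
  refine measurable_driven (fun t => ?_) _ k
  have hX : Measurable (X t) := measurable_of_countable _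
  have hc : Measurable fun p : (Fin (N + 1) → ℝ) × Noise d => cell δ p.1 :=
    (measurable_cell δ).comp measurable_fst
  have hl : Measurable fun p : (Fin (N + 1) → ℝ) × Noise d =>
      lossVec σ κ₁ κ₂ θn ((X t (cell δ p.1), p.2), Y t (cell δ p.1) p.2) :=
    Measurable.lossVec hσ κ₁ κ₂ θn (((hX.comp hc).prodMk measurable_snd).prodMk
      ((measurable_uncurry_label hY t).comp (hc.prodMk measurable_snd)))
  exact measurable_pi_iff.2 fun i => ((measurable_pi_apply i).comp measurable_fst).sub
    ((((measurable_pi_apply i).comp hl).const_mul _).const_mul _)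

lemma treeState_congr (t : Fin T) {ε ε' : Fin T → ℤˣ} {ξ ξ' : Fin T → Noise d}
    (hε : ∀ s, s < t → ε s = ε' s) (hξ : ∀ s, s < t → ξ s = ξ' s) :
    treeState σ κ₁ κ₂ δ θn X Y ε t ξ = treeState σ κ₁ κ₂ δ θn X Y ε' t ξ' :=
  driven_congr _ fun s hs => ⟨by rw [hε s hs], hξ s hs⟩

lemma treeState_succ (t : Fin T) (ε : Fin T → ℤˣ) (ξ : Fin T → Noise d) (i : Fin (N + 1)) :
    treeState σ κ₁ κ₂ δ θn X Y ε (t + 1) ξ i = treeState σ κ₁ κ₂ δ θn X Y ε t ξ i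
      - 2 * (sg (ε t) * loss σ κ₁ κ₂ ((treeAction σ κ₁ κ₂ δ θn X Y t ε ξ, ξ t),
        treeLabel σ κ₁ κ₂ δ θn X Y t ε ξ) (θn i : Param m d)) := by
  rw [treeState, driven_succ]
  rfl

lemma treeState_last (ε : Fin T → ℤˣ) (ξ : Fin T → Noise d) (i : Fin (N + 1)) :
    treeState σ κ₁ κ₂ δ θn X Y ε T ξ i = -(2 * ∑ t, sg (ε t) * loss σ κ₁ κ₂
      ((treeAction σ κ₁ κ₂ δ θn X Y t ε ξ, ξ t),
        treeLabel σ κ₁ κ₂ δ θn X Y t ε ξ) (θn i : Param m d)) := by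
  have h1 := sum_add_le_of_step (T := T) (e := 0)
    (c := fun t => 2 * (sg (ε t) * loss σ κ₁ κ₂ ((treeAction σ κ₁ κ₂ δ θn X Y t ε ξ, ξ t),
        treeLabel σ κ₁ κ₂ δ θn X Y t ε ξ) (θn i : Param m d)))
    (ψ := fun k => treeState σ κ₁ κ₂ δ θn X Y ε k ξ i)
    fun t => by simp only [treeState_succ]; linarith
  have h2 := sum_add_le_of_step (T := T) (e := 0)
    (c := fun t => -(2 * (sg (ε t) * loss σ κ₁ κ₂ ((treeAction σ κ₁ κ₂ δ θn X Y t ε ξ, ξ t),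
        treeLabel σ κ₁ κ₂ δ θn X Y t ε ξ) (θn i : Param m d))))
    (ψ := fun k => -treeState σ κ₁ κ₂ δ θn X Y ε k ξ i)
    fun t => by simp only [treeState_succ]; linarith
  have h0 : treeState σ κ₁ κ₂ δ θn X Y ε 0 ξ i = 0 := rfl
  simp only [h0, Finset.sum_neg_distrib, ← Finset.mul_sum] at h1 h2
  linarith

/-- Nature's choices depend on the state through its cell only, so measurability is automatic; the
state before a round involves only earlier signs and earlier noise. -/
lemma isTree_tree (hσ : IsSmoothActivation σ) (hY : ∀ k z, Measurable (Y k z))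
    (hadm : ∀ k z w, IsAdmissible ρ ((X k z, w), Y k z w)) :
    IsTree (T := T) ρ (treeAction σ κ₁ κ₂ δ θn X Y) (treeLabel σ κ₁ κ₂ δ θn X Y) := by
  refine ⟨fun ε => ⟨fun t => ?_, fun t => ?_, fun t ξ ξ' h => ?_, fun t ξ ξ' h => ?_,
    fun t ξ => ?_, fun t ξ => ?_⟩, fun t ε ε' h => ⟨?_, ?_⟩⟩
  · have hX : Measurable (X t) := measurable_of_countable _
    exact hX.comp ((measurable_cell δ).comp (measurable_treeState hσ hY ε t))
  · exact (measurable_uncurry_label hY t).comp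
      (((measurable_cell δ).comp (measurable_treeState hσ hY ε t)).prodMk (measurable_pi_apply t))
  · simp only [treeAction, treeState_congr t (fun _ _ => rfl) h]
  · simp only [treeLabel, treeState_congr t (fun _ _ => rfl) fun s hs => h s hs.le, h t le_rfl]
  · exact ⟨(hadm _ _ 0).fst, (hadm _ _ 0).snd⟩
  · exact ⟨(hadm _ _ _).label₀, (hadm _ _ _).label₁⟩
  · ext1 ξ; simp only [treeAction, treeState_congr t h fun _ _ => rfl]
  · ext1 ξ; simp only [treeLabel, treeState_congr t h fun _ _ => rfl]

lemma abs_treeState_le (hσ : IsSmoothActivation σ)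
    (hadm : ∀ k z w, IsAdmissible ρ ((X k z, w), Y k z w)) (ε : Fin T → ℤˣ) (k : ℕ)
    (ξ : Fin T → Noise d) (i : Fin (N + 1)) :
    |treeState σ κ₁ κ₂ δ θn X Y ε k ξ i| ≤ k * (2 * lossBound ρ κ₁ κ₂) := by
  induction k with
  | zero => simp [treeState, driven]
  | succ k ih =>
    by_cases hk : k < T
    · have h1 := treeState_succ (σ := σ) (κ₁ := κ₁) (κ₂ := κ₂) (δ := δ) (θn := θn) (X := X) (Y := Y)
        ⟨k, hk⟩ ε ξ i
      simp only at h1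
      rw [h1]
      refine (abs_sub _ _).trans ?_
      rw [abs_mul, abs_mul, abs_sg, one_mul, abs_two]
      have h2 := abs_loss_le hσ κ₁ κ₂ (hadm k (cell δ (treeState σ κ₁ κ₂ δ θn X Y ε k ξ))
        (ξ ⟨k, hk⟩)) (θn i).2
      simp only [treeAction, treeLabel]
      push_cast
      linarith
    · have h1 : treeState σ κ₁ κ₂ δ θn X Y ε (k + 1) ξ = treeState σ κ₁ κ₂ δ θn X Y ε k ξ := by
        simp [treeState, driven, hk]
      rw [h1]
      refine ih.trans ?_
      have := lossBound_nonneg ρ κ₁ κ₂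
      push_cast
      nlinarith

/-- In every round of the symmetrized game the mean potential hardly decreases. -/
lemma treeState_step (hσ : IsSmoothActivation σ) (hρ : 0 ≤ ρ) (hδ : 0 < δ)
    (hY : ∀ k z, Measurable (Y k z)) (hadm : ∀ k z w, IsAdmissible ρ ((X k z, w), Y k z w))
    (hopt : ∀ (t : Fin T) z, potential (roundLaw d) (moves ρ σ κ₁ κ₂ θn) (T - t) (corner δ z) - δ
      ≤ symValue (roundLaw d) (potential (roundLaw d) (moves ρ σ κ₁ κ₂ θn) (T - (t + 1)))
        (fun w => lossVec σ κ₁ κ₂ θn ((X t z, w), Y t z w)) (corner δ z)) (t : Fin T) :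
    signAvg (fun ε : Fin T → ℤˣ => ∫ ξ, potential (roundLaw d) (moves ρ σ κ₁ κ₂ θn) (T - t)
      (treeState σ κ₁ κ₂ δ θn X Y ε t ξ) ∂noiseLaw d T)
    ≤ signAvg (fun ε : Fin T → ℤˣ => ∫ ξ, potential (roundLaw d) (moves ρ σ κ₁ κ₂ θn) (T - (t + 1))
      (treeState σ κ₁ κ₂ δ θn X Y ε (t + 1) ξ) ∂noiseLaw d T) + 3 * δ := by
  have h𝒢 := isMoveClass_moves hσ hρ κ₁ κ₂ θn
  have hΦ := fun n => isPotential_potential (ν := roundLaw d) h𝒢 n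
  set Φ := potential (roundLaw d) (moves ρ σ κ₁ κ₂ θn) (T - (t + 1)) with hΦdef
  set Ψ := potential (roundLaw d) (moves ρ σ κ₁ κ₂ θn) (T - t) with hΨdef
  have hΦ1 : IsPotential Φ := hΦ _
  have hΨ1 : IsPotential Ψ := hΦ _
  have hint : ∀ {Θ}, IsPotential Θ → ∀ k (ε : Fin T → ℤˣ), Integrable
      (fun ξ => Θ (treeState σ κ₁ κ₂ δ θn X Y ε k ξ)) (noiseLaw d T) := fun hΘ k ε =>
    hΘ.integrable_comp (measurable_treeState hσ hY ε k) fun ξ i => abs_treeState_le hσ hadm ε k ξ i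
  rw [signAvg_flip t fun ε : Fin T → ℤˣ => ∫ ξ, Φ (treeState σ κ₁ κ₂ δ θn X Y ε (t + 1) ξ)
    ∂noiseLaw d T, ← signAvg_const T (3 * δ), ← signAvg_add]
  refine signAvg_mono fun ε => ?_
  set ε' := Function.update ε t (-ε t) with hε'
  have i1 := hint hΦ1 (t + 1) ε
  have i2 := hint hΦ1 (t + 1) ε'
  have i3 := hint hΨ1 t ε
  have i4 : Integrable (fun ξ => 1 / 2 * (Φ (treeState σ κ₁ κ₂ δ θn X Y ε (t + 1) ξ)
      + Φ (treeState σ κ₁ κ₂ δ θn X Y ε' (t + 1) ξ))) (noiseLaw d T) := (i1.add i2).const_mul _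
  rw [← integral_add i1 i2, ← integral_const_mul, integral_resample t i4, ← sub_le_iff_le_add]
  have e : ∫ ξ, Ψ (treeState σ κ₁ κ₂ δ θn X Y ε t ξ) ∂noiseLaw d T - 3 * δ
      = ∫ ξ, (Ψ (treeState σ κ₁ κ₂ δ θn X Y ε t ξ) - 3 * δ) ∂noiseLaw d T := by
    rw [integral_sub i3 (integrable_const _)]; simp
  rw [e]
  refine integral_mono (i3.sub (integrable_const _)) (integrable_resample t i4) fun ξ => ?_
  set L := treeState σ κ₁ κ₂ δ θn X Y ε t ξ with hL
  set z := cell δ L with hz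
  set g : Noise d → Fin (N + 1) → ℝ := fun w => lossVec σ κ₁ κ₂ θn ((X t z, w), Y t z w) with hg
  have hgm : g ∈ moves ρ σ κ₁ κ₂ θn := ⟨X t z, Y t z, hY _ _, hadm _ _, rfl⟩
  have hupd : ∀ w s, s < t → Function.update ξ t w s = ξ s := fun w s hs =>
    Function.update_of_ne hs.ne _ _
  have hupd' : ∀ s, s < t → ε' s = ε s := fun s hs => Function.update_of_ne hs.ne _ _
  have e1 : ∀ w, treeState σ κ₁ κ₂ δ θn X Y ε (t + 1) (Function.update ξ t w)
      = fun i => L i - 2 * (sg (ε t) * g w i) := by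
    intro w
    ext i
    rw [treeState_succ]
    simp only [treeAction, treeLabel]
    rw [treeState_congr t (fun _ _ => rfl) (hupd w), Function.update_self]
    rfl
  have e2 : ∀ w, treeState σ κ₁ κ₂ δ θn X Y ε' (t + 1) (Function.update ξ t w)
      = fun i => L i + 2 * (sg (ε t) * g w i) := by
    intro w
    ext i
    rw [treeState_succ]
    simp only [treeAction, treeLabel]
    rw [treeState_congr t hupd' (hupd w), Function.update_self, hε', Function.update_self]
    simp only [sg, Units.val_neg, Int.cast_neg, neg_mul, mul_neg, sub_neg_eq_add]
    rfl
  have e3 : ∀ w, 1 / 2 * (Φ (treeState σ κ₁ κ₂ δ θn X Y ε (t + 1) (Function.update ξ t w))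
      + Φ (treeState σ κ₁ κ₂ δ θn X Y ε' (t + 1) (Function.update ξ t w)))
      = 1 / 2 * (Φ (fun i => L i + 2 * g w i) + Φ (fun i => L i - 2 * g w i)) := by
    intro w
    rw [e1, e2]
    rcases Int.units_eq_one_or (ε t) with h | h
    · simp only [h, sg, Units.val_one, Int.cast_one, one_mul]
      ring
    · simp only [h, sg, Units.val_neg, Units.val_one, Int.cast_neg, Int.cast_one, neg_mul, one_mul,
        mul_neg, sub_neg_eq_add, ← sub_eq_add_neg]
  simp only [e3]
  -- The loss `3 * δ` consists of `δ` for near optimality of the move and `δ` for each of two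
  -- passages between the state and its corner.
  have hclose := fun i => abs_sub_corner_le hδ L i
  have k1 := hopt t z
  have k2 : symValue (roundLaw d) Φ g (corner δ z) ≤ symValue (roundLaw d) Φ g L + δ :=
    symValue_le_add hΦ1 h𝒢 hgm fun i => by
      have := (abs_le.1 (hclose i)).2
      simp only [← hz] at this
      linarith
  have k3 : Ψ L ≤ Ψ (corner δ z) + δ := hΨ1.le_add fun i => by
    have := (abs_le.1 (hclose i)).1
    simp only [← hz] at this
    linarith
  show Ψ L - 3 * δ ≤ symValue (roundLaw d) Φ g L
  linarith

end tree

/-- The value of the game is at most twice the sequential Rademacher complexity. -/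
lemma potential_le_seqRademacher (hσ : IsSmoothActivation σ) {ρ : ℝ} (hρ : 0 ≤ ρ) (κ₁ κ₂ : ℝ)
    (θn : Fin (N + 1) → Theta m d) (T : ℕ) {δ : ℝ} (hδ : 0 < δ) :
    potential (roundLaw d) (moves ρ σ κ₁ κ₂ θn) T 0
      ≤ 2 * seqRademacher m d T ρ σ κ₁ κ₂ + T * (3 * δ) := by
  have h𝒢 := isMoveClass_moves hσ hρ κ₁ κ₂ θn
  -- Writing the horizon as `T - (k + 1) + 1` lets the recursion unfold for every natural `k`, in
  -- spite of truncated subtraction; only `k < T` is used.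
  have hex : ∀ (k : ℕ) (z : Fin (N + 1) → ℤ), ∃ (x : Pair d) (y : Noise d → Fin 4 → ℝ),
      Measurable y ∧ (∀ w, IsAdmissible ρ ((x, w), y w)) ∧
      potential (roundLaw d) (moves ρ σ κ₁ κ₂ θn) (T - (k + 1) + 1) (corner δ z) - δ
      ≤ symValue (roundLaw d) (potential (roundLaw d) (moves ρ σ κ₁ κ₂ θn) (T - (k + 1)))
        (fun w => lossVec σ κ₁ κ₂ θn ((x, w), y w)) (corner δ z) := by
    intro k z
    obtain ⟨g, ⟨x, y, hy, hadm, rfl⟩, hopt⟩ := exists_symValue_ge (ν := roundLaw d)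
      (Φ := potential (roundLaw d) (moves ρ σ κ₁ κ₂ θn) (T - (k + 1))) h𝒢 (corner δ z) hδ
    exact ⟨x, y, hy, hadm, hopt⟩
  choose X Y hY hadm hopt using hex
  have hopt' : ∀ (t : Fin T) z,
      potential (roundLaw d) (moves ρ σ κ₁ κ₂ θn) (T - t) (corner δ z) - δ
      ≤ symValue (roundLaw d) (potential (roundLaw d) (moves ρ σ κ₁ κ₂ θn) (T - (t + 1)))
        (fun w => lossVec σ κ₁ κ₂ θn ((X t z, w), Y t z w)) (corner δ z) := by
    intro t z
    have := hopt t z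
    rwa [show T - ((t : ℕ) + 1) + 1 = T - t by omega] at this
  have htree := isTree_tree (T := T) (κ₁ := κ₁) (κ₂ := κ₂) (δ := δ) (θn := θn) hσ hY hadm
  have hstep := sum_add_le_of_step (T := T) (c := fun _ => 0) (e := 3 * δ)
    (ψ := fun k => -signAvg (fun ε : Fin T → ℤˣ => ∫ ξ,
      potential (roundLaw d) (moves ρ σ κ₁ κ₂ θn) (T - k)
      (treeState σ κ₁ κ₂ δ θn X Y ε k ξ) ∂noiseLaw d T)) fun t => by
        have := treeState_step hσ hρ hδ hY hadm hopt' t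
        linarith
  have h0 : ∀ (ε : Fin T → ℤˣ) ξ, treeState σ κ₁ κ₂ δ θn X Y ε 0 ξ = 0 := fun _ _ => rfl
  simp only [Finset.sum_const_zero, h0, Nat.sub_zero, Nat.sub_self, integral_const, probReal_univ,
    one_smul, signAvg_const] at hstep
  -- The final potential is a maximum over the net of twice the signed sum of losses, hence at most
  -- twice the supremum over Θ.
  have hlast : signAvg (fun ε : Fin T → ℤˣ => ∫ ξ,
      potential (roundLaw d) (moves ρ σ κ₁ κ₂ θn) 0
      (treeState σ κ₁ κ₂ δ θn X Y ε T ξ) ∂noiseLaw d T)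
      ≤ 2 * treeComplexity m σ κ₁ κ₂ (treeAction (T := T) σ κ₁ κ₂ δ θn X Y)
        (treeLabel σ κ₁ κ₂ δ θn X Y) := by
    rw [htree.treeComplexity_eq hσ, ← signAvg_const_mul]
    refine signAvg_mono fun ε => ?_
    rw [← integral_const_mul]
    refine integral_mono ((isPotential_potential h𝒢 0).integrable_comp
      (measurable_treeState hσ hY ε T) fun ξ i => abs_treeState_le hσ hadm ε T ξ i)
      ((htree.integrable hσ κ₁ κ₂ ε).const_mul 2) fun ξ => ?_
    refine ciSup_le fun i => ?_
    rw [treeState_last, neg_neg]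
    refine mul_le_mul_of_nonneg_left ?_ zero_le_two
    exact le_ciSup (bddAbove_sum_loss hσ κ₁ κ₂ _ _) (θn i)
  have := htree.treeComplexity_le (m := m) hσ κ₁ κ₂
  linarith

end ViOlin

namespace ViOlin

variable {m d T N : ℕ} {σ : ℝ → ℝ}

/-! ### Runs with the grid learner -/

/-- For a mixture of finitely many parameters the mean reward is a finite sum, hence continuous, and
the regularizer confines its maximum to a ball. -/
lemma exists_argmax_mixture (hσ : IsSmoothActivation σ) (θn : Fin (N + 1) → Theta m d)
    {p : Fin (N + 1) → ℝ} (hp : p ∈ stdSimplex ℝ (Fin (N + 1))) :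
    ∃ b : Act d, ∀ b', ∫ θ : Theta m d, reward σ (θ : Param m d) b' ∂mixture θn p
      ≤ ∫ θ : Theta m d, reward σ (θ : Param m d) b ∂mixture θn p := by
  have := isProbabilityMeasure_mixture θn hp
  have hcont : Continuous fun b : Act d =>
      ∫ θ : Theta m d, reward σ (θ : Param m d) b ∂mixture θn p := by
    simp only [integral_mixture θn hp]
    refine continuous_finsetSum _ fun i _ => continuous_const.mul ?_
    exact (continuous_reward hσ).comp
      (by fun_prop : Continuous fun b : Act d => ((θn i : Param m d), b))
  have hle : ∀ b : Act d, ∫ θ : Theta m d, reward σ (θ : Param m d) b ∂mixture θn p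
      ≤ 1 - ‖b‖ ^ 2 / 2 := fun b => by
    have := integral_mono (integrable_reward hσ b (mixture θn p))
      (integrable_const (1 - ‖b‖ ^ 2 / 2)) fun θ => reward_le hσ θ.2 b
    simpa using this
  have hge : -1 ≤ ∫ θ : Theta m d, reward σ (θ : Param m d) 0 ∂mixture θn p := by
    have := integral_mono (integrable_const (-1)) (integrable_reward hσ (0 : Act d) (mixture θn p))
      fun θ => by simpa using le_reward hσ θ.2 (0 : Act d)
    simpa using this
  obtain ⟨b, -, hb⟩ := exists_argmax hcont hle hge
  exact ⟨b, hb⟩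

section run

variable {κ₁ κ₂ δ : ℝ} {θn : Fin (N + 1) → Theta m d} {A : ℕ → (Fin (N + 1) → ℤ) → Act d}
  {θs : Param m d} {a₀ : Act d}

/-- The action and the cumulative losses during a run with the grid learner. -/
noncomputable def runState (σ : ℝ → ℝ) (κ₁ κ₂ δ : ℝ) (θn : Fin (N + 1) → Theta m d)
    (A : ℕ → (Fin (N + 1) → ℤ) → Act d) (θs : Param m d) (a₀ : Act d) :
    ℕ → (Fin T → Noise d) → Act d × (Fin (N + 1) → ℝ) :=
  driven (fun t s w => (A t (cell δ s.2), s.2 + lossVec σ κ₁ κ₂ θn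
    (((A t (cell δ s.2), s.1), w), predict σ θs ((A t (cell δ s.2), s.1), w)))) (a₀, 0)

/-- The actions of a run with the grid learner. -/
noncomputable def runAction (σ : ℝ → ℝ) (κ₁ κ₂ δ : ℝ) (θn : Fin (N + 1) → Theta m d)
    (A : ℕ → (Fin (N + 1) → ℤ) → Act d) (θs : Param m d) (a₀ : Act d) (t : Fin (T + 1))
    (ξ : Fin T → Noise d) : Act d :=
  (runState σ κ₁ κ₂ δ θn A θs a₀ t ξ).1

lemma runState_succ (t : Fin T) (ξ : Fin T → Noise d) :
    runState σ κ₁ κ₂ δ θn A θs a₀ (t + 1) ξ =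
      (A t (cell δ (runState σ κ₁ κ₂ δ θn A θs a₀ t ξ).2),
        (runState σ κ₁ κ₂ δ θn A θs a₀ t ξ).2 + lossVec σ κ₁ κ₂ θn
          ((runPair (runAction σ κ₁ κ₂ δ θn A θs a₀) t ξ, ξ t),
            runLabel σ θs (runAction σ κ₁ κ₂ δ θn A θs a₀) t ξ)) := by
  have h : runAction σ κ₁ κ₂ δ θn A θs a₀ t.succ ξ
      = A t (cell δ (runState σ κ₁ κ₂ δ θn A θs a₀ t ξ).2) := by
    simp only [runAction, Fin.val_succ]
    rw [runState, driven_succ]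
  simp only [runLabel, runPair, h]
  rw [runState, driven_succ]
  rfl

lemma runAction_succ (t : Fin T) (ξ : Fin T → Noise d) :
    runAction σ κ₁ κ₂ δ θn A θs a₀ t.succ ξ
      = A t (cell δ (runState σ κ₁ κ₂ δ θn A θs a₀ t ξ).2) := by
  simp only [runAction, Fin.val_succ, runState_succ]

lemma measurable_runState (hσ : IsSmoothActivation σ) (k : ℕ) :
    Measurable (runState (T := T) σ κ₁ κ₂ δ θn A θs a₀ k) := by
  refine measurable_driven (fun t => ?_) _ k
  have hA : Measurable (A t) := measurable_of_countable _
  have h1 : Measurable fun p : (Act d × (Fin (N + 1) → ℝ)) × Noise d => A t (cell δ p.1.2) :=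
    hA.comp ((measurable_cell δ).comp (by fun_prop))
  have h2 : Measurable fun p : (Act d × (Fin (N + 1) → ℝ)) × Noise d =>
      (((A t (cell δ p.1.2), p.1.1), p.2) : Pair d × Noise d) :=
    (h1.prodMk (by fun_prop)).prodMk measurable_snd
  exact h1.prodMk ((by fun_prop : Measurable
    fun p : (Act d × (Fin (N + 1) → ℝ)) × Noise d => p.1.2).add
    (Measurable.lossVec hσ κ₁ κ₂ θn (h2.prodMk (Measurable.predict hσ measurable_const h2))))

lemma cumLoss_run (ξ : Fin T → Noise d) (k : ℕ) (hk : k ≤ T) :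
    cumLoss σ κ₁ κ₂ θn (runPair (runAction σ κ₁ κ₂ δ θn A θs a₀))
      (runLabel σ θs (runAction σ κ₁ κ₂ δ θn A θs a₀)) k ξ
      = (runState σ κ₁ κ₂ δ θn A θs a₀ k ξ).2 := by
  induction k with
  | zero => rw [cumLoss_zero]; rfl
  | succ k ih =>
    have h1 := cumLoss_succ (σ := σ) (κ₁ := κ₁) (κ₂ := κ₂) (θn := θn)
      (x := runPair (runAction σ κ₁ κ₂ δ θn A θs a₀))
      (y := runLabel σ θs (runAction σ κ₁ κ₂ δ θn A θs a₀)) ⟨k, hk⟩ ξ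
    have h2 := runState_succ (σ := σ) (κ₁ := κ₁) (κ₂ := κ₂) (δ := δ) (θn := θn) (A := A) (θs := θs)
      (a₀ := a₀) ⟨k, hk⟩ ξ
    simp only at h1 h2
    rw [h1, h2, ih (Nat.le_of_succ_le hk)]

lemma isRun_runAction (hσ : IsSmoothActivation σ)
    {p : ℕ → (Fin (N + 1) → ℤ) → Fin (N + 1) → ℝ}
    (hp : ∀ t z, p t z ∈ stdSimplex ℝ (Fin (N + 1)))
    (hA : ∀ t z b, ∫ θ : Theta m d, reward σ (θ : Param m d) b ∂mixture θn (p t z)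
      ≤ ∫ θ : Theta m d, reward σ (θ : Param m d) (A t z) ∂mixture θn (p t z)) :
    IsRun (T := T) σ (gridLearner hσ κ₁ κ₂ δ θn p hp) θs a₀
      (runAction σ κ₁ κ₂ δ θn A θs a₀) where
  measurable t := (measurable_runState hσ t).fst
  init ξ := rfl
  predictable t ξ ξ' h := by
    have h1 : runState σ κ₁ κ₂ δ θn A θs a₀ t ξ = runState σ κ₁ κ₂ δ θn A θs a₀ t ξ' :=
      driven_congr _ fun s hs => ⟨rfl, h s hs⟩
    rw [runAction_succ, runAction_succ, h1]
  argmax t ξ b := by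
    rw [gridLearner_dist, cumLoss_history, cumLoss_run ξ t t.2.le, runAction_succ]
    exact hA _ _ _

end run

/-- There is a good learner for which the algorithm can be run. -/
theorem exists_learner (hσ : IsSmoothActivation σ) {ρ κ₁ κ₂ : ℝ} (hρ : 0 ≤ ρ) (hκ₁ : 0 ≤ κ₁)
    (hκ₂ : 0 ≤ κ₂) (T : ℕ) : ∃ R : Learner m d, HasGuarantee T ρ σ κ₁ κ₂ R ∧
      ∀ (θs : Param m d) (a₀ : Act d),
        ∃ a : Fin (T + 1) → (Fin T → Noise d) → Act d, IsRun σ R θs a₀ a := by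
  set M := ∫ w : Noise d, noiseSize w ∂roundLaw d with hM
  have hM1 : 1 ≤ M := by
    have := integral_mono (integrable_const (1 : ℝ)) (integrable_noiseSize (d := d))
      one_le_noiseSize
    simpa using this
  -- The grid costs `2 * δ` per round for the learner and `3 * δ` for the tree, the net costs `η *
  -- M`; either total is at most 1/2.
  set δ : ℝ := 1 / (10 * (T + 1)) with hδ
  set η : ℝ := 1 / (2 * (T + 1) * M) with hη
  have hδ0 : 0 < δ := by positivity
  have hη0 : 0 < η := by positivity
  obtain ⟨N, θn, hnet⟩ := exists_param_net (m := m) (d := d) (ρ := ρ) hσ hκ₁ hκ₂ hη0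
  have h𝒢 := isMoveClass_moves hσ hρ κ₁ κ₂ θn
  have hex := fun (t : ℕ) (z : Fin (N + 1) → ℤ) => exists_mixed_action (ν := roundLaw d)
    (isPotential_potential (ν := roundLaw d) h𝒢 (T - (t + 1))) h𝒢 (corner δ z)
  choose p hp hbest using hex
  choose A hA using fun (t : ℕ) (z : Fin (N + 1) → ℤ) => exists_argmax_mixture hσ θn (hp t z)
  refine ⟨gridLearner hσ κ₁ κ₂ δ θn p hp, fun x y h => ?_,
    fun θs a₀ => ⟨_, isRun_runAction hσ hp hA⟩⟩
  have h1 := h.onlineRegret_gridLearner_le hσ hρ hδ0 hp (fun t z g hg => by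
    have h2 : potential (roundLaw d) (moves ρ σ κ₁ κ₂ θn) (T - t)
        = gameStep (roundLaw d) (moves ρ σ κ₁ κ₂ θn)
          (potential (roundLaw d) (moves ρ σ κ₁ κ₂ θn) (T - (t + 1))) := by
      rw [show T - (t : ℕ) = T - (t + 1) + 1 by omega]; rfl
    rw [h2]
    exact hbest t z g hg) hnet
  have h2 := potential_le_seqRademacher hσ hρ κ₁ κ₂ θn T hδ0
  have e1 : T * (5 * δ) ≤ 1 / 2 := by
    have : (T : ℝ) * (5 * δ) = 1 / 2 * (T / (T + 1)) := by rw [hδ]; field_simp; ring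
    have h3 : (T : ℝ) / (T + 1) ≤ 1 := (div_le_one (by positivity)).2 (by linarith)
    linarith
  have e2 : T * (η * M) ≤ 1 / 2 := by
    have : (T : ℝ) * (η * M) = 1 / 2 * (T / (T + 1)) := by rw [hη]; field_simp
    have h3 : (T : ℝ) / (T + 1) ≤ 1 := (div_le_one (by positivity)).2 (by linarith)
    linarith
  linarith

end ViOlin

/-- Local and global regret of ViOlin on two-layer networks. Every action played in the rounds
`1, …, T` lies in the ball of radius `2`; the initial action may lie in any ball of radius `ρ ≥ 2`. On
that ball the rewards have gradients bounded by `1 + ρ`; their Hessians are bounded by `2` and are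
`1`-Lipschitz. The algorithm may be run with any upper bounds `ζg`, `ζh`, `ζ3` of these
quantities, and `κ₁ = 2 ζg`, `κ₂ = 640 √2 ζh`. -/
theorem mainTheorem8 (ρ ζg ζh ζ3 : ℝ) (hρ : 2 ≤ ρ) (hζg : 1 + ρ ≤ ζg) (hζh : 2 ≤ ζh)
    (hζ3 : 1 ≤ ζ3) :
    ∃ (K : ℝ) (q : ℕ), 0 < K ∧
      ∀ (m d T : ℕ) (σ : ℝ → ℝ), ViOlin.IsSmoothActivation σ →
        (∃ R : ViOlin.Learner m d,
          ViOlin.HasGuarantee T ρ σ (2 * ζg) (640 * √2 * ζh) R ∧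
          ∀ θs ∈ ViOlin.Theta m d, ∀ a₀ : ViOlin.Act d, ‖a₀‖ ≤ ρ →
            ∃ a : Fin (T + 1) → (Fin T → ViOlin.Noise d) → ViOlin.Act d,
              ViOlin.IsRun σ R θs a₀ a) ∧
        ∀ R : ViOlin.Learner m d,
          ViOlin.HasGuarantee T ρ σ (2 * ζg) (640 * √2 * ζh) R →
          ∀ θs ∈ ViOlin.Theta m d, ∀ a₀ : ViOlin.Act d, ‖a₀‖ ≤ ρ →
          ∀ a : Fin (T + 1) → (Fin T → ViOlin.Noise d) → ViOlin.Act d,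
            ViOlin.IsRun σ R θs a₀ a →
            (∀ ε : ℝ, 0 < ε → ε ≤ min 1 (ζ3 / 16) →
              MeasureTheory.Integrable
                (ViOlin.localRegret (ViOlin.reward σ θs) ε (6 * √(ζ3 * ε)) a)
                (ViOlin.noiseLaw d T) ∧
              ∫ ξ, ViOlin.localRegret (ViOlin.reward σ θs) ε (6 * √(ζ3 * ε)) a ξ
                  ∂ViOlin.noiseLaw d T
                ≤ K * Real.log (d * T + 2) ^ q * ε⁻¹ ^ 2 * (T : ℝ) ^ (3 / 4 : ℝ)) ∧
            (ConcaveOn ℝ (Metric.closedBall 0 2) (ViOlin.net σ θs) →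
              MeasureTheory.Integrable
                (ViOlin.globalRegret (ViOlin.reward σ θs) a) (ViOlin.noiseLaw d T) ∧
              ∫ ξ, ViOlin.globalRegret (ViOlin.reward σ θs) a ξ ∂ViOlin.noiseLaw d T
                ≤ K * Real.log (d * T + 2) ^ q * (T : ℝ) ^ (7 / 8 : ℝ)) := by
  have h2 : 1 ≤ √2 := Real.one_le_sqrt.2 one_le_two
  -- The progress argument needs only that the truncation levels are at least 2, the maximal size of
  -- the gradient and Hessian errors; otherwise they affect only `K`.
  have hκ₁ : 2 ≤ 2 * ζg := by linarith
  have hκ₂ : 2 ≤ 640 * √2 * ζh := by nlinarith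
  obtain ⟨K, hK, hmain⟩ := ViOlin.exists_regret_le hρ hκ₁ hκ₂
  refine ⟨K, 16, hK, fun m d T σ hσ => ⟨?_, fun R hR θs hθs a₀ ha₀ a ha => ?_⟩⟩
  · obtain ⟨R, hR, hrun⟩ := ViOlin.exists_learner (m := m) (d := d) hσ (ρ := ρ) (by linarith)
      (by linarith : 0 ≤ 2 * ζg) (by linarith : 0 ≤ 640 * √2 * ζh) T
    exact ⟨R, hR, fun θs _ a₀ _ => hrun θs a₀⟩
  · obtain ⟨hloc, hglob⟩ := hmain m d T σ hσ R hR θs hθs a₀ ha₀ a ha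
    refine ⟨fun ε hε hε1 => ⟨ha.integrable_localRegret hσ hθs _ _,
      hloc ε ζ3 hε (hε1.trans (min_le_left _ _)) hζ3⟩,
      fun hconc => ⟨ha.integrable_globalRegret hσ hθs, (hglob hconc).trans ?_⟩⟩
    have hlog : 0 ≤ Real.log ((d : ℝ) * T + 2) := by
      refine Real.log_nonneg ?_
      have : (0 : ℝ) ≤ (d : ℝ) * T := by positivity
      linarith
    refine mul_le_mul_of_nonneg_left ?_ (by positivity)
    -- The exponent 3/4 is relaxed to 7/8, which is legitimate for `1 ≤ T`; for `T = 0` both powers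
    -- are zero.
    rcases Nat.eq_zero_or_pos T with rfl | hT
    · rw [Nat.cast_zero, Real.zero_rpow (by norm_num), Real.zero_rpow (by norm_num)]
    · exact Real.rpow_le_rpow_of_exponent_le (by exact_mod_cast hT) (by norm_num)
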